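/- **Setting.** Let $\mathcal A,\mathcal B,\mathcal S$ be finite sets ($\mathcal A,\mathcal B\neq\emptyset$), $\mathcal X$ a standard Borel space, $\mathbf Q$ a probability distribution on $\mathcal X\times\mathcal S$, and $\mathbf m:\mathcal A\times\mathcal B\times\mathcal X\times\mathcal S\to\mathbb R^d$ a Borel function with $\|\mathbf m\|_{\infty,2}:=\sup_{a,b,x,s}\|\mathbf m(a,b,x,s)\|<\infty$; extend $\mathbf m$ bilinearly to probability distributions on $\mathcal A$ and $\mathcal B$. Let $G$ be either $G(x,s)=x$ or $G(x,s)=(x,s)$. In each round $t\ge1$ of a repeated game, contexts $(x_t,s_t)\sim\mathbf Q$ are drawn independently of the past; Nature observes $G(x_t,s_t)$ and the Player observes $x_t$; then they draw, independently of each other, $b_t\sim \mathbf q_t^{G(x_t,s_t)}$ and $a_t\sim\mathbf p_t^{x_t}$. Here the measurable family $(\mathbf p_t^x)_{x\in\mathcal X}$ of distributions on $\mathcal A$ is a measurable function of $h_{t-1}=(\mathbf m_{t'},x_{t'},s_{t'})_{t'\le t-1}$, where $\mathbf m_t=\mathbf m(a_t,b_t,x_t,s_t)$, and the measurable family $(\mathbf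 q_t^{G(x,s)})_{(x,s)}$ of distributions on $\mathcal B$ is a measurable function of $H_{t-1}=(a_{t'},b_{t'},x_{t'},s_{t'})_{t'\le t-1}$; these functions are the strategies of the Player and of Nature. Let $\mathcal C\subseteq\mathbb R^d$ be nonempty, closed and convex, $\Pi_{\mathcal C}$ the Euclidean projection onto $\mathcal C$, $\bar{\mathbf m}_T=\frac1T\sum_{t=1}^T\mathbf m_t$, $\bar{\mathbf c}_T=\Pi_{\mathcal C}(\bar{\mathbf m}_T)$ and $d_T=\|\bar{\mathbf m}_T-\bar{\mathbf c}_T\|$. The set $\mathcal C$ is *approachable* (under $\mathbf Q$) if the Player has a strategy such that $d_T\to0$ almost surely against every strategy of Nature. All families below are measurable. **Theorem.** (i) $\mathcal C$ is approachable if and only if $$\forall(\mathbf q^{G(x,s)})_{(x,s)\in\mathcal X\times\mathcal S}\ \ \exists(\mathbf p^x)_{x\in\mathcal X}:\quad \int_{\mathcal X\times\mathcal S}\mathbf m(\mathbf p^x,\mathbf q^{G(x,s)},x,s)\,d\mathbf Q(x,s)\in\mathcal C.\qquad(\ast)$$ (ii) Let $(\hat{\mathbf Q}_t)_{t\ge1}$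 be probability distributions on $\mathcal X\times\mathcal S$ such that $\hat{\mathbf Q}_t$ is a measurable function of $h_t$. A *plug-in Blackwell strategy* for $(\hat{\mathbf Q}_t)$ is a strategy of the Player such that, for every $t\ge1$ and every value of $h_t$, $$(\mathbf p_{t+1}^x)_x\in\operatorname*{argmin}_{(\mathbf p^x)_x}\ \sup_{(\mathbf q^{G(x,s)})_{(x,s)}}\Bigl\langle\bar{\mathbf m}_t-\bar{\mathbf c}_t,\int\mathbf m(\mathbf p^x,\mathbf q^{G(x,s)},x,s)\,d\hat{\mathbf Q}_t(x,s)\Bigr\rangle .$$ Such a strategy exists for every prescribed family $(\mathbf p_1^x)_x$ of the first round. (iii) Suppose that $(\ast)$ holds, that the Player uses a plug-in Blackwell strategy for $(\hat{\mathbf Q}_t)$ and Nature any strategy, and that, under the resulting law, $$\sum_{t\ge1}\frac{\delta_t}t<\infty,\qquad \delta_t:=\sqrt{\mathbb E\bigl[\mathrm{TV}^2(\hat{\mathbf Q}_t,\mathbf Q)\bigr]},\qquad \mathrm{TV}(\mu,\nu)=\sup_E|\mu(E)-\nu(E)| .$$ Put $\bar\Delta_T=\frac1T\sum_{t=1}^{T-1}\delta_t$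 and $$K=\sup\bigl\{\|v-\Pi_{\mathcal C}(w)\|^2:\ v\in\mathbf m(\mathcal A,\mathcal B,\mathcal X,\mathcal S),\ w\in\operatorname{conv}\mathbf m(\mathcal A,\mathcal B,\mathcal X,\mathcal S)\bigr\}<\infty .$$ Then $d_T\to0$ almost surely; for all $T\ge1$, $$\sqrt{\mathbb E[d_T^2]}\le\sqrt{\frac KT}+4\|\mathbf m\|_{\infty,2}\,\bar\Delta_T ;$$ and for all $T\ge2$ and $\varepsilon>0$, $$\mathbb P\Bigl(\sup_{t\ge T}d_t\ge\varepsilon\Bigr)\le\frac{3K}{T\varepsilon^2}+\frac{16\|\mathbf m\|_{\infty,2}}{\varepsilon^2}\Biggl(\sqrt{\frac K{T-1}}+2\|\mathbf m\|_{\infty,2}\Bigl(\sup_{t\ge T}\bar\Delta_t\Bigr)\Bigl(\bar\Delta_T+\sum_{t\ge T}\frac{\delta_t}t\Bigr)\Biggr).$$ -/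

import Mathlib

open MeasureTheory ProbabilityTheory Filter Topology

namespace FairApproach

/-- What Nature observes of the contexts: only `x` (`unaware`) or both `x` and `s` (`aware`). -/
inductive Monitoring where
  | unaware
  | aware

/-- The observation operator `G`: `G (x, s) = x` for an unaware Nature (left summand),
`G (x, s) = (x, s)` for an aware Nature (right summand). -/
def Monitoring.obs {X S : Type*} : Monitoring → X × S → X ⊕ (X × S)
  | .unaware, z => Sum.inl z.1
  | .aware, z => Sum.inr z

theorem Monitoring.measurable_obs {X S : Type*} [MeasurableSpace X] [MeasurableSpace S]
    (G : Monitoring) : Measurable (G.obs : X × S → X ⊕ (X × S)) := by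
  cases G
  · exact measurable_inl.comp measurable_fst
  · exact measurable_inr

/-- A measurable family `(μ^y)_{y ∈ Y}` of probability distributions over `Z`. -/
abbrev MeasFamily (Y Z : Type*) [MeasurableSpace Y] [MeasurableSpace Z] : Type _ :=
  {κ : Kernel Y Z // IsMarkovKernel κ}

/-- The total variation distance, `sup_E |μ E - ν E|` over measurable sets `E`. -/
noncomputable def tvDist {Y : Type*} [MeasurableSpace Y] (μ ν : Measure Y) : ℝ :=
  ⨆ E : {E : Set Y // MeasurableSet E}, |μ.real E - ν.real E|

open Classical in
/-- The Euclidean projection onto `C` (unique if `C` is nonempty, closed and convex; the value is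
irrelevant if there is no closest point). -/
noncomputable def proj {E : Type*} [NormedAddCommGroup E] (C : Set E) (v : E) : E :=
  if h : ∃ c ∈ C, ∀ c' ∈ C, ‖v - c‖ ≤ ‖v - c'‖ then h.choose else 0

/-- The data of the repeated game: Borel payoff function and observation operator of Nature. -/
structure Game (A B X S : Type*) [MeasurableSpace X] [MeasurableSpace S] (d : ℕ) where
  /-- the vector payoff `m(a, b, x, s)` -/
  payoff : A → B → X → S → EuclideanSpace ℝ (Fin d)
  measurable_payoff : ∀ a b, Measurable fun z : X × S => payoff a b z.1 z.2
  /-- the observation operator of Nature -/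
  G : Monitoring

/-- The outcome `((x, s), (a, b))` of one round. -/
abbrev Round (A B X S : Type*) : Type _ := (X × S) × (A × B)

/-- The full history `H_t` of the first `t` rounds. -/
abbrev FullHistory (A B X S : Type*) (t : ℕ) : Type _ := Fin t → Round A B X S

/-- The Player's information `h_t` after `t` rounds: the triples `(m_t', x_t', s_t')`. -/
abbrev PlayerHistory (X S : Type*) (d t : ℕ) : Type _ :=
  Fin t → EuclideanSpace ℝ (Fin d) × X × S

section Strategies

variable (A B X S : Type*) [MeasurableSpace A] [MeasurableSpace B] [MeasurableSpace X]
  [MeasurableSpace S]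

/-- A strategy of the Player: for every number `t` of past rounds, the mixed action
`p_{t+1}^x` as a jointly measurable function of the information `h_t` and of `x`. -/
abbrev PlayerStrategy (d : ℕ) : Type _ := ∀ t : ℕ, MeasFamily (PlayerHistory X S d t × X) A

/-- A strategy of Nature: for every number `t` of past rounds, the mixed action
`q_{t+1}^{G(x,s)}` as a jointly measurable function of the full history `H_t` and of `G(x,s)`. -/
abbrev NatureStrategy : Type _ :=
  ∀ t : ℕ, MeasFamily (FullHistory A B X S t × (X ⊕ (X × S))) B

/-- A sequence of estimates of the context distribution adapted to the Player's information:
the estimate after `t` rounds is a measurable function of `h_t`. -/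
abbrev Estimator (d : ℕ) : Type _ := ∀ t : ℕ, MeasFamily (PlayerHistory X S d t) (X × S)

end Strategies

/-- The average payoff `m̄_t` as a function of the Player's information. -/
noncomputable def avgPayoff {X S : Type*} {d t : ℕ} (h : PlayerHistory X S d t) :
    EuclideanSpace ℝ (Fin d) :=
  (t : ℝ)⁻¹ • ∑ i, (h i).1

namespace Game

section Basic

variable {A B X S : Type*} [MeasurableSpace X] [MeasurableSpace S] {d : ℕ} (Γ : Game A B X S d)

/-- The payoff function is bounded. -/
def BoundedPayoff : Prop := ∃ M : ℝ, ∀ a b x s, ‖Γ.payoff a b x s‖ ≤ M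

/-- The set `m(A, B, X, S)` of all payoff vectors. -/
def payoffSet : Set (EuclideanSpace ℝ (Fin d)) := {v | ∃ a b x s, Γ.payoff a b x s = v}

/-- The supremum `‖m‖_{∞,2}` of the Euclidean norms of the payoffs. -/
noncomputable def supNorm : ℝ := sSup ((fun v => ‖v‖) '' Γ.payoffSet)

/-- The constant `K`: the supremum of the squared distances between a payoff vector and the
projection onto `C` of an average of payoff vectors. -/
noncomputable def constK (C : Set (EuclideanSpace ℝ (Fin d))) : ℝ :=
  sSup {r | ∃ v ∈ Γ.payoffSet, ∃ w ∈ convexHull ℝ Γ.payoffSet, r = ‖v - proj C w‖ ^ 2}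

/-- What the Player retains of one round: payoff, non-sensitive and sensitive contexts. -/
def playerObs (r : Round A B X S) : EuclideanSpace ℝ (Fin d) × X × S :=
  (Γ.payoff r.2.1 r.2.2 r.1.1 r.1.2, r.1.1, r.1.2)

/-- The Player's information `h_t` along a play `ω`, where `ω i` is the outcome of
round `i + 1`. -/
def playerHistory (ω : ℕ → Round A B X S) (t : ℕ) : PlayerHistory X S d t :=
  fun i => Γ.playerObs (ω i)

/-- The distance `d_T` of the average payoff to `C` after `T` rounds. -/
noncomputable def distTo (C : Set (EuclideanSpace ℝ (Fin d))) (ω : ℕ → Round A B X S) (T : ℕ) :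
    ℝ :=
  Metric.infDist (avgPayoff (Γ.playerHistory ω T)) C

end Basic

variable {A B X S : Type*} [Fintype A] [MeasurableSpace A] [MeasurableSingletonClass A]
  [Fintype B] [MeasurableSpace B] [MeasurableSingletonClass B]
  [MeasurableSpace X] [MeasurableSpace S] {d : ℕ} (Γ : Game A B X S d)

theorem measurable_playerObs : Measurable Γ.playerObs := by
  refine Measurable.prodMk ?_ measurable_fst
  exact measurable_from_prod_countable_left fun c : A × B => Γ.measurable_payoff c.1 c.2

/-- The bilinear extension `m(p, q, x, s)` to mixed actions. -/
noncomputable def mixedPayoff (p : Measure A) (q : Measure B) (x : X) (s : S) :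
    EuclideanSpace ℝ (Fin d) :=
  ∑ a, ∑ b, (p.real {a} * q.real {b}) • Γ.payoff a b x s

/-- `∫ m(p^x, q^{G(x,s)}, x, s) dρ(x, s)`. -/
noncomputable def expectedPayoff (ρ : Measure (X × S)) (p : MeasFamily X A)
    (q : MeasFamily (X ⊕ (X × S)) B) : EuclideanSpace ℝ (Fin d) :=
  ∫ z, Γ.mixedPayoff (p.1 z.1) (q.1 (Γ.G.obs z)) z.1 z.2 ∂ρ

/-- The Blackwell condition. -/
def BlackwellCondition (Q : Measure (X × S)) (C : Set (EuclideanSpace ℝ (Fin d))) : Prop :=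
  ∀ q : MeasFamily (X ⊕ (X × S)) B, ∃ p : MeasFamily X A, Γ.expectedPayoff Q p q ∈ C

/-- The law of round `t + 1` given the full history `H_t`: the contexts `(x, s)` have law `Q`
whatever the history; given them, `a` and `b` are independent with laws
`p_{t+1}^x` and `q_{t+1}^{G(x,s)}`. -/
noncomputable def roundKernel (Q : Measure (X × S)) (σ : PlayerStrategy A X S d)
    (τ : NatureStrategy A B X S) (t : ℕ) : Kernel (FullHistory A B X S t) (Round A B X S) :=
  Kernel.const (FullHistory A B X S t) Q ⊗ₖ
    (((σ t).1.comap (fun y : FullHistory A B X S t × (X × S) =>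
          ((fun i => Γ.playerObs (y.1 i) : PlayerHistory X S d t), y.2.1))
        (Measurable.prodMk
          (measurable_pi_lambda _ fun i =>
            Γ.measurable_playerObs.comp ((measurable_pi_apply i).comp measurable_fst))
          (measurable_fst.comp measurable_snd))) ×ₖ
      ((τ t).1.comap (fun y : FullHistory A B X S t × (X × S) => (y.1, Γ.G.obs y.2))
        (Measurable.prodMk measurable_fst (Γ.G.measurable_obs.comp measurable_snd))))

instance isMarkovKernel_roundKernel (Q : Measure (X × S)) [IsProbabilityMeasure Q]
    (σ : PlayerStrategy A X S d) (τ : NatureStrategy A B X S) (t : ℕ) :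
    IsMarkovKernel (Γ.roundKernel Q σ τ t) := by
  have := (σ t).2
  have := (τ t).2
  unfold roundKernel
  infer_instance

/-- The law of the whole play `(round 1, round 2, …)` when the Player uses `σ` and Nature
uses `τ`, given by the Ionescu-Tulcea theorem. -/
noncomputable def playLaw (Q : Measure (X × S)) [IsProbabilityMeasure Q]
    (σ : PlayerStrategy A X S d) (τ : NatureStrategy A B X S) : Measure (ℕ → Round A B X S) :=
  Kernel.trajMeasure (X := fun _ => Round A B X S)
    (Γ.roundKernel Q σ τ 0 (fun i => i.elim0))
    (fun n => (Γ.roundKernel Q σ τ (n + 1)).comap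
      (fun (H : ∀ _ : Finset.Iic n, Round A B X S) (i : Fin (n + 1)) =>
        H ⟨i.1, Finset.mem_Iic.2 (Nat.lt_succ_iff.1 i.2)⟩)
      (measurable_pi_lambda _ fun _ => measurable_pi_apply _))

/-- The strategy `σ` approaches `C` against `τ`: the average payoff converges to `C` a.s. -/
def Approaches (Q : Measure (X × S)) [IsProbabilityMeasure Q]
    (C : Set (EuclideanSpace ℝ (Fin d)))
    (σ : PlayerStrategy A X S d) (τ : NatureStrategy A B X S) : Prop :=
  ∀ᵐ ω ∂(Γ.playLaw Q σ τ), Tendsto (fun T => Γ.distTo C ω T) atTop (𝓝 0)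

/-- `C` is approachable by the Player under the context distribution `Q`. -/
def Approachable (Q : Measure (X × S)) [IsProbabilityMeasure Q]
    (C : Set (EuclideanSpace ℝ (Fin d))) : Prop :=
  ∃ σ : PlayerStrategy A X S d, ∀ τ : NatureStrategy A B X S, Γ.Approaches Q C σ τ

/-- The family `p` minimizes `max_q ⟨u, ∫ m(p^x, q^{G(x,s)}, x, s) dρ(x, s)⟩` over all
measurable families; for bounded payoffs the supremum is that of a bounded nonempty set. -/
def IsMinimaxFamily (ρ : Measure (X × S)) (u : EuclideanSpace ℝ (Fin d))
    (p : MeasFamily X A) : Prop :=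
  ∀ p' : MeasFamily X A,
    (⨆ q : MeasFamily (X ⊕ (X × S)) B, inner ℝ u (Γ.expectedPayoff ρ p q)) ≤
      ⨆ q : MeasFamily (X ⊕ (X × S)) B, inner ℝ u (Γ.expectedPayoff ρ p' q)

/-- The family `(p_{t+1}^x)_x` that the strategy `σ` plays after the history `h` of length `t`. -/
noncomputable def playerFamily (σ : PlayerStrategy A X S d) {t : ℕ} (h : PlayerHistory X S d t) :
    MeasFamily X A :=
  ⟨(σ t).1.comap (fun x => (h, x)) measurable_prodMk_left, by
    have := (σ t).2
    infer_instance⟩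

/-- `σ` is a plug-in Blackwell strategy for the estimates `Qhat`: after every `t ≥ 1` rounds it
plays a minimax family for the estimate of the context distribution and the direction
`m̄_t - c̄_t`. The first round is arbitrary. -/
def IsBlackwellStrategy (C : Set (EuclideanSpace ℝ (Fin d))) (Qhat : Estimator X S d)
    (σ : PlayerStrategy A X S d) : Prop :=
  ∀ t : ℕ, 1 ≤ t → ∀ h : PlayerHistory X S d t,
    Γ.IsMinimaxFamily ((Qhat t).1 h) (avgPayoff h - proj C (avgPayoff h)) (playerFamily σ h)

/-- `√(E[TV²(Qhat_t, Q)])` when the Player uses `σ` and Nature uses `τ`. -/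
noncomputable def tvError (Q : Measure (X × S)) [IsProbabilityMeasure Q]
    (σ : PlayerStrategy A X S d) (τ : NatureStrategy A B X S) (Qhat : Estimator X S d)
    (t : ℕ) : ℝ :=
  √(∫ ω, tvDist ((Qhat t).1 (Γ.playerHistory ω t)) Q ^ 2 ∂(Γ.playLaw Q σ τ))

/-- The estimation is fast enough: `∑_{t ≥ 1} (1/t) √(E[TV²(Qhat_t, Q)]) < ∞`. -/
def FastEstimation (Q : Measure (X × S)) [IsProbabilityMeasure Q]
    (σ : PlayerStrategy A X S d) (τ : NatureStrategy A B X S) (Qhat : Estimator X S d) : Prop :=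
  Summable fun k : ℕ => Γ.tvError Q σ τ Qhat (k + 1) / ((k + 1 : ℕ) : ℝ)

/-- `Δ̄_T = (1/T) ∑_{t=1}^{T-1} √(E[TV²(Qhat_t, Q)])`. -/
noncomputable def avgTvError (Q : Measure (X × S)) [IsProbabilityMeasure Q]
    (σ : PlayerStrategy A X S d) (τ : NatureStrategy A B X S) (Qhat : Estimator X S d)
    (T : ℕ) : ℝ :=
  (1 / (T : ℝ)) * ∑ t ∈ Finset.Ico 1 T, Γ.tvError Q σ τ Qhat t

end Game

end FairApproach

/-! The sufficiency half and the rates follow Blackwell. With `u = m̄_t - c̄_t`, comparing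
`m̄_{t+1}` with the old projection `c̄_t` gives `(t+1)² d_{t+1}² ≤ t² d_t² + K + 2t ⟨u, m_{t+1} -
c̄_t⟩`. Given the past, the mean of the payoff in the last term is the expected payoff of the two
families in play. Nature's optimal family for `Q` and `u` has, by the Blackwell condition, an answer
with payoff in `C`, hence in the half-space `⟨u, · - c̄_t⟩ ≤ 0`. A saddle point turns this into one
family of the Player that stays in the half-space against all families of Nature. Playing the
minimax family of an estimate instead costs two changes of measure, together `4 ‖m‖ d_t TV`
(`inner_expectedPayoff_sub_proj_le`). Cauchy–Schwarz then gives a recursion for `E[d_t²]`, and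
completing a square solves it (`sqrt_le_of_sq_recursion`).

The same recursion holds when weighted by a `[0,1]`-valued function of the past
(`integral_weighted_sq_distTo_succ_le`). With the indicator of not having left the `ε`-neighbourhood
since round `T`, it controls the stopped squared distance, and Markov's inequality yields the
maximal inequality. Its bound tends to 0 by a Kronecker-type lemma, which gives almost sure
convergence.

The saddle point needs no minimax theorem on function spaces (`exists_saddle_families`). After
disintegration over `x`, the game splits into finite matrix games whose columns are Nature's pure
responses `S → B` (constant ones if Nature is unaware). Solutions are selected measurably as the
zeros of least norm of a Carathéodory function (`exists_measurable_zero`). The parameter of the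
selection may be the whole history, which also yields the existence of plug-in strategies.

For necessity, Nature repeats a fixed family `q`. The payoffs attainable against `q` form a closed
convex set `R`: the image under a continuous linear map of the bounded closed convex set of
simplex-valued functions in `L²`. Expected average payoffs lie in `R`, the expectations of their
projections lie in `C`, and the difference tends to 0. Hence a limit point lies in `R ∩ C`. -/

namespace FairApproach

/-! ### Measurable selection by regularization -/

section Selection

/-- In an inner product space, a convex set has at most one element of minimal norm. -/
theorem eq_of_norm_le_of_convex {E : Type*} [NormedAddCommGroup E] [InnerProductSpace ℝ E]
    {Z : Set E} (hZ : Convex ℝ Z) {z w : E} (hz : z ∈ Z) (hw : w ∈ Z)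
    (hmin : ∀ z' ∈ Z, ‖z‖ ≤ ‖z'‖) (hwz : ‖w‖ ≤ ‖z‖) : w = z := by
  by_contra hne
  have hmid : (1 / 2 : ℝ) • w + (1 / 2 : ℝ) • z ∈ Z :=
    hZ hw hz (by norm_num) (by norm_num) (by norm_num)
  have hlt := norm_combo_lt_of_ne (x := w) (y := z) (r := ‖z‖) hwz le_rfl hne
    (a := 1 / 2) (b := 1 / 2) (by norm_num) (by norm_num) (by norm_num)
  exact absurd (hmin _ hmid) (not_le.2 hlt)

/-- Measurable selection of a zero of a nonnegative Carathéodory function on a compact set, when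
the sets of zeros are convex: the zero of minimal norm is measurable. -/
theorem exists_measurable_zero {Y E : Type*} [MeasurableSpace Y] [NormedAddCommGroup E]
    [InnerProductSpace ℝ E] [MeasurableSpace E] [BorelSpace E]
    {K : Set E} (hK : IsCompact K) {F : Y → E → ℝ}
    (hmeas : ∀ z ∈ K, Measurable fun y => F y z) (hcont : ∀ y, ContinuousOn (F y) K)
    (hnn : ∀ y, ∀ z ∈ K, 0 ≤ F y z) (hconv : ∀ y, Convex ℝ {z | z ∈ K ∧ F y z = 0})
    (hzero : ∀ y, ∃ z ∈ K, F y z = 0) :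
    ∃ f : Y → E, Measurable f ∧ ∀ y, f y ∈ K ∧ F y (f y) = 0 := by
  rcases isEmpty_or_nonempty Y with hY | ⟨⟨y₀⟩⟩
  · exact ⟨fun y => hY.elim y, measurable_of_empty _, fun y => hY.elim y⟩
  have : CompactSpace K := isCompact_iff_compactSpace.1 hK
  obtain ⟨w₀, hw₀, -⟩ := hzero y₀
  have : Nonempty K := ⟨⟨w₀, hw₀⟩⟩
  let e : ℕ → K := TopologicalSpace.denseSeq K
  have he : DenseRange e := TopologicalSpace.denseRange_denseSeq K
  -- the regularized functions and their infima
  let g : ℕ → Y → E → ℝ := fun k y z => F y z + ‖z‖ ^ 2 / (k + 1)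
  have hgnn : ∀ k y, ∀ z ∈ K, 0 ≤ g k y z := fun k y z hz =>
    add_nonneg (hnn y z hz) (by positivity)
  have hgcont : ∀ k y, ContinuousOn (g k y) K := fun k y =>
    (hcont y).add (((continuous_norm.pow 2).div_const _).continuousOn)
  have hgmeas : ∀ k j, Measurable fun y => g k y (e j) := fun k j =>
    (hmeas _ (e j).2).add_const _
  let v : ℕ → Y → ℝ := fun k y => ⨅ j, g k y (e j)
  have hbdd : ∀ k y, BddBelow (Set.range fun j => g k y (e j)) := fun k y =>
    ⟨0, by rintro _ ⟨j, rfl⟩; exact hgnn k y _ (e j).2⟩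
  have hvmeas : ∀ k, Measurable (v k) := fun k => Measurable.iInf fun j => hgmeas k j
  have hvle : ∀ k y, ∀ z ∈ K, v k y ≤ g k y z := by
    intro k y z hz
    have hcl : IsClosed {w : K | v k y ≤ g k y w} :=
      isClosed_le continuous_const (continuousOn_iff_continuous_domRestrict.1 (hgcont k y))
    have := he.induction_on (p := fun w : K => v k y ≤ g k y w) ⟨z, hz⟩ hcl
      (fun j => ciInf_le (hbdd k y) j)
    exact this
  -- The tolerance `1/(k+1)²` is of smaller order than the weight `1/(k+1)` of `‖z‖²`: after
  -- division by this weight it still vanishes, so near-minimizers are driven to the zero of least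
  -- norm and not merely to some zero. Taking the first admissible index of the dense sequence makes
  -- the choice measurable.
  have hex : ∀ k y, ∃ j, g k y (e j) < v k y + 1 / ((k : ℝ) + 1) ^ 2 := fun k y =>
    exists_lt_of_ciInf_lt (lt_add_of_pos_right _ (by positivity))
  classical
  let f : ℕ → Y → E := fun k y => (e (Nat.find (hex k y)) : E)
  have hfmeas : ∀ k, Measurable (f k) := by
    intro k
    have h1 : Measurable fun y => Nat.find (hex k y) :=
      measurable_find (hex k) fun j =>
        measurableSet_lt (hgmeas k j) ((hvmeas k).add_const _)
    exact (measurable_from_nat (f := fun j => (e j : E))).comp h1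
  have hfK : ∀ k y, f k y ∈ K := fun k y => (e _).2
  have hfspec : ∀ k y, g k y (f k y) < v k y + 1 / ((k : ℝ) + 1) ^ 2 := fun k y =>
    Nat.find_spec (hex k y)
  -- the zero of minimal norm
  have hclz : ∀ y, IsCompact {z | z ∈ K ∧ F y z = 0} := by
    intro y
    have := (hcont y).preimage_isClosed_of_isClosed hK.isClosed (isClosed_singleton (x := (0 : ℝ)))
    exact hK.of_isClosed_subset this fun z hz => hz.1
  have hminex : ∀ y, ∃ z, (z ∈ K ∧ F y z = 0) ∧ ∀ z' ∈ {z | z ∈ K ∧ F y z = 0}, ‖z‖ ≤ ‖z'‖ := by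
    intro y
    obtain ⟨z, hz, hmin⟩ := (hclz y).exists_isMinOn (hzero y) continuous_norm.continuousOn
    exact ⟨z, hz, fun z' hz' => hmin hz'⟩
  choose zs hzs hmin using hminex
  have htend : ∀ y, Tendsto (fun k => f k y) atTop (𝓝 (zs y)) := by
    intro y
    have hbound : ∀ k, F y (f k y) + ‖f k y‖ ^ 2 / (k + 1) ≤
        ‖zs y‖ ^ 2 / (k + 1) + 1 / ((k : ℝ) + 1) ^ 2 := by
      intro k
      have h1 := hfspec k y
      have h2 := hvle k y (zs y) (hzs y).1
      simp only [g, (hzs y).2] at h1 h2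
      linarith
    have hlim0 : Tendsto (fun k : ℕ => 1 / ((k : ℝ) + 1)) atTop (𝓝 0) :=
      tendsto_one_div_add_atTop_nhds_zero_nat
    have hF : Tendsto (fun k => F y (f k y)) atTop (𝓝 0) := by
      have hup : Tendsto (fun k : ℕ => (‖zs y‖ ^ 2 + 1 / ((k : ℝ) + 1)) * (1 / ((k : ℝ) + 1)))
          atTop (𝓝 0) := by
        simpa using (hlim0.const_add (‖zs y‖ ^ 2)).mul hlim0
      refine squeeze_zero (fun k => hnn y _ (hfK k y)) (fun k => ?_) hup
      have h1 := hbound k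
      have h2 : 0 ≤ ‖f k y‖ ^ 2 / ((k : ℝ) + 1) := by positivity
      have h3 : (‖zs y‖ ^ 2 + 1 / ((k : ℝ) + 1)) * (1 / ((k : ℝ) + 1)) =
          ‖zs y‖ ^ 2 / (k + 1) + 1 / ((k : ℝ) + 1) ^ 2 := by
        field_simp
      linarith
    have hnorm : ∀ k, ‖f k y‖ ^ 2 ≤ ‖zs y‖ ^ 2 + 1 / ((k : ℝ) + 1) := by
      intro k
      have h1 := hbound k
      have h2 := hnn y _ (hfK k y)
      have h4 : (0 : ℝ) < (k : ℝ) + 1 := by positivity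
      have h3 : ‖f k y‖ ^ 2 / ((k : ℝ) + 1) ≤
          (‖zs y‖ ^ 2 + 1 / ((k : ℝ) + 1)) / ((k : ℝ) + 1) := by
        have : (‖zs y‖ ^ 2 + 1 / ((k : ℝ) + 1)) / ((k : ℝ) + 1) =
          ‖zs y‖ ^ 2 / (k + 1) + 1 / ((k : ℝ) + 1) ^ 2 := by field_simp
        linarith
      exact (div_le_div_iff_of_pos_right h4).1 h3
    -- In a compact set it suffices that every cluster point is `zs y`: it is a zero by `hF`, its
    -- norm is at most that of `zs y` by `hnorm`, and the least-norm zero is unique by convexity.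
    refine hK.tendsto_nhds_of_unique_mapClusterPt (Eventually.of_forall fun k => hfK k y) ?_
    intro w hw hcl
    obtain ⟨φ, hφ, hφw⟩ := MapClusterPt.tendsto_subseq hcl
    have hFw : F y w = 0 := by
      have h1 : Tendsto (fun k => F y (f (φ k) y)) atTop (𝓝 (F y w)) :=
        ((hcont y) w hw).tendsto.comp
          (tendsto_nhdsWithin_iff.2 ⟨hφw, Eventually.of_forall fun k => hfK _ y⟩)
      exact tendsto_nhds_unique h1 (hF.comp hφ.tendsto_atTop)
    have hnw : ‖w‖ ≤ ‖zs y‖ := by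
      have h1 : Tendsto (fun k => ‖f (φ k) y‖ ^ 2) atTop (𝓝 (‖w‖ ^ 2)) := (hφw.norm).pow 2
      have h2 : Tendsto (fun k : ℕ => ‖zs y‖ ^ 2 + 1 / (((φ k : ℕ) : ℝ) + 1)) atTop
          (𝓝 (‖zs y‖ ^ 2 + 0)) := (hlim0.comp hφ.tendsto_atTop).const_add _
      have h3 := le_of_tendsto_of_tendsto' h1 h2 fun k => hnorm (φ k)
      rw [add_zero] at h3
      exact (pow_le_pow_iff_left₀ (norm_nonneg _) (norm_nonneg _) two_ne_zero).1 h3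
    exact eq_of_norm_le_of_convex (hconv y) (hzs y) ⟨hw, hFw⟩ (hmin y) hnw
  exact ⟨zs, measurable_of_tendsto_metrizable hfmeas (tendsto_pi_nhds.2 htend), hzs⟩

end Selection

/-! ### Finite matrix games with a measurable parameter -/

section MatrixGame

variable {I J : Type*} [Fintype I] [Nonempty I] [Fintype J] [Nonempty J]

theorem sum_stdSimplex_mul_le {I : Type*} [Fintype I] {w : I → ℝ} (hw : w ∈ stdSimplex ℝ I)
    {c : I → ℝ} {r : ℝ} (h : ∀ i, c i ≤ r) : ∑ i, w i * c i ≤ r := by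
  calc ∑ i, w i * c i ≤ ∑ i, w i * r :=
        Finset.sum_le_sum fun i _ => mul_le_mul_of_nonneg_left (h i) (hw.1 i)
    _ = r := by rw [← Finset.sum_mul, hw.2, one_mul]

/-- Sion's theorem for the bilinear form on two simplices, with the row player minimizing; testing
the saddle point against vertices leaves finitely many linear inequalities. -/
theorem exists_saddle_matrix (N : I → J → ℝ) :
    ∃ p ∈ stdSimplex ℝ I, ∃ q ∈ stdSimplex ℝ J,
      ∀ i j, ∑ i', p i' * N i' j ≤ ∑ j', q j' * N i j' := by
  classical
  have hlinL : ∀ q : J → ℝ, IsLinearMap ℝ fun p : I → ℝ => ∑ i, ∑ j, p i * (q j * N i j) := by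
    intro q
    constructor
    · intro x y; simp [add_mul, Finset.sum_add_distrib]
    · intro c x; simp [Finset.mul_sum, mul_assoc]
  have hlinR : ∀ p : I → ℝ, IsLinearMap ℝ fun q : J → ℝ => ∑ i, ∑ j, p i * (q j * N i j) := by
    intro p
    constructor
    · intro x y; simp [add_mul, mul_add, Finset.sum_add_distrib]
    · intro c x; simp only [Pi.smul_apply, smul_eq_mul, Finset.mul_sum]
      refine Finset.sum_congr rfl fun i _ => Finset.sum_congr rfl fun j _ => by ring
  have hneI : (stdSimplex ℝ I).Nonempty := ⟨_, single_mem_stdSimplex ℝ (Classical.arbitrary I)⟩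
  have hneJ : (stdSimplex ℝ J).Nonempty := ⟨_, single_mem_stdSimplex ℝ (Classical.arbitrary J)⟩
  obtain ⟨p, hp, q, hq, hpq⟩ := Sion.exists_isSaddlePointOn
    (f := fun (p : I → ℝ) (q : J → ℝ) => ∑ i, ∑ j, p i * (q j * N i j))
    hneI (convex_stdSimplex ℝ I) (isCompact_stdSimplex ℝ I)
    (fun q _ => Continuous.lowerSemicontinuous (by fun_prop) |>.lowerSemicontinuousOn _)
    (fun q _ => (((hlinL q).mk' _).convexOn (convex_stdSimplex ℝ I)).quasiconvexOn)
    (convex_stdSimplex ℝ J) hneJ (isCompact_stdSimplex ℝ J)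
    (fun p _ => Continuous.upperSemicontinuous (by fun_prop) |>.upperSemicontinuousOn _)
    (fun p _ => (((hlinR p).mk' _).concaveOn (convex_stdSimplex ℝ J)).quasiconcaveOn)
  refine ⟨p, hp, q, hq, fun i j => ?_⟩
  have h := hpq (Pi.single i 1) (single_mem_stdSimplex ℝ i) (Pi.single j 1)
    (single_mem_stdSimplex ℝ j)
  simpa [Pi.single_apply] using h

/-- A measurable family of finite matrix games has measurable optimal mixed actions. -/
theorem exists_measurable_saddle_matrix {Y : Type*} [MeasurableSpace Y] {N : Y → I → J → ℝ}
    (hN : ∀ i j, Measurable fun y => N y i j) :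
    ∃ (p : Y → I → ℝ) (q : Y → J → ℝ), Measurable p ∧ Measurable q ∧
      (∀ y, p y ∈ stdSimplex ℝ I) ∧ (∀ y, q y ∈ stdSimplex ℝ J) ∧
      ∀ y i j, ∑ i', p y i' * N y i' j ≤ ∑ j', q y j' * N y i j' := by
  -- Both mixed actions are packed into one Euclidean vector, so that the selection theorem for
  -- inner product spaces applies. The sum `F` of positive parts vanishes exactly when all saddle
  -- inequalities hold; these are linear in `z`, whence the convexity of the zero set.
  let K : Set (EuclideanSpace ℝ (I ⊕ J)) := {z | (fun i => z (Sum.inl i)) ∈ stdSimplex ℝ I ∧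
    (fun j => z (Sum.inr j)) ∈ stdSimplex ℝ J}
  let l : Y → I × J → EuclideanSpace ℝ (I ⊕ J) → ℝ := fun y ij z =>
    ∑ i', z (Sum.inl i') * N y i' ij.2 - ∑ j', z (Sum.inr j') * N y ij.1 j'
  let F : Y → EuclideanSpace ℝ (I ⊕ J) → ℝ := fun y z => ∑ ij : I × J, max (l y ij z) 0
  have hFzero : ∀ y z, F y z = 0 ↔ ∀ ij, l y ij z ≤ 0 := by
    intro y z
    simp only [F]
    rw [Finset.sum_eq_zero_iff_of_nonneg (fun ij _ => le_max_right _ _)]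
    simp
  have hKclosed : IsClosed K := by
    have h1 : Continuous fun z : EuclideanSpace ℝ (I ⊕ J) => fun i => z (Sum.inl i : I ⊕ J) := by fun_prop
    have h2 : Continuous fun z : EuclideanSpace ℝ (I ⊕ J) => fun j => z (Sum.inr j : I ⊕ J) := by fun_prop
    exact ((isCompact_stdSimplex ℝ I).isClosed.preimage h1).inter
      ((isCompact_stdSimplex ℝ J).isClosed.preimage h2)
  have hKc : IsCompact K := by
    have h1 : IsCompact (Set.pi Set.univ fun _ : I ⊕ J => Set.Icc (0 : ℝ) 1) :=
      isCompact_univ_pi fun _ => isCompact_Icc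
    have h2 := (EuclideanSpace.equiv (I ⊕ J) ℝ).toHomeomorph.isCompact_preimage.2 h1
    refine h2.of_isClosed_subset hKclosed fun z hz => ?_
    rintro (i | j) -
    · exact ⟨hz.1.1 i, (mem_Icc_of_mem_stdSimplex hz.1 i).2⟩
    · exact ⟨hz.2.1 j, (mem_Icc_of_mem_stdSimplex hz.2 j).2⟩
  have hKconv : Convex ℝ K := by
    intro z hz w hw a b ha hb hab
    exact ⟨convex_stdSimplex ℝ I hz.1 hw.1 ha hb hab, convex_stdSimplex ℝ J hz.2 hw.2 ha hb hab⟩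
  have hllin : ∀ y ij (z w : EuclideanSpace ℝ (I ⊕ J)) (a b : ℝ),
      l y ij (a • z + b • w) = a * l y ij z + b * l y ij w := by
    intro y ij z w a b
    simp only [l, PiLp.add_apply, PiLp.smul_apply, smul_eq_mul, add_mul, Finset.sum_add_distrib,
      mul_sub, Finset.mul_sum, mul_assoc]
    ring
  obtain ⟨f, hf, hfK⟩ := exists_measurable_zero hKc (F := F)
    (fun z _ => by
      simp only [F, l]
      fun_prop)
    (fun y => by
      refine Continuous.continuousOn ?_
      simp only [F, l]
      fun_prop)
    (fun y z _ => Finset.sum_nonneg fun ij _ => le_max_right _ _)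
    (fun y z hz w hw a b ha hb hab => by
      refine ⟨hKconv hz.1 hw.1 ha hb hab, (hFzero _ _).2 fun ij => ?_⟩
      rw [hllin]
      have h1 := (hFzero _ _).1 hz.2 ij
      have h2 := (hFzero _ _).1 hw.2 ij
      nlinarith)
    (fun y => by
      obtain ⟨p, hp, q, hq, hpq⟩ := exists_saddle_matrix (N y)
      refine ⟨WithLp.toLp 2 (Sum.elim p q), ⟨hp, hq⟩, (hFzero _ _).2 fun ij => ?_⟩
      have := hpq ij.1 ij.2
      simpa [l] using this)
  refine ⟨fun y i => f y (Sum.inl i), fun y j => f y (Sum.inr j), ?_, ?_,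
    fun y => (hfK y).1.1, fun y => (hfK y).1.2, fun y i j => ?_⟩
  · exact measurable_pi_lambda _ fun i =>
      (Continuous.measurable (f := fun z : EuclideanSpace ℝ (I ⊕ J) => z (Sum.inl i : I ⊕ J)) (by fun_prop)).comp hf
  · exact measurable_pi_lambda _ fun j =>
      (Continuous.measurable (f := fun z : EuclideanSpace ℝ (I ⊕ J) => z (Sum.inr j : I ⊕ J)) (by fun_prop)).comp hf
  · exact sub_nonpos.1 ((hFzero _ _).1 (hfK y).2 (i, j))

end MatrixGame

/-! ### Total variation: integrals and measurability -/

section TotalVariation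

theorem tvDist_comm {Y : Type*} [MeasurableSpace Y] (μ ν : Measure Y) :
    tvDist μ ν = tvDist ν μ := by
  simp only [tvDist, abs_sub_comm]

theorem tvDist_self {Y : Type*} [MeasurableSpace Y] (μ : Measure Y) : tvDist μ μ = 0 := by
  simp [tvDist]

variable {Y : Type*} [MeasurableSpace Y] (μ ν : Measure Y) [IsProbabilityMeasure μ]
  [IsProbabilityMeasure ν]

theorem abs_real_sub_real_le_one (E : Set Y) : |μ.real E - ν.real E| ≤ 1 := by
  have h1 : μ.real E ≤ 1 := measureReal_le_one
  have h2 : ν.real E ≤ 1 := measureReal_le_one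
  have h3 : 0 ≤ μ.real E := measureReal_nonneg
  have h4 : 0 ≤ ν.real E := measureReal_nonneg
  exact abs_le.2 ⟨by linarith, by linarith⟩

theorem bddAbove_range_tvDist :
    BddAbove (Set.range fun E : {E : Set Y // MeasurableSet E} => |μ.real E - ν.real E|) :=
  ⟨1, by rintro _ ⟨E, rfl⟩; exact abs_real_sub_real_le_one μ ν E⟩

theorem abs_real_sub_real_le_tvDist {E : Set Y} (hE : MeasurableSet E) :
    |μ.real E - ν.real E| ≤ tvDist μ ν :=
  le_ciSup (bddAbove_range_tvDist μ ν) ⟨E, hE⟩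

theorem tvDist_nonneg : 0 ≤ tvDist μ ν :=
  (abs_nonneg _).trans (abs_real_sub_real_le_tvDist μ ν MeasurableSet.empty)

theorem tvDist_le_one : tvDist μ ν ≤ 1 := by
  have : Nonempty {E : Set Y // MeasurableSet E} := ⟨⟨∅, MeasurableSet.empty⟩⟩
  exact ciSup_le fun E => abs_real_sub_real_le_one μ ν E

/-- The layer-cake formula, cut at `c` because the superlevel sets above `c` are empty. The bounded
range of levels lets a uniform bound on set probabilities be integrated. -/
theorem integral_eq_intervalIntegral_meas_lt {f : Y → ℝ} (hf : Measurable f) {c : ℝ}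
    (h0 : ∀ y, 0 ≤ f y) (hc : ∀ y, f y ≤ c) :
    ∫ y, f y ∂μ = ∫ t in (0 : ℝ)..c, μ.real {y | t < f y} := by
  have hY : Nonempty Y := μ.nonempty_of_neZero
  have hc0 : 0 ≤ c := (h0 hY.some).trans (hc _)
  have hint : Integrable f μ := by
    refine Integrable.of_bound hf.aestronglyMeasurable c (Eventually.of_forall fun y => ?_)
    rw [Real.norm_eq_abs, abs_of_nonneg (h0 y)]
    exact hc y
  rw [hint.integral_eq_integral_meas_lt (Eventually.of_forall h0),
    intervalIntegral.integral_of_le hc0]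
  refine (setIntegral_eq_of_subset_of_forall_sdiff_eq_zero measurableSet_Ioi
    (fun t ht => ht.1) fun t ht => ?_)
  have : {y | t < f y} = ∅ := by
    ext y
    simp only [Set.mem_ofPred_eq, Set.mem_empty_iff_false, iff_false, not_lt]
    have h1 : ¬ t ≤ c := fun h => ht.2 ⟨ht.1, h⟩
    exact (hc y).trans (le_of_lt (not_le.1 h1))
  simp [this]

theorem antitone_real_lt {f : Y → ℝ} : Antitone fun t : ℝ => μ.real {y | t < f y} :=
  fun _ _ hst => measureReal_mono fun _ hy => lt_of_le_of_lt hst hy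

/-- Integrals of a function bounded by `c` under two probability measures differ by at most
`2 * c` times the total variation distance. -/
theorem integral_sub_integral_le_tvDist {f : Y → ℝ} (hf : Measurable f) {c : ℝ}
    (hc : ∀ y, |f y| ≤ c) : ∫ y, f y ∂μ - ∫ y, f y ∂ν ≤ 2 * c * tvDist μ ν := by
  have hY : Nonempty Y := μ.nonempty_of_neZero
  have hc0 : 0 ≤ c := (abs_nonneg _).trans (hc hY.some)
  have hint : ∀ (ρ : Measure Y) [IsProbabilityMeasure ρ], Integrable f ρ := fun ρ _ =>
    Integrable.of_bound hf.aestronglyMeasurable c (Eventually.of_forall hc)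
  -- The shift by `c` moves the values into `[0, 2c]`; the length of this interval is the factor in
  -- the bound, and the shift cancels in the difference.
  have key : ∀ (ρ : Measure Y) [IsProbabilityMeasure ρ],
      ∫ y, f y ∂ρ = (∫ t in (0 : ℝ)..(2 * c), ρ.real {y | t < f y + c}) - c := by
    intro ρ _
    rw [← integral_eq_intervalIntegral_meas_lt ρ (f := fun y => f y + c) (hf.add_const c)
      (fun y => by linarith [(abs_le.1 (hc y)).1]) (fun y => by linarith [(abs_le.1 (hc y)).2]),
      integral_add (hint ρ) (integrable_const c)]
    simp
  have hii : ∀ (ρ : Measure Y) [IsProbabilityMeasure ρ],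
      IntervalIntegrable (fun t => ρ.real {y | t < f y + c}) volume 0 (2 * c) := fun ρ _ =>
    (antitone_real_lt ρ).intervalIntegrable
  rw [key μ, key ν, sub_sub_sub_cancel_right, ← intervalIntegral.integral_sub (hii μ) (hii ν)]
  calc ∫ t in (0 : ℝ)..(2 * c), (μ.real {y | t < f y + c} - ν.real {y | t < f y + c})
      ≤ ∫ _ in (0 : ℝ)..(2 * c), tvDist μ ν := by
        refine intervalIntegral.integral_mono_on (by linarith) ((hii μ).sub (hii ν))
          intervalIntegrable_const fun t _ => ?_
        exact (le_abs_self _).trans (abs_real_sub_real_le_tvDist μ ν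
          (measurableSet_lt measurable_const (hf.add_const c)))
    _ = 2 * c * tvDist μ ν := by simp

/-- The total variation distance to a fixed measure is measurable along a Markov kernel. -/
theorem measurable_tvDist [MeasurableSpace.CountablyGenerated Y] {Z : Type*} [MeasurableSpace Z]
    (κ : Kernel Z Y) [IsMarkovKernel κ] : Measurable fun z => tvDist (κ z) ν := by
  let 𝒜 : Set (Set Y) := generateSetAlgebra (MeasurableSpace.countableGeneratingSet Y)
  have halg : IsSetAlgebra 𝒜 := isSetAlgebra_generateSetAlgebra
  have hgen : (inferInstance : MeasurableSpace Y) = MeasurableSpace.generateFrom 𝒜 := by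
    rw [generateFrom_generateSetAlgebra_eq, MeasurableSpace.generateFrom_countableGeneratingSet]
  have hcount : 𝒜.Countable :=
    countable_generateSetAlgebra MeasurableSpace.countable_countableGeneratingSet
  have hms : ∀ E ∈ 𝒜, MeasurableSet E := fun E hE => by
    have := MeasurableSpace.measurableSet_generateFrom hE
    rwa [← hgen] at this
  have : Nonempty 𝒜 := ⟨⟨∅, halg.empty_mem⟩⟩
  have : Countable 𝒜 := hcount.to_subtype
  have key : ∀ z, tvDist (κ z) ν = ⨆ E : 𝒜, |(κ z).real E - ν.real E| := by
    intro z
    have hbdd : BddAbove (Set.range fun E : 𝒜 => |(κ z).real E - ν.real E|) :=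
      ⟨1, by rintro _ ⟨E, rfl⟩; exact abs_real_sub_real_le_one _ ν E⟩
    have hne : Nonempty {E : Set Y // MeasurableSet E} := ⟨⟨∅, MeasurableSet.empty⟩⟩
    refine le_antisymm (ciSup_le fun E => ?_)
      (ciSup_le fun E => abs_real_sub_real_le_tvDist (κ z) ν (hms E E.2))
    refine le_of_forall_pos_le_add fun ε hε => ?_
    -- Density with respect to the sum of the measures provides a single set of the countable
    -- algebra that approximates `E` under both at once. The supremum thus becomes countable, hence
    -- measurable in `z`.
    have hd := Measure.MeasureDense.of_generateFrom_isSetAlgebra_finite (κ z + ν) halg hgen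
    obtain ⟨F, hF, hlt⟩ := hd.approx E E.2 (measure_ne_top _ _) ε hε
    have hr : (κ z + ν).real (symmDiff E.1 F) ≤ ε := by
      rw [measureReal_def]
      exact ENNReal.toReal_le_of_le_ofReal hε.le hlt.le
    have h1 : |(κ z).real E - (κ z).real F| ≤ (κ z).real (symmDiff E.1 F) :=
      abs_measureReal_sub_le_measureReal_symmDiff' E.2.nullMeasurableSet
        (hms F hF).nullMeasurableSet (measure_ne_top _ _) (measure_ne_top _ _)
    have h2 : |ν.real E - ν.real F| ≤ ν.real (symmDiff E.1 F) :=
      abs_measureReal_sub_le_measureReal_symmDiff' E.2.nullMeasurableSet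
        (hms F hF).nullMeasurableSet (measure_ne_top _ _) (measure_ne_top _ _)
    have h3 : (κ z + ν).real (symmDiff E.1 F) =
        (κ z).real (symmDiff E.1 F) + ν.real (symmDiff E.1 F) := measureReal_add_apply
    have h4 := le_ciSup hbdd ⟨F, hF⟩
    have h5 : (κ z).real E - ν.real E = ((κ z).real F - ν.real F) +
        (((κ z).real E - (κ z).real F) - (ν.real E - ν.real F)) := by ring
    rw [h5]
    refine (abs_add_le _ _).trans (add_le_add h4 ((abs_sub _ _).trans ?_))
    linarith
  simp_rw [key]
  refine Measurable.iSup fun E => ?_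
  have : Measurable fun z => (κ z).real E :=
    (κ.measurable_coe (hms E E.2)).ennreal_toReal
  exact (this.sub_const _).abs

end TotalVariation

/-! ### Projection onto a closed convex set -/

section Projection

variable {E : Type*} [NormedAddCommGroup E] [InnerProductSpace ℝ E] [CompleteSpace E]
  {C : Set E}

theorem proj_spec (hne : C.Nonempty) (hcl : IsClosed C) (hcv : Convex ℝ C) (v : E) :
    proj C v ∈ C ∧ ∀ c ∈ C, ‖v - proj C v‖ ≤ ‖v - c‖ := by
  have h : ∃ c ∈ C, ∀ c' ∈ C, ‖v - c‖ ≤ ‖v - c'‖ := by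
    obtain ⟨c, hc, heq⟩ := exists_norm_eq_iInf_of_complete_convex hne hcl.isComplete hcv v
    refine ⟨c, hc, fun c' hc' => ?_⟩
    rw [heq]
    exact ciInf_le (f := fun w : C => ‖v - w‖) ⟨0, by rintro _ ⟨w, rfl⟩; exact norm_nonneg _⟩
      ⟨c', hc'⟩
  rw [proj, dif_pos h]
  exact h.choose_spec

variable (hne : C.Nonempty) (hcl : IsClosed C) (hcv : Convex ℝ C)
include hne hcl hcv

theorem proj_mem (v : E) : proj C v ∈ C := (proj_spec hne hcl hcv v).1

theorem norm_sub_proj_eq_infDist (v : E) : ‖v - proj C v‖ = Metric.infDist v C := by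
  obtain ⟨hm, hle⟩ := proj_spec hne hcl hcv v
  refine le_antisymm ((Metric.le_infDist hne).2 fun c hc => ?_) ?_
  · rw [dist_eq_norm]; exact hle c hc
  · rw [← dist_eq_norm]; exact Metric.infDist_le_dist_of_mem hm

theorem inner_sub_proj_le_zero (v : E) {c : E} (hc : c ∈ C) :
    inner ℝ (v - proj C v) (c - proj C v) ≤ 0 := by
  obtain ⟨hm, hle⟩ := proj_spec hne hcl hcv v
  have : Nonempty C := hne.to_subtype
  refine (norm_eq_iInf_iff_real_inner_le_zero hcv hm).1 (le_antisymm ?_ ?_) c hc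
  · exact le_ciInf fun w => hle w w.2
  · exact ciInf_le (f := fun w : C => ‖v - w‖) ⟨0, by rintro _ ⟨w, rfl⟩; exact norm_nonneg _⟩
      ⟨_, hm⟩

/-- Adding the two variational inequalities gives `‖p - q‖² ≤ ⟨v - w, p - q⟩`, and Cauchy–Schwarz
finishes. Later this supplies both the measurability of `proj C` and its boundedness on bounded
sets. -/
theorem lipschitzWith_proj : LipschitzWith 1 (proj C) := by
  refine LipschitzWith.of_dist_le_mul fun v w => ?_
  rw [NNReal.coe_one, one_mul, dist_eq_norm, dist_eq_norm]
  have h1 := inner_sub_proj_le_zero hne hcl hcv v (proj_mem hne hcl hcv w)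
  have h2 := inner_sub_proj_le_zero hne hcl hcv w (proj_mem hne hcl hcv v)
  set p := proj C v
  set q := proj C w
  have h3 : ‖p - q‖ ^ 2 ≤ inner ℝ (v - w) (p - q) := by
    rw [← real_inner_self_eq_norm_sq]
    have e1 : inner ℝ (v - p) (q - p) + inner ℝ (w - q) (p - q) =
        inner ℝ (p - q) (p - q) - inner ℝ (v - w) (p - q) := by
      simp only [inner_sub_left, inner_sub_right]
      ring
    linarith
  have h4 := h3.trans (real_inner_le_norm (v - w) (p - q))
  by_contra hlt
  push Not at hlt
  nlinarith [norm_nonneg (v - w), norm_nonneg (p - q)]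

end Projection

/-! ### Closed images of bounded convex sets in Hilbert space -/

section NestedConvex

/-- A decreasing sequence of nonempty bounded closed convex sets of a Hilbert space has nonempty
intersection. -/
theorem nonempty_iInter_of_antitone_convex {E : Type*} [NormedAddCommGroup E]
    [InnerProductSpace ℝ E] [CompleteSpace E] {D : ℕ → Set E} (hanti : Antitone D)
    (hne : ∀ n, (D n).Nonempty) (hcl : ∀ n, IsClosed (D n)) (hcv : ∀ n, Convex ℝ (D n))
    (hbdd : Bornology.IsBounded (D 0)) : (⋂ n, D n).Nonempty := by
  let c : ℕ → E := fun n => proj (D n) 0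
  have hc : ∀ n, c n ∈ D n := fun n => proj_mem (hne n) (hcl n) (hcv n) 0
  have hmin : ∀ n, ∀ w ∈ D n, ‖c n‖ ≤ ‖w‖ := fun n w hw => by
    simpa using (proj_spec (hne n) (hcl n) (hcv n) 0).2 w hw
  obtain ⟨R, hR⟩ := hbdd.exists_norm_le
  have hmono : Monotone fun n => ‖c n‖ ^ 2 := fun n m hnm => by
    have := hmin n (c m) (hanti hnm (hc m))
    exact pow_le_pow_left₀ (norm_nonneg _) this 2
  have hbd : BddAbove (Set.range fun n => ‖c n‖ ^ 2) :=
    ⟨R ^ 2, by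
      rintro _ ⟨n, rfl⟩
      exact pow_le_pow_left₀ (norm_nonneg _) (hR _ (hanti (Nat.zero_le n) (hc n))) 2⟩
  have hlim := tendsto_atTop_ciSup hmono hbd
  set L := ⨆ n, ‖c n‖ ^ 2
  -- The midpoint of `c n` and `c m` lies in `D n`, so its norm is at least `‖c n‖`; the
  -- parallelogram law does the rest. As the squared norms increase to a finite limit, the
  -- least-norm points are Cauchy.
  have hpar : ∀ n m, n ≤ m → ‖c n - c m‖ ^ 2 ≤ 2 * (‖c m‖ ^ 2 - ‖c n‖ ^ 2) := by
    intro n m hnm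
    have hmid : (1 / 2 : ℝ) • c n + (1 / 2 : ℝ) • c m ∈ D n :=
      hcv n (hc n) (hanti hnm (hc m)) (by norm_num) (by norm_num) (by norm_num)
    have h1 := hmin n _ hmid
    rw [← smul_add, norm_smul, Real.norm_of_nonneg (by norm_num : (0 : ℝ) ≤ 1 / 2)] at h1
    have h2 := parallelogram_law_with_norm ℝ (c n) (c m)
    have h3 : ‖c n‖ ^ 2 ≤ (1 / 2 * ‖c n + c m‖) ^ 2 := pow_le_pow_left₀ (norm_nonneg _) h1 2
    nlinarith
  have hcau : CauchySeq c := by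
    rw [Metric.cauchySeq_iff']
    intro ε hε
    have hε2 : 0 < ε ^ 2 / 2 := by positivity
    obtain ⟨n, hn⟩ := (hlim.eventually (lt_mem_nhds (sub_lt_self L hε2))).exists
    refine ⟨n, fun m hm => ?_⟩
    have h1 := hpar n m hm
    have h2 : ‖c m‖ ^ 2 ≤ L := le_ciSup hbd m
    have h3 : ‖c n - c m‖ ^ 2 < ε ^ 2 := by linarith
    rw [dist_comm, dist_eq_norm]
    exact lt_of_pow_lt_pow_left₀ 2 hε.le h3
  obtain ⟨x, hx⟩ := cauchySeq_tendsto_of_complete hcau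
  refine ⟨x, Set.mem_iInter.2 fun n => (hcl n).mem_of_tendsto hx ?_⟩
  exact (eventually_ge_atTop n).mono fun m hm => hanti hm (hc m)

/-- A continuous linear image of a bounded closed convex set of a Hilbert space is closed. -/
theorem isClosed_image_of_convex {E F : Type*} [NormedAddCommGroup E] [InnerProductSpace ℝ E]
    [CompleteSpace E] [NormedAddCommGroup F] [NormedSpace ℝ F] (L : E →L[ℝ] F) {D : Set E}
    (hcl : IsClosed D) (hcv : Convex ℝ D) (hbdd : Bornology.IsBounded D) :
    IsClosed (L '' D) := by
  refine isClosed_of_closure_subset fun r hr => ?_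
  have hpos : ∀ n : ℕ, (0 : ℝ) < 1 / ((n : ℝ) + 1) := fun n => by positivity
  -- The slices of `D` over shrinking balls around `r` are nested, and any common point is mapped to
  -- `r`. This takes the place of weak compactness.
  obtain ⟨x, hx⟩ := nonempty_iInter_of_antitone_convex
    (D := fun n : ℕ => D ∩ L ⁻¹' Metric.closedBall r (1 / ((n : ℝ) + 1)))
    (fun n m hnm => Set.inter_subset_inter_right _ (Set.preimage_mono
      (Metric.closedBall_subset_closedBall (one_div_le_one_div_of_le (by positivity)
        (by simpa using hnm)))))
    (fun n => by
      obtain ⟨_, ⟨x, hx, rfl⟩, hlt⟩ := Metric.mem_closure_iff.1 hr _ (hpos n)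
      exact ⟨x, hx, by simpa [dist_comm] using hlt.le⟩)
    (fun n => hcl.inter (Metric.isClosed_closedBall.preimage L.continuous))
    (fun n => hcv.inter ((convex_closedBall _ _).linear_preimage (L : E →ₗ[ℝ] F)))
    (hbdd.subset Set.inter_subset_left)
  rw [Set.mem_iInter] at hx
  refine ⟨x, (hx 0).1, ?_⟩
  have h0 : dist (L x) r ≤ 0 :=
    ge_of_tendsto' tendsto_one_div_add_atTop_nhds_zero_nat fun n => (hx n).2
  exact dist_le_zero.1 h0

end NestedConvex

/-! ### Kernels to finite spaces as measurable simplex-valued maps -/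

section SimplexKernel

variable {Y I : Type*} [MeasurableSpace Y] [Fintype I] [MeasurableSpace I]
  [MeasurableSingletonClass I]

/-- The kernel to a finite space with given measurable weights. -/
noncomputable def simplexKernel {Y I : Type*} [MeasurableSpace Y] [Fintype I]
    [MeasurableSpace I] (p : Y → I → ℝ) (hp : Measurable p) : Kernel Y I where
  toFun y := ∑ i, ENNReal.ofReal (p y i) • Measure.dirac i
  measurable' := by
    refine Measure.measurable_of_measurable_coe _ fun E hE => ?_
    simp only [Measure.coe_finsetSum, Measure.smul_apply, Finset.sum_apply, smul_eq_mul]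
    refine Finset.measurable_sum _ fun i _ => Measurable.mul_const ?_ _
    exact ((measurable_pi_apply i).comp hp).ennreal_ofReal

theorem simplexKernel_apply_singleton (p : Y → I → ℝ) (hp : Measurable p) (y : Y) (i : I) :
    simplexKernel p hp y {i} = ENNReal.ofReal (p y i) := by
  classical
  change (∑ j, ENNReal.ofReal (p y j) • Measure.dirac j : Measure I) {i} = _
  simp [Measure.coe_finsetSum, Set.indicator_apply]

theorem simplexKernel_real_singleton (p : Y → I → ℝ) (hp : Measurable p)
    (hs : ∀ y, p y ∈ stdSimplex ℝ I) (y : Y) (i : I) :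
    (simplexKernel p hp y).real {i} = p y i := by
  rw [measureReal_def, simplexKernel_apply_singleton, ENNReal.toReal_ofReal ((hs y).1 i)]

theorem isMarkovKernel_simplexKernel {Y I : Type*} [MeasurableSpace Y] [Fintype I]
    [MeasurableSpace I] (p : Y → I → ℝ) (hp : Measurable p)
    (hs : ∀ y, p y ∈ stdSimplex ℝ I) : IsMarkovKernel (simplexKernel p hp) := by
  refine ⟨fun y => ⟨?_⟩⟩
  change (∑ j, ENNReal.ofReal (p y j) • Measure.dirac j : Measure I) Set.univ = _
  simp only [Measure.coe_finsetSum, Measure.smul_apply, Finset.sum_apply, smul_eq_mul,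
    measure_univ, mul_one]
  rw [← ENNReal.ofReal_sum_of_nonneg fun i _ => (hs y).1 i, (hs y).2, ENNReal.ofReal_one]

/-- The measurable family of distributions on a finite space with given weights. -/
noncomputable def simplexFamily (p : Y → I → ℝ) (hp : Measurable p)
    (hs : ∀ y, p y ∈ stdSimplex ℝ I) : MeasFamily Y I :=
  ⟨simplexKernel p hp, isMarkovKernel_simplexKernel p hp hs⟩

theorem real_singleton_mem_stdSimplex (μ : Measure I) [IsProbabilityMeasure μ] :
    (fun i => μ.real {i}) ∈ stdSimplex ℝ I := by
  refine ⟨fun i => measureReal_nonneg, ?_⟩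
  simp

theorem measurable_kernel_real {Y I : Type*} [MeasurableSpace Y] [MeasurableSpace I]
    [MeasurableSingletonClass I] (κ : Kernel Y I) (i : I) :
    Measurable fun y => (κ y).real {i} :=
  (κ.measurable_coe (measurableSet_singleton i)).ennreal_toReal

end SimplexKernel

/-! ### Bounds and measurability of payoffs -/

namespace Game

section Bounds

variable {A B X S : Type*} [MeasurableSpace X] [MeasurableSpace S] {d : ℕ} {Γ : Game A B X S d}

theorem norm_payoff_le_supNorm (hm : Γ.BoundedPayoff) (a : A) (b : B) (x : X) (s : S) :
    ‖Γ.payoff a b x s‖ ≤ Γ.supNorm := by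
  obtain ⟨M, hM⟩ := hm
  refine le_csSup ⟨M, ?_⟩ ⟨_, ⟨a, b, x, s, rfl⟩, rfl⟩
  rintro _ ⟨_, ⟨a, b, x, s, rfl⟩, rfl⟩
  exact hM a b x s

theorem supNorm_nonneg (Γ : Game A B X S d) : 0 ≤ Γ.supNorm :=
  Real.sSup_nonneg (by rintro _ ⟨v, -, rfl⟩; exact norm_nonneg v)

end Bounds

variable {A B X S : Type*} [Fintype A] [MeasurableSpace A] [MeasurableSingletonClass A]
  [Fintype B] [MeasurableSpace B] [MeasurableSingletonClass B]
  [MeasurableSpace X] [MeasurableSpace S] {d : ℕ} {Γ : Game A B X S d}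

theorem norm_mixedPayoff_le (hm : Γ.BoundedPayoff) (p : Measure A) [IsProbabilityMeasure p]
    (q : Measure B) [IsProbabilityMeasure q] (x : X) (s : S) :
    ‖Γ.mixedPayoff p q x s‖ ≤ Γ.supNorm := by
  have hp := real_singleton_mem_stdSimplex p
  have hq := real_singleton_mem_stdSimplex q
  calc ‖Γ.mixedPayoff p q x s‖ ≤ ∑ a, ∑ b, (p.real {a} * q.real {b}) * Γ.supNorm := by
        refine (norm_sum_le _ _).trans (Finset.sum_le_sum fun a _ =>
          (norm_sum_le _ _).trans (Finset.sum_le_sum fun b _ => ?_))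
        rw [norm_smul, Real.norm_of_nonneg (mul_nonneg (hp.1 a) (hq.1 b))]
        exact mul_le_mul_of_nonneg_left (norm_payoff_le_supNorm hm a b x s)
          (mul_nonneg (hp.1 a) (hq.1 b))
    _ = Γ.supNorm := by
        have hq2 : ∑ b, q.real {b} = 1 := hq.2
        have hp2 : ∑ a, p.real {a} = 1 := hp.2
        simp_rw [← Finset.sum_mul, ← Finset.mul_sum, hq2, mul_one, hp2, one_mul]

theorem measurable_mixedPayoff (p : MeasFamily X A) (q : MeasFamily (X ⊕ (X × S)) B) :
    Measurable fun z : X × S => Γ.mixedPayoff (p.1 z.1) (q.1 (Γ.G.obs z)) z.1 z.2 := by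
  have := p.2
  have := q.2
  unfold mixedPayoff
  refine Finset.measurable_sum _ fun a _ => Finset.measurable_sum _ fun b _ => ?_
  have hw : Measurable fun z : X × S => (p.1 z.1).real {a} * (q.1 (Γ.G.obs z)).real {b} :=
    ((measurable_kernel_real p.1 a).comp measurable_fst).mul
      ((measurable_kernel_real q.1 b).comp Γ.G.measurable_obs)
  exact hw.smul (Γ.measurable_payoff a b)

theorem integrable_mixedPayoff (hm : Γ.BoundedPayoff) (ρ : Measure (X × S))
    [IsProbabilityMeasure ρ] (p : MeasFamily X A) (q : MeasFamily (X ⊕ (X × S)) B) :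
    Integrable (fun z : X × S => Γ.mixedPayoff (p.1 z.1) (q.1 (Γ.G.obs z)) z.1 z.2) ρ := by
  have := p.2
  have := q.2
  exact Integrable.of_bound (measurable_mixedPayoff p q).aestronglyMeasurable Γ.supNorm
    (Eventually.of_forall fun z => norm_mixedPayoff_le hm _ _ _ _)

theorem norm_expectedPayoff_le (hm : Γ.BoundedPayoff) (ρ : Measure (X × S))
    [IsProbabilityMeasure ρ] (p : MeasFamily X A) (q : MeasFamily (X ⊕ (X × S)) B) :
    ‖Γ.expectedPayoff ρ p q‖ ≤ Γ.supNorm := by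
  have := p.2
  have := q.2
  have h := norm_integral_le_of_norm_le_const (μ := ρ) (C := Γ.supNorm)
    (Eventually.of_forall fun z : X × S =>
      norm_mixedPayoff_le hm (p.1 z.1) (q.1 (Γ.G.obs z)) z.1 z.2)
  simpa [expectedPayoff] using h

theorem inner_expectedPayoff (hm : Γ.BoundedPayoff) (ρ : Measure (X × S))
    [IsProbabilityMeasure ρ] (p : MeasFamily X A) (q : MeasFamily (X ⊕ (X × S)) B)
    (u : EuclideanSpace ℝ (Fin d)) :
    inner ℝ u (Γ.expectedPayoff ρ p q) =
      ∫ z, inner ℝ u (Γ.mixedPayoff (p.1 z.1) (q.1 (Γ.G.obs z)) z.1 z.2) ∂ρ :=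
  (integral_inner (integrable_mixedPayoff hm ρ p q) u).symm

theorem inner_expectedPayoff_le (hm : Γ.BoundedPayoff) (ρ : Measure (X × S))
    [IsProbabilityMeasure ρ] (p : MeasFamily X A) (q : MeasFamily (X ⊕ (X × S)) B)
    (u : EuclideanSpace ℝ (Fin d)) :
    inner ℝ u (Γ.expectedPayoff ρ p q) ≤ ‖u‖ * Γ.supNorm :=
  (real_inner_le_norm _ _).trans
    (mul_le_mul_of_nonneg_left (norm_expectedPayoff_le hm ρ p q) (norm_nonneg _))

theorem bddAbove_inner_expectedPayoff (hm : Γ.BoundedPayoff) (ρ : Measure (X × S))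
    [IsProbabilityMeasure ρ] (p : MeasFamily X A) (u : EuclideanSpace ℝ (Fin d)) :
    BddAbove (Set.range fun q : MeasFamily (X ⊕ (X × S)) B =>
      inner ℝ u (Γ.expectedPayoff ρ p q)) :=
  ⟨‖u‖ * Γ.supNorm, by rintro _ ⟨q, rfl⟩; exact inner_expectedPayoff_le hm ρ p q u⟩

/-- The expected payoffs in a direction under two context distributions are close. -/
theorem inner_expectedPayoff_le_add_tvDist (hm : Γ.BoundedPayoff) (ρ ρ' : Measure (X × S))
    [IsProbabilityMeasure ρ] [IsProbabilityMeasure ρ'] (p : MeasFamily X A)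
    (q : MeasFamily (X ⊕ (X × S)) B) (u : EuclideanSpace ℝ (Fin d)) :
    inner ℝ u (Γ.expectedPayoff ρ p q) ≤ inner ℝ u (Γ.expectedPayoff ρ' p q) +
      2 * (‖u‖ * Γ.supNorm) * tvDist ρ ρ' := by
  have := p.2
  have := q.2
  have h := integral_sub_integral_le_tvDist ρ ρ'
    (f := fun z => inner ℝ u (Γ.mixedPayoff (p.1 z.1) (q.1 (Γ.G.obs z)) z.1 z.2))
    (c := ‖u‖ * Γ.supNorm) (measurable_const.inner (measurable_mixedPayoff p q))
    (fun z => (abs_real_inner_le_norm _ _).trans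
      (mul_le_mul_of_nonneg_left (norm_mixedPayoff_le hm _ _ _ _) (norm_nonneg _)))
  rw [← inner_expectedPayoff hm, ← inner_expectedPayoff hm] at h
  linarith

end Game

/-! ### Saddle points among measurable families -/

section Saddle

/-- Pure responses of Nature to a realized context `x`: maps from the sensitive contexts to
actions, constant if Nature does not observe the sensitive context. -/
abbrev PureResponse (S B : Type*) (G : Monitoring) : Type _ :=
  {v : S → B // G = .unaware → ∀ s s', v s = v s'}

/-- An aware Nature maximizes each `c s` separately; an unaware one uses the same distribution for
all `s`, so a single action maximizing the sum over `s` suffices. -/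
theorem exists_pureResponse_le {X S B : Type*} [Fintype S] [Fintype B] [Nonempty B]
    [MeasurableSpace B] [MeasurableSingletonClass B] (G : Monitoring)
    (q : X ⊕ (X × S) → Measure B) (hq : ∀ y, IsProbabilityMeasure (q y)) (x : X)
    (c : S → B → ℝ) :
    ∃ v : PureResponse S B G,
      ∑ s, ∑ b, (q (G.obs (x, s))).real {b} * c s b ≤ ∑ s, c s (v.1 s) := by
  cases G with
  | unaware =>
    obtain ⟨b₀, hb₀⟩ := Finite.exists_max fun b => ∑ s, c s b
    refine ⟨⟨fun _ => b₀, fun _ _ _ => rfl⟩, ?_⟩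
    have := hq (Sum.inl x)
    simp only [Monitoring.obs]
    rw [Finset.sum_comm]
    simp_rw [← Finset.mul_sum]
    exact sum_stdSimplex_mul_le (real_singleton_mem_stdSimplex (q (Sum.inl x))) hb₀
  | aware =>
    choose v hv using fun s => Finite.exists_max (c s)
    refine ⟨⟨v, fun h => nomatch h⟩, Finset.sum_le_sum fun s _ => ?_⟩
    have := hq (Sum.inr (x, s))
    exact sum_stdSimplex_mul_le (real_singleton_mem_stdSimplex (q (Sum.inr (x, s)))) (hv s)

end Saddle

namespace Game

variable {A B X S : Type*} [Fintype A] [MeasurableSpace A] [MeasurableSingletonClass A]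
  [Fintype B] [MeasurableSpace B] [MeasurableSingletonClass B]
  [MeasurableSpace X] [MeasurableSpace S] {d : ℕ} {Γ : Game A B X S d}

/-- The family `x ↦ p (y, x)` extracted from a family with a parameter `y`. -/
noncomputable def sectionFamily {Y : Type*} [MeasurableSpace Y] (p : MeasFamily (Y × X) A)
    (y : Y) : MeasFamily X A :=
  ⟨p.1.comap (fun x => (y, x)) measurable_prodMk_left, by
    have := p.2
    infer_instance⟩

/-- Disintegration of the expected payoff in a direction with respect to the non-sensitive
context. -/
theorem inner_expectedPayoff_eq_integral_fst [Fintype S] [MeasurableSingletonClass S] [Nonempty S]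
    [StandardBorelSpace X] (hm : Γ.BoundedPayoff) {Y : Type*} [MeasurableSpace Y]
    (κ : Kernel Y (X × S)) [IsMarkovKernel κ] (y : Y) (p : MeasFamily X A)
    (q : MeasFamily (X ⊕ (X × S)) B) (u : EuclideanSpace ℝ (Fin d)) :
    inner ℝ u (Γ.expectedPayoff (κ y) p q) =
      ∫ x, ∑ s, (κ.condKernel (y, x)).real {s} *
        inner ℝ u (Γ.mixedPayoff (p.1 x) (q.1 (Γ.G.obs (x, s))) x s) ∂(κ.fst y) ∧
    Integrable (fun x => ∑ s, (κ.condKernel (y, x)).real {s} *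
        inner ℝ u (Γ.mixedPayoff (p.1 x) (q.1 (Γ.G.obs (x, s))) x s)) (κ.fst y) := by
  have hdis : κ.fst ⊗ₖ κ.condKernel = κ := κ.disintegrate κ.condKernel
  let f : X × S → ℝ := fun z =>
    inner ℝ u (Γ.mixedPayoff (p.1 z.1) (q.1 (Γ.G.obs z)) z.1 z.2)
  have hint : Integrable f ((κ.fst ⊗ₖ κ.condKernel) y) := by
    rw [hdis]
    exact (integrable_mixedPayoff hm (κ y) p q).const_inner u
  have hfin : ∀ x, ∫ s, f (x, s) ∂(κ.condKernel (y, x)) =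
      ∑ s, (κ.condKernel (y, x)).real {s} * f (x, s) := by
    intro x
    rw [integral_fintype .of_finite]
    simp
  have h1 : ∫ z, f z ∂(κ y) = ∫ x, ∫ s, f (x, s) ∂(κ.condKernel (y, x)) ∂(κ.fst y) := by
    conv_lhs => rw [← hdis]
    exact integral_compProd hint
  have h2 := hint.integral_compProd
  simp_rw [hfin] at h1 h2
  exact ⟨(inner_expectedPayoff hm (κ y) p q u).trans h1, h2⟩

/-- For a measurable family of context distributions and of directions, there are measurable
optimal families of both opponents. -/
theorem exists_saddle_families [Nonempty A] [Nonempty B] [Fintype S] [MeasurableSingletonClass S]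
    [Nonempty S] [StandardBorelSpace X] (hm : Γ.BoundedPayoff) {Y : Type*} [MeasurableSpace Y]
    (κ : Kernel Y (X × S)) [IsMarkovKernel κ] {u : Y → EuclideanSpace ℝ (Fin d)}
    (hu : Measurable u) :
    ∃ p : MeasFamily (Y × X) A, ∀ y, ∃ q : MeasFamily (X ⊕ (X × S)) B,
      ∀ (p' : MeasFamily X A) (q' : MeasFamily (X ⊕ (X × S)) B),
        inner ℝ (u y) (Γ.expectedPayoff (κ y) (sectionFamily p y) q') ≤
          inner ℝ (u y) (Γ.expectedPayoff (κ y) p' q) := by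
  classical
  have : Nonempty (PureResponse S B Γ.G) :=
    ⟨⟨fun _ => Classical.arbitrary B, fun _ _ _ => rfl⟩⟩
  let w : Y × X → S → ℝ := fun z s => (κ.condKernel z).real {s}
  -- The matrix game at `(y, x)`: the sensitive context is averaged out with its conditional law
  -- given `x`, which is why Nature's actions must be whole response maps.
  let N : Y × X → A → PureResponse S B Γ.G → ℝ := fun z a v =>
    ∑ s, w z s * inner ℝ (u z.1) (Γ.payoff a (v.1 s) z.2 s)
  have hpay : ∀ a b s, Measurable fun x => Γ.payoff a b x s := fun a b s =>
    (Γ.measurable_payoff a b).comp measurable_prodMk_right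
  have hN : ∀ a v, Measurable fun z => N z a v := by
    intro a v
    refine Finset.measurable_sum _ fun s _ => (measurable_kernel_real _ s).mul ?_
    exact (hu.comp measurable_fst).inner ((hpay a _ s).comp measurable_snd)
  obtain ⟨p, q, hp, hq, hps, hqs, hpq⟩ := exists_measurable_saddle_matrix hN
  refine ⟨simplexFamily p hp hps, fun y => ?_⟩
  -- the optimal family of Nature
  let s₀ : S := Classical.arbitrary S
  -- The law of `v s` when `v` follows the optimal mixture of responses. These marginals lose
  -- nothing, since the payoff is a sum over `s` of terms involving only `v s`.
  let r : X × S → B → ℝ := fun z b => ∑ v : PureResponse S B Γ.G,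
    if v.1 z.2 = b then q (y, z.1) v else 0
  have hrsum : ∀ z (c : B → ℝ), ∑ b, r z b * c b =
      ∑ v : PureResponse S B Γ.G, q (y, z.1) v * c (v.1 z.2) := by
    intro z c
    simp only [r, Finset.sum_mul]
    rw [Finset.sum_comm]
    simp [ite_mul]
  have hrs : ∀ z, r z ∈ stdSimplex ℝ B := by
    intro z
    refine ⟨fun b => Finset.sum_nonneg fun v _ => ?_, ?_⟩
    · split_ifs
      · exact (hqs (y, z.1)).1 v
      · exact le_rfl
    · have := hrsum z fun _ => 1
      simpa [(hqs (y, z.1)).2] using this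
  have hrm : Measurable r := by
    refine measurable_pi_lambda _ fun b => Finset.measurable_sum _ fun v _ => ?_
    refine Measurable.ite ?_ ?_ measurable_const
    · exact measurable_snd (Set.toFinite {s : S | v.1 s = b}).measurableSet
    · exact (measurable_pi_apply v).comp
        (hq.comp (measurable_const.prodMk measurable_fst))
  -- The choice of `s₀` is immaterial: an unaware Nature has constant responses, and an aware one
  -- never observes the left summand.
  let r' : X ⊕ (X × S) → B → ℝ := Sum.elim (fun x => r (x, s₀)) r
  have hr'm : Measurable r' :=
    Measurable.sumElim (hrm.comp (measurable_id.prodMk measurable_const)) hrm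
  have hr's : ∀ z, r' z ∈ stdSimplex ℝ B := by
    rintro (x | z)
    · exact hrs _
    · exact hrs z
  have hr'obs : ∀ z, r' (Γ.G.obs z) = r z := by
    intro z
    cases hG : Γ.G with
    | unaware =>
      funext b
      refine Finset.sum_congr rfl fun v _ => ?_
      rw [v.2 hG s₀ z.2]
    | aware => rfl
  refine ⟨simplexFamily r' hr'm hr's, fun p' q' => ?_⟩
  have := p'.2
  have := q'.2
  obtain ⟨h1, h1i⟩ := inner_expectedPayoff_eq_integral_fst (Γ := Γ) hm κ y
    (sectionFamily (simplexFamily p hp hps) y) q' (u y)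
  obtain ⟨h2, h2i⟩ := inner_expectedPayoff_eq_integral_fst (Γ := Γ) hm κ y p'
    (simplexFamily r' hr'm hr's) (u y)
  rw [h1, h2]
  refine integral_mono h1i h2i fun x => ?_
  have e1 : ∀ a, ((sectionFamily (simplexFamily p hp hps) y).1 x).real {a} = p (y, x) a :=
    fun a => simplexKernel_real_singleton p hp hps (y, x) a
  have e2 : ∀ s b, ((simplexFamily r' hr'm hr's).1 (Γ.G.obs (x, s))).real {b} = r (x, s) b := by
    intro s b
    refine (simplexKernel_real_singleton r' hr'm hr's _ b).trans ?_
    rw [hr'obs]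
  have hL : ∑ s, w (y, x) s * inner ℝ (u y) (Γ.mixedPayoff
        ((sectionFamily (simplexFamily p hp hps) y).1 x) (q'.1 (Γ.G.obs (x, s))) x s) =
      ∑ s, ∑ b, (q'.1 (Γ.G.obs (x, s))).real {b} *
        (w (y, x) s * ∑ a, p (y, x) a * inner ℝ (u y) (Γ.payoff a b x s)) := by
    refine Finset.sum_congr rfl fun s _ => ?_
    simp only [mixedPayoff, e1, inner_sum, inner_smul_right, Finset.mul_sum]
    rw [Finset.sum_comm]
    exact Finset.sum_congr rfl fun b _ => Finset.sum_congr rfl fun a _ => by ring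
  have hR : ∑ s, w (y, x) s * inner ℝ (u y) (Γ.mixedPayoff (p'.1 x)
        ((simplexFamily r' hr'm hr's).1 (Γ.G.obs (x, s))) x s) =
      ∑ a, (p'.1 x).real {a} * ∑ v, q (y, x) v * N (y, x) a v := by
    have : ∀ s, w (y, x) s * inner ℝ (u y) (Γ.mixedPayoff (p'.1 x)
        ((simplexFamily r' hr'm hr's).1 (Γ.G.obs (x, s))) x s) =
        ∑ a, (p'.1 x).real {a} * ∑ v, q (y, x) v *
          (w (y, x) s * inner ℝ (u y) (Γ.payoff a (v.1 s) x s)) := by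
      intro s
      simp only [mixedPayoff, e2, inner_sum, inner_smul_right]
      rw [Finset.mul_sum]
      refine Finset.sum_congr rfl fun a _ => ?_
      have := hrsum (x, s) fun b => w (y, x) s * inner ℝ (u y) (Γ.payoff a b x s)
      rw [← this, Finset.mul_sum, Finset.mul_sum]
      exact Finset.sum_congr rfl fun b _ => by ring
    rw [Finset.sum_congr rfl fun s _ => this s, Finset.sum_comm]
    refine Finset.sum_congr rfl fun a _ => ?_
    rw [← Finset.mul_sum, Finset.sum_comm]
    simp only [N, Finset.mul_sum]
  -- At fixed `x`, Nature's deviation `q'` is dominated by a column of the matrix game; the saddle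
  -- inequality for this column is then averaged over the rows with the weights of `p'`.
  obtain ⟨v, hv⟩ := exists_pureResponse_le Γ.G (fun z => q'.1 z) (fun z => inferInstance) x
    fun s b => w (y, x) s * ∑ a, p (y, x) a * inner ℝ (u y) (Γ.payoff a b x s)
  have hv' : ∑ s, w (y, x) s * ∑ a, p (y, x) a * inner ℝ (u y) (Γ.payoff a (v.1 s) x s) =
      ∑ a, p (y, x) a * N (y, x) a v := by
    simp only [N, Finset.mul_sum]
    rw [Finset.sum_comm]
    exact Finset.sum_congr rfl fun b _ => Finset.sum_congr rfl fun a _ => by ring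
  change ∑ s, w (y, x) s * _ ≤ ∑ s, w (y, x) s * _
  rw [hL, hR]
  refine hv.trans (hv'.le.trans ?_)
  have hp' := real_singleton_mem_stdSimplex (p'.1 x)
  calc ∑ a, p (y, x) a * N (y, x) a v
      = ∑ a', (p'.1 x).real {a'} * ∑ a, p (y, x) a * N (y, x) a v := by
        have h : ∑ a, (p'.1 x).real {a} = 1 := hp'.2
        rw [← Finset.sum_mul, h, one_mul]
    _ ≤ _ := Finset.sum_le_sum fun a _ =>
        mul_le_mul_of_nonneg_left (hpq (y, x) a v) (hp'.1 a)

end Game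

/-! ### Plug-in strategies and the approximate half-space condition -/

theorem measurable_avgPayoff {X S : Type*} [MeasurableSpace X] [MeasurableSpace S] {d t : ℕ} :
    Measurable (avgPayoff : PlayerHistory X S d t → EuclideanSpace ℝ (Fin d)) := by
  unfold avgPayoff
  have h : Measurable fun h : PlayerHistory X S d t => ∑ i, (h i).1 :=
    Finset.measurable_sum _ fun i _ => measurable_fst.comp (measurable_pi_apply i)
  exact h.const_smul (t : ℝ)⁻¹

namespace Game

variable {A B X S : Type*} [Fintype A] [MeasurableSpace A] [MeasurableSingletonClass A]
  [Fintype B] [MeasurableSpace B] [MeasurableSingletonClass B]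
  [MeasurableSpace X] [MeasurableSpace S] {d : ℕ} {Γ : Game A B X S d}

section Strategy

variable [Nonempty A] [Nonempty B] [Fintype S] [MeasurableSingletonClass S] [Nonempty S]
  [StandardBorelSpace X] {C : Set (EuclideanSpace ℝ (Fin d))}

theorem nonempty_measFamily {Y Z : Type*} [MeasurableSpace Y] [MeasurableSpace Z] [Nonempty Z] :
    Nonempty (MeasFamily Y Z) :=
  ⟨⟨Kernel.const Y (Measure.dirac (Classical.arbitrary Z)), inferInstance⟩⟩

/-- Saddle families are taken with the history as parameter, which gives joint measurability in the
history and `x`. They are minimax: Nature's optimal `q` bounds every payoff of the saddle family by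
a payoff of the competitor `p'`, hence by the supremum for `p'`. -/
theorem exists_isBlackwellStrategy (hm : Γ.BoundedPayoff) (hCne : C.Nonempty)
    (hCcl : IsClosed C) (hCcv : Convex ℝ C) (Qhat : Estimator X S d) (p₁ : MeasFamily X A) :
    ∃ σ : PlayerStrategy A X S d, Γ.IsBlackwellStrategy C Qhat σ ∧
      ∀ h : PlayerHistory X S d 0, playerFamily σ h = p₁ := by
  have hex : ∀ t : ℕ, ∃ p : MeasFamily (PlayerHistory X S d t × X) A, ∀ h,
      Γ.IsMinimaxFamily ((Qhat t).1 h) (avgPayoff h - proj C (avgPayoff h))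
        (sectionFamily p h) := by
    intro t
    have := (Qhat t).2
    obtain ⟨p, hp⟩ := exists_saddle_families (Γ := Γ) hm (Qhat t).1
      (u := fun h => avgPayoff h - proj C (avgPayoff h))
      (measurable_avgPayoff.sub
        ((lipschitzWith_proj hCne hCcl hCcv).continuous.measurable.comp measurable_avgPayoff))
    refine ⟨p, fun h p' => ?_⟩
    obtain ⟨q, hq⟩ := hp h
    have := nonempty_measFamily (Y := X ⊕ (X × S)) (Z := B)
    exact ciSup_le fun q' => (hq p' q').trans
      (le_ciSup (bddAbove_inner_expectedPayoff hm _ p' _) q)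
  choose p hp using hex
  have := p₁.2
  let κ₁ : Kernel (PlayerHistory X S d 0 × X) A := p₁.1.comap Prod.snd measurable_snd
  have h₁ : IsMarkovKernel κ₁ := by
    unfold κ₁
    infer_instance
  refine ⟨fun t => match t with
    | 0 => ⟨κ₁, h₁⟩
    | t + 1 => p (t + 1), fun t ht h => ?_, fun h => ?_⟩
  · obtain ⟨t, rfl⟩ := Nat.exists_eq_succ_of_ne_zero (Nat.one_le_iff_ne_zero.1 ht)
    exact hp (t + 1) h
  · exact Subtype.ext (Kernel.ext fun x => rfl)

/-- A minimax family for an estimate of the context distribution guarantees the half-space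
condition up to the error of the estimate. -/
theorem inner_expectedPayoff_sub_proj_le (hm : Γ.BoundedPayoff) (hCne : C.Nonempty)
    (hCcl : IsClosed C) (hCcv : Convex ℝ C) {Q ρ : Measure (X × S)} [IsProbabilityMeasure Q]
    [IsProbabilityMeasure ρ] (hB : Γ.BlackwellCondition Q C) {v : EuclideanSpace ℝ (Fin d)}
    {p : MeasFamily X A} (hp : Γ.IsMinimaxFamily ρ (v - proj C v) p)
    (q : MeasFamily (X ⊕ (X × S)) B) :
    inner ℝ (v - proj C v) (Γ.expectedPayoff Q p q) ≤
      inner ℝ (v - proj C v) (proj C v) +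
        4 * Γ.supNorm * (‖v - proj C v‖ * tvDist ρ Q) := by
  set u := v - proj C v
  -- A saddle pair for the true distribution `Q`. The Blackwell condition is used only once, against
  -- Nature's optimal family `q'`.
  obtain ⟨p', hp'⟩ := exists_saddle_families (Γ := Γ) hm (Kernel.const Unit Q)
    (u := fun _ => u) measurable_const
  obtain ⟨q', hq'⟩ := hp' ()
  simp only [Kernel.const_apply] at hq'
  obtain ⟨p'', hp''⟩ := hB q'
  have h1 : ∀ q, inner ℝ u (Γ.expectedPayoff Q (sectionFamily p' ()) q) ≤
      inner ℝ u (proj C v) := by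
    intro q
    refine (hq' p'' q).trans ?_
    have := inner_sub_proj_le_zero hCne hCcl hCcv v hp''
    rw [inner_sub_right] at this
    exact sub_nonpos.1 this
  have := nonempty_measFamily (Y := X ⊕ (X × S)) (Z := B)
  -- From `Q` to the estimate `ρ`, where `p` is optimal and `p'` a competitor, and back to `Q`,
  -- where `p'` meets the half-space condition. Each passage costs `2 ‖u‖ ‖m‖ TV`.
  calc inner ℝ u (Γ.expectedPayoff Q p q)
      ≤ inner ℝ u (Γ.expectedPayoff ρ p q) + 2 * (‖u‖ * Γ.supNorm) * tvDist Q ρ :=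
        inner_expectedPayoff_le_add_tvDist hm Q ρ p q u
    _ ≤ (⨆ q, inner ℝ u (Γ.expectedPayoff ρ p q)) + 2 * (‖u‖ * Γ.supNorm) * tvDist Q ρ := by
        gcongr
        exact le_ciSup (bddAbove_inner_expectedPayoff hm ρ p u) q
    _ ≤ (⨆ q, inner ℝ u (Γ.expectedPayoff ρ (sectionFamily p' ()) q)) +
          2 * (‖u‖ * Γ.supNorm) * tvDist Q ρ := by
        exact add_le_add (hp _) le_rfl
    _ ≤ (inner ℝ u (proj C v) + 2 * (‖u‖ * Γ.supNorm) * tvDist ρ Q) +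
          2 * (‖u‖ * Γ.supNorm) * tvDist Q ρ := by
        gcongr
        refine ciSup_le fun q => ?_
        refine (inner_expectedPayoff_le_add_tvDist hm ρ Q _ q u).trans ?_
        gcongr
        exact h1 q
    _ = _ := by rw [tvDist_comm Q ρ]; ring

end Strategy

/-! ### The law of the play and conditional payoffs -/

section Law

/-- The full history of the first `t` rounds of a play. -/
def fullHistory {R : Type*} (t : ℕ) (ω : ℕ → R) : Fin t → R := fun i => ω i

theorem measurable_fullHistory {R : Type*} [MeasurableSpace R] (t : ℕ) :
    Measurable (fullHistory t : (ℕ → R) → Fin t → R) :=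
  measurable_pi_lambda _ fun _ => measurable_pi_apply _

variable (Q : Measure (X × S)) [IsProbabilityMeasure Q] (σ : PlayerStrategy A X S d)
  (τ : NatureStrategy A B X S)

instance isProbabilityMeasure_playLaw : IsProbabilityMeasure (Γ.playLaw Q σ τ) := by
  unfold playLaw
  infer_instance

/-- The law of round `t + 1` given the first `t` rounds is the round kernel. -/
theorem map_playLaw_eq_compProd (t : ℕ) :
    (Γ.playLaw Q σ τ).map (fun ω => (fullHistory t ω, ω t)) =
      (Γ.playLaw Q σ τ).map (fullHistory t) ⊗ₘ Γ.roundKernel Q σ τ t := by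
  cases t with
  | zero =>
    have h0 : (Γ.playLaw Q σ τ).map (fullHistory 0) = Measure.dirac (fun i => i.elim0) := by
      have : (fullHistory 0 : (ℕ → Round A B X S) → _) = fun _ => (fun i => i.elim0) := by
        funext ω i
        exact i.elim0
      rw [this, Measure.map_const]
      simp
    have h1 : (Γ.playLaw Q σ τ).map (fun ω => ω 0) =
        Γ.roundKernel Q σ τ 0 (fun i => i.elim0) := by
      have he : (fun ω : ℕ → Round A B X S => ω 0) =
          (MeasurableEquiv.piUnique (fun _ : Finset.Iic 0 => Round A B X S)) ∘
            Preorder.frestrictLe (π := fun _ => Round A B X S) 0 := rfl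
      rw [he, ← Measure.map_map (by fun_prop) (by fun_prop), playLaw, Kernel.trajMeasure,
        Measure.map_comp _ _ (by fun_prop), Kernel.traj_map_frestrictLe, Kernel.partialTraj_self,
        Measure.id_comp]
      exact MeasurableEquiv.map_map_symm _
    have h2 : (fun ω : ℕ → Round A B X S => (fullHistory 0 ω, ω 0)) =
        (fun r => ((fun i => i.elim0 : FullHistory A B X S 0), r)) ∘ fun ω => ω 0 := by
      funext ω
      exact Prod.ext (funext fun i => i.elim0) rfl
    rw [h2, ← Measure.map_map (g := fun r => ((fun i => i.elim0 : FullHistory A B X S 0), r))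
      (f := fun ω : ℕ → Round A B X S => ω 0)
      measurable_prodMk_left (measurable_pi_apply 0), h1, h0]
    ext s hs
    rw [Measure.map_apply measurable_prodMk_left hs, Measure.dirac_compProd_apply hs]
  | succ n =>
    -- The trajectory measure indexes the past by `Finset.Iic n`, histories by `Fin (n + 1)`; what
    -- remains is to transport its disintegration along this reindexing.
    let e : (Finset.Iic n → Round A B X S) → FullHistory A B X S (n + 1) :=
      fun H i => H ⟨i.1, Finset.mem_Iic.2 (Nat.lt_succ_iff.1 i.2)⟩
    have he : Measurable e := measurable_pi_lambda _ fun _ => measurable_pi_apply _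
    have h := Kernel.map_frestrictLe_trajMeasure_compProd_eq_map_trajMeasure
      (X := fun _ => Round A B X S)
      (μ₀ := Γ.roundKernel Q σ τ 0 (fun i => i.elim0))
      (κ := fun n => (Γ.roundKernel Q σ τ (n + 1)).comap
        (fun (H : ∀ _ : Finset.Iic n, Round A B X S) (i : Fin (n + 1)) =>
          H ⟨i.1, Finset.mem_Iic.2 (Nat.lt_succ_iff.1 i.2)⟩)
        (measurable_pi_lambda _ fun _ => measurable_pi_apply _)) (a := n)
    change (Γ.playLaw Q σ τ).map _ ⊗ₘ _ = (Γ.playLaw Q σ τ).map _ at h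
    have hl : (fun ω : ℕ → Round A B X S => (fullHistory (n + 1) ω, ω (n + 1))) =
        Prod.map e id ∘ fun ω =>
          (Preorder.frestrictLe (π := fun _ => Round A B X S) n ω, ω (n + 1)) := rfl
    have hr : (fullHistory (n + 1) : (ℕ → Round A B X S) → _) =
        e ∘ Preorder.frestrictLe (π := fun _ => Round A B X S) n := rfl
    rw [hl, hr, ← Measure.map_map (he.prodMap measurable_id) (by fun_prop),
      ← Measure.map_map he (by fun_prop), ← h]
    refine Measure.ext_of_lintegral _ fun f hf => ?_
    rw [lintegral_map hf (he.prodMap measurable_id), Measure.lintegral_compProd hf,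
      Measure.lintegral_compProd (f := fun a => f (Prod.map e id a))
        (hf.comp (he.prodMap measurable_id)), lintegral_map _ he]
    · rfl
    · exact hf.lintegral_kernel_prod_right'

/-- The family that Nature plays after a given full history. -/
noncomputable def natureFamily {t : ℕ} (H : FullHistory A B X S t) :
    MeasFamily (X ⊕ (X × S)) B :=
  ⟨(τ t).1.comap (fun y => (H, y)) measurable_prodMk_left, by
    have := (τ t).2
    infer_instance⟩

/-- The Player's information contained in a full history. -/
def playerInfo (Γ : Game A B X S d) {t : ℕ} (H : FullHistory A B X S t) : PlayerHistory X S d t :=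
  fun i => Γ.playerObs (H i)

theorem measurable_playerInfo {t : ℕ} :
    Measurable (Γ.playerInfo : FullHistory A B X S t → PlayerHistory X S d t) :=
  measurable_pi_lambda _ fun i => Γ.measurable_playerObs.comp (measurable_pi_apply i)

/-- The payoff of a round. -/
def roundPayoff (Γ : Game A B X S d) (r : Round A B X S) : EuclideanSpace ℝ (Fin d) :=
  Γ.payoff r.2.1 r.2.2 r.1.1 r.1.2

theorem measurable_roundPayoff : Measurable Γ.roundPayoff :=
  measurable_fst.comp Γ.measurable_playerObs

theorem norm_roundPayoff_le {A B X S : Type*} [MeasurableSpace X] [MeasurableSpace S] {d : ℕ}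
    {Γ : Game A B X S d} (hm : Γ.BoundedPayoff) (r : Round A B X S) :
    ‖Γ.roundPayoff r‖ ≤ Γ.supNorm := norm_payoff_le_supNorm hm _ _ _ _

/-- The conditional expectation of the payoff of a round given the past. -/
theorem integral_roundPayoff_roundKernel (hm : Γ.BoundedPayoff) {t : ℕ}
    (H : FullHistory A B X S t) :
    ∫ r, Γ.roundPayoff r ∂(Γ.roundKernel Q σ τ t H) =
      Γ.expectedPayoff Q (playerFamily σ (Γ.playerInfo H)) (natureFamily τ H) := by
  have := (σ t).2
  have := (τ t).2
  have hint : Integrable Γ.roundPayoff (Γ.roundKernel Q σ τ t H) :=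
    Integrable.of_bound measurable_roundPayoff.aestronglyMeasurable Γ.supNorm
      (Eventually.of_forall fun r => norm_roundPayoff_le hm r)
  unfold roundKernel at hint ⊢
  rw [ProbabilityTheory.integral_compProd hint, Kernel.const_apply]
  refine integral_congr_ae (Eventually.of_forall fun z => ?_)
  simp only [Kernel.prod_apply, Kernel.comap_apply]
  rw [integral_fintype .of_finite]
  rw [Fintype.sum_prod_type]
  refine Finset.sum_congr rfl fun a _ => Finset.sum_congr rfl fun b _ => ?_
  rw [← Set.singleton_prod_singleton, measureReal_prod_prod]
  rfl

end Law

end Game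

/-! ### Cauchy–Schwarz and the recursion for mean squares -/

/-- The Cauchy–Schwarz inequality for nonnegative bounded functions. -/
theorem integral_mul_le_sqrt_mul_sqrt {Ω : Type*} [MeasurableSpace Ω] {μ : Measure Ω}
    [IsFiniteMeasure μ] {f g : Ω → ℝ} (hf : Measurable f) (hg : Measurable g) {c : ℝ}
    (hf0 : ∀ ω, 0 ≤ f ω) (hg0 : ∀ ω, 0 ≤ g ω) (hfc : ∀ ω, f ω ≤ c) (hgc : ∀ ω, g ω ≤ c) :
    ∫ ω, f ω * g ω ∂μ ≤ √(∫ ω, f ω ^ 2 ∂μ) * √(∫ ω, g ω ^ 2 ∂μ) := by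
  have hL : ∀ h : Ω → ℝ, Measurable h → (∀ ω, 0 ≤ h ω) → (∀ ω, h ω ≤ c) →
      MemLp h (ENNReal.ofReal 2) μ := fun h hh h0 hc =>
    MemLp.of_bound hh.aestronglyMeasurable c (Eventually.of_forall fun ω => by
      rw [Real.norm_of_nonneg (h0 ω)]; exact hc ω)
  have h := integral_mul_le_Lp_mul_Lq_of_nonneg (μ := μ) Real.HolderConjugate.two_two
    (Eventually.of_forall hf0) (Eventually.of_forall hg0) (hL f hf hf0 hfc) (hL g hg hg0 hgc)
  simpa [Real.sqrt_eq_rpow] using h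

theorem integrable_of_bounded {Ω E : Type*} [MeasurableSpace Ω] {μ : Measure Ω}
    [IsFiniteMeasure μ] [NormedAddCommGroup E] [MeasurableSpace E] [BorelSpace E]
    [SecondCountableTopology E] {f : Ω → E} (hf : Measurable f) {c : ℝ} (hc : ∀ ω, ‖f ω‖ ≤ c) :
    Integrable f μ :=
  Integrable.of_bound hf.aestronglyMeasurable c (Eventually.of_forall hc)

/-- The rate implied by Blackwell's recursion on mean squared distances. -/
theorem sqrt_le_of_sq_recursion {K M : ℝ} (hK : 0 ≤ K) (hM : 0 ≤ M) {D δ : ℕ → ℝ}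
    (hD : ∀ t, 0 ≤ D t) (hδ : ∀ t, 0 ≤ δ t) (h1 : D 1 ≤ K)
    (hrec : ∀ t : ℕ, 1 ≤ t → ((t : ℝ) + 1) ^ 2 * D (t + 1) ≤
      (t : ℝ) ^ 2 * D t + K + 8 * t * M * (√(D t) * δ t)) {T : ℕ} (hT : 1 ≤ T) :
    √(D T) ≤ √(K / T) + 4 * M * (1 / (T : ℝ) * ∑ t ∈ Finset.Ico 1 T, δ t) := by
  -- Up to a nonnegative square, `t² D t + 8tM √(D t) δ t` is `(t √(D t) + 4M δ t)²`, to which the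
  -- induction hypothesis applies. The extra `K` is absorbed by passing from `√(K t)` to `√(K
  -- (t+1))`, which only enlarges the cross term.
  have key : T * √(D T) ≤ √(K * T) + 4 * M * ∑ t ∈ Finset.Ico 1 T, δ t := by
    induction T, hT using Nat.le_induction with
    | base => simpa using Real.sqrt_le_sqrt h1
    | succ t ht ih =>
      rw [Finset.sum_Ico_succ_top ht]
      have h := hrec t ht
      have hS : 0 ≤ ∑ i ∈ Finset.Ico 1 t, δ i := Finset.sum_nonneg fun i _ => hδ i
      have hδt := hδ t
      set s := ∑ i ∈ Finset.Ico 1 t, δ i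
      have e1 : √(K * t) ^ 2 = K * t := Real.sq_sqrt (by positivity)
      have e2 : √(K * (t + 1)) ^ 2 = K * (t + 1) := Real.sq_sqrt (by positivity)
      have e3 : √(D t) ^ 2 = D t := Real.sq_sqrt (hD t)
      have e4 : √(D (t + 1)) ^ 2 = D (t + 1) := Real.sq_sqrt (hD (t + 1))
      have hle : √(K * t) ≤ √(K * (t + 1)) := Real.sqrt_le_sqrt (by nlinarith)
      have hw : 0 ≤ 4 * M * (s + δ t) := by positivity
      have a1 : t * √(D t) + 4 * M * δ t ≤ √(K * t) + 4 * M * (s + δ t) := by linarith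
      have a2 : (t * √(D t) + 4 * M * δ t) ^ 2 ≤ (√(K * t) + 4 * M * (s + δ t)) ^ 2 :=
        pow_le_pow_left₀ (by positivity) a1 2
      have b1 : (((t + 1 : ℕ) : ℝ) * √(D (t + 1))) ^ 2 = ((t : ℝ) + 1) ^ 2 * D (t + 1) := by
        rw [mul_pow, e4]
        push_cast
        ring
      have b2 : (t * √(D t) + 4 * M * δ t) ^ 2 =
          (t : ℝ) ^ 2 * √(D t) ^ 2 + 8 * t * M * (√(D t) * δ t) + (4 * M * δ t) ^ 2 := by
        ring
      have b3 : √(K * t) * (4 * M * (s + δ t)) ≤ √(K * (t + 1)) * (4 * M * (s + δ t)) :=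
        mul_le_mul_of_nonneg_right hle hw
      have b4 : (√(K * t) + 4 * M * (s + δ t)) ^ 2 = √(K * t) ^ 2 +
          2 * (√(K * t) * (4 * M * (s + δ t))) + (4 * M * (s + δ t)) ^ 2 := by ring
      have b5 : (√(K * (t + 1)) + 4 * M * (s + δ t)) ^ 2 = √(K * (t + 1)) ^ 2 +
          2 * (√(K * (t + 1)) * (4 * M * (s + δ t))) + (4 * M * (s + δ t)) ^ 2 := by ring
      have a3 : (((t + 1 : ℕ) : ℝ) * √(D (t + 1))) ^ 2 ≤
          (√(K * (t + 1)) + 4 * M * (s + δ t)) ^ 2 := by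
        rw [b1, b5, e2]
        rw [b2, b4, e1, e3] at a2
        linarith [sq_nonneg (4 * M * δ t)]
      have a4 := (pow_le_pow_iff_left₀ (by positivity) (by positivity) two_ne_zero).1 a3
      simpa using a4
  have hT0 : (0 : ℝ) < T := by exact_mod_cast hT
  have e : √(K / T) = √(K * T) / T := by
    rw [eq_div_iff hT0.ne']
    nth_rewrite 2 [← Real.sqrt_sq hT0.le]
    rw [← Real.sqrt_mul (by positivity)]
    congr 1
    field_simp
  have e' : √(K * T) / T + 4 * M * (1 / (T : ℝ) * ∑ t ∈ Finset.Ico 1 T, δ t) =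
      (√(K * T) + 4 * M * ∑ t ∈ Finset.Ico 1 T, δ t) / T := by
    field_simp
  rw [e, e', le_div_iff₀ hT0, mul_comm]
  exact key

/-! ### Blackwell's recursion along a single play -/

namespace Game

section Deterministic

variable {A B X S : Type*} [MeasurableSpace X] [MeasurableSpace S] {d : ℕ} {Γ : Game A B X S d}
  {C : Set (EuclideanSpace ℝ (Fin d))}

theorem avgPayoff_playerHistory (ω : ℕ → Round A B X S) (t : ℕ) :
    avgPayoff (Γ.playerHistory ω t) = (t : ℝ)⁻¹ • ∑ i ∈ Finset.range t, Γ.roundPayoff (ω i) := by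
  rw [avgPayoff, Finset.sum_range]
  rfl

theorem smul_avgPayoff_succ (ω : ℕ → Round A B X S) (t : ℕ) :
    ((t : ℝ) + 1) • avgPayoff (Γ.playerHistory ω (t + 1)) =
      (t : ℝ) • avgPayoff (Γ.playerHistory ω t) + Γ.roundPayoff (ω t) := by
  have h1 : ((t : ℝ) + 1) ≠ 0 := by positivity
  rw [avgPayoff_playerHistory, avgPayoff_playerHistory, smul_smul, smul_smul,
    Finset.sum_range_succ, Nat.cast_add, Nat.cast_one, mul_inv_cancel₀ h1, one_smul]
  rcases Nat.eq_zero_or_pos t with rfl | ht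
  · simp
  · rw [mul_inv_cancel₀ (by positivity), one_smul]

theorem roundPayoff_mem_payoffSet (r : Round A B X S) : Γ.roundPayoff r ∈ Γ.payoffSet :=
  ⟨_, _, _, _, rfl⟩

theorem avgPayoff_mem_convexHull (ω : ℕ → Round A B X S) {t : ℕ} (ht : 1 ≤ t) :
    avgPayoff (Γ.playerHistory ω t) ∈ convexHull ℝ Γ.payoffSet := by
  rw [avgPayoff_playerHistory, Finset.smul_sum]
  refine (convex_convexHull ℝ _).sum_mem (fun i _ => by positivity) ?_
    fun i _ => subset_convexHull ℝ _ (roundPayoff_mem_payoffSet (ω i))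
  rw [Finset.sum_const, Finset.card_range, nsmul_eq_mul,
    mul_inv_cancel₀ (Nat.cast_ne_zero.2 (by omega))]

theorem norm_le_supNorm_of_mem_convexHull (hm : Γ.BoundedPayoff) {w : EuclideanSpace ℝ (Fin d)}
    (hw : w ∈ convexHull ℝ Γ.payoffSet) : ‖w‖ ≤ Γ.supNorm := by
  have h : convexHull ℝ Γ.payoffSet ⊆ Metric.closedBall 0 Γ.supNorm := by
    refine convexHull_min ?_ (convex_closedBall _ _)
    rintro _ ⟨a, b, x, s, rfl⟩
    simpa using norm_payoff_le_supNorm hm a b x s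
  simpa using h hw

theorem norm_avgPayoff_le (hm : Γ.BoundedPayoff) (ω : ℕ → Round A B X S) (t : ℕ) :
    ‖avgPayoff (Γ.playerHistory ω t)‖ ≤ Γ.supNorm := by
  rcases Nat.eq_zero_or_pos t with rfl | ht
  · simpa [avgPayoff] using Γ.supNorm_nonneg
  · exact norm_le_supNorm_of_mem_convexHull hm (avgPayoff_mem_convexHull ω ht)

theorem distTo_nonneg (ω : ℕ → Round A B X S) (t : ℕ) : 0 ≤ Γ.distTo C ω t :=
  Metric.infDist_nonneg

theorem constK_nonneg : 0 ≤ Γ.constK C :=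
  Real.sSup_nonneg (by rintro _ ⟨v, -, w, -, rfl⟩; positivity)

section ConvexTarget

variable (hCne : C.Nonempty) (hCcl : IsClosed C) (hCcv : Convex ℝ C)
include hCne hCcl hCcv

theorem distTo_eq_norm (ω : ℕ → Round A B X S) (t : ℕ) :
    Γ.distTo C ω t = ‖avgPayoff (Γ.playerHistory ω t) - proj C (avgPayoff (Γ.playerHistory ω t))‖ :=
  (norm_sub_proj_eq_infDist hCne hCcl hCcv _).symm

theorem norm_proj_le (w : EuclideanSpace ℝ (Fin d)) : ‖proj C w‖ ≤ ‖proj C 0‖ + ‖w‖ := by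
  have h := (lipschitzWith_proj hCne hCcl hCcv).dist_le_mul w 0
  rw [NNReal.coe_one, one_mul, dist_eq_norm, dist_eq_norm, sub_zero] at h
  have := norm_sub_norm_le (proj C w) (proj C 0)
  linarith

variable (hm : Γ.BoundedPayoff)
include hm

theorem distTo_le (ω : ℕ → Round A B X S) (t : ℕ) :
    Γ.distTo C ω t ≤ Γ.supNorm + ‖proj C 0‖ := by
  refine (Metric.infDist_le_dist_of_mem (proj_mem hCne hCcl hCcv 0)).trans ?_
  rw [dist_eq_norm]
  exact (norm_sub_le _ _).trans (add_le_add (norm_avgPayoff_le hm ω t) le_rfl)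

theorem sq_norm_sub_proj_le_constK {v w : EuclideanSpace ℝ (Fin d)} (hv : v ∈ Γ.payoffSet)
    (hw : w ∈ convexHull ℝ Γ.payoffSet) : ‖v - proj C w‖ ^ 2 ≤ Γ.constK C := by
  refine le_csSup ⟨(Γ.supNorm + (‖proj C 0‖ + Γ.supNorm)) ^ 2, ?_⟩ ⟨v, hv, w, hw, rfl⟩
  rintro _ ⟨v, hv, w, hw, rfl⟩
  refine pow_le_pow_left₀ (norm_nonneg _) ((norm_sub_le _ _).trans (add_le_add ?_ ?_)) 2
  · exact norm_le_supNorm_of_mem_convexHull hm (subset_convexHull ℝ _ hv)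
  · have := norm_le_supNorm_of_mem_convexHull hm hw
    have := norm_proj_le hCne hCcl hCcv w
    linarith

theorem sq_distTo_one_le (ω : ℕ → Round A B X S) : Γ.distTo C ω 1 ^ 2 ≤ Γ.constK C := by
  rw [distTo_eq_norm hCne hCcl hCcv]
  have h : avgPayoff (Γ.playerHistory ω 1) = Γ.roundPayoff (ω 0) := by
    rw [avgPayoff_playerHistory]
    simp
  rw [h]
  exact sq_norm_sub_proj_le_constK hCne hCcl hCcv hm (roundPayoff_mem_payoffSet _)
    (subset_convexHull ℝ _ (roundPayoff_mem_payoffSet _))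

/-- One step of Blackwell's recursion on squared distances. -/
theorem sq_distTo_succ_le (ω : ℕ → Round A B X S) {t : ℕ} (ht : 1 ≤ t) :
    ((t : ℝ) + 1) ^ 2 * Γ.distTo C ω (t + 1) ^ 2 ≤
      (t : ℝ) ^ 2 * Γ.distTo C ω t ^ 2 + Γ.constK C +
        2 * t * (inner ℝ (avgPayoff (Γ.playerHistory ω t) - proj C (avgPayoff (Γ.playerHistory ω t)))
            (Γ.roundPayoff (ω t)) -
          inner ℝ (avgPayoff (Γ.playerHistory ω t) - proj C (avgPayoff (Γ.playerHistory ω t)))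
            (proj C (avgPayoff (Γ.playerHistory ω t)))) := by
  have hK := sq_norm_sub_proj_le_constK hCne hCcl hCcv hm (roundPayoff_mem_payoffSet (ω t))
    (avgPayoff_mem_convexHull (Γ := Γ) ω ht)
  have hs := smul_avgPayoff_succ (Γ := Γ) ω t
  -- The new distance is bounded by the distance to the old projection `c`, which makes the
  -- expansion of the square explicit.
  have hd := (proj_spec hCne hCcl hCcv (avgPayoff (Γ.playerHistory ω (t + 1)))).2 _
    (proj_mem hCne hCcl hCcv (avgPayoff (Γ.playerHistory ω t)))
  rw [distTo_eq_norm hCne hCcl hCcv, distTo_eq_norm hCne hCcl hCcv, ← inner_sub_right]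
  set v := avgPayoff (Γ.playerHistory ω t)
  set v' := avgPayoff (Γ.playerHistory ω (t + 1))
  set c := proj C v
  set m := Γ.roundPayoff (ω t)
  have e1 : ((t : ℝ) + 1) • (v' - c) = (t : ℝ) • (v - c) + (m - c) := by
    rw [smul_sub, hs]
    module
  have e2 : ((t : ℝ) + 1) ^ 2 * ‖v' - c‖ ^ 2 = ‖(t : ℝ) • (v - c) + (m - c)‖ ^ 2 := by
    rw [← e1, norm_smul, mul_pow, Real.norm_of_nonneg (by positivity)]
  have e3 : ‖(t : ℝ) • (v - c) + (m - c)‖ ^ 2 =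
      (t : ℝ) ^ 2 * ‖v - c‖ ^ 2 + 2 * t * inner ℝ (v - c) (m - c) + ‖m - c‖ ^ 2 := by
    rw [norm_add_sq_real, norm_smul, mul_pow, Real.norm_of_nonneg (by positivity),
      real_inner_smul_left]
    ring
  have h1 : ((t : ℝ) + 1) ^ 2 * ‖v' - proj C v'‖ ^ 2 ≤ ((t : ℝ) + 1) ^ 2 * ‖v' - c‖ ^ 2 := by
    gcongr
  linarith

end ConvexTarget

end Deterministic

variable {A B X S : Type*} [Fintype A] [MeasurableSpace A] [MeasurableSingletonClass A]
  [Fintype B] [MeasurableSpace B] [MeasurableSingletonClass B]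
  [MeasurableSpace X] [MeasurableSpace S] {d : ℕ} {Γ : Game A B X S d}
  {C : Set (EuclideanSpace ℝ (Fin d))}

theorem measurable_playerHistory (t : ℕ) :
    Measurable fun ω : ℕ → Round A B X S => Γ.playerHistory ω t :=
  measurable_playerInfo.comp (measurable_fullHistory t)

theorem measurable_distTo (t : ℕ) : Measurable fun ω => Γ.distTo C ω t :=
  (Metric.continuous_infDist_pt C).measurable.comp
    (measurable_avgPayoff.comp (measurable_playerHistory t))

/-! ### The recursion in expectation and the mean-square rate -/

section Expectation

variable (Q : Measure (X × S)) [IsProbabilityMeasure Q] (σ : PlayerStrategy A X S d)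
  (τ : NatureStrategy A B X S)

/-- Rewritten as an integral against the round kernel, the expected payoff inherits measurability in
the history from that kernel. -/
theorem measurable_expectedPayoff_families (hm : Γ.BoundedPayoff) (t : ℕ) :
    Measurable fun H : FullHistory A B X S t =>
      Γ.expectedPayoff Q (playerFamily σ (Γ.playerInfo H)) (natureFamily τ H) := by
  simp_rw [← integral_roundPayoff_roundKernel Q σ τ hm]
  have h : StronglyMeasurable fun z : FullHistory A B X S t × Round A B X S =>
      Γ.roundPayoff z.2 := (measurable_roundPayoff.comp measurable_snd).stronglyMeasurable
  exact h.integral_kernel_prod_right'.measurable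

/-- The payoff of round `t + 1` integrates, against a function of the past, as its conditional
expectation. -/
theorem integral_inner_roundPayoff (hm : Γ.BoundedPayoff) (t : ℕ)
    {ψ : FullHistory A B X S t → EuclideanSpace ℝ (Fin d)} (hψ : Measurable ψ) {c : ℝ}
    (hc : ∀ H, ‖ψ H‖ ≤ c) :
    ∫ ω, inner ℝ (ψ (fullHistory t ω)) (Γ.roundPayoff (ω t)) ∂(Γ.playLaw Q σ τ) =
      ∫ ω, inner ℝ (ψ (fullHistory t ω))
        (Γ.expectedPayoff Q (playerFamily σ (Γ.playerHistory ω t))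
          (natureFamily τ (fullHistory t ω))) ∂(Γ.playLaw Q σ τ) := by
  have hmeas : Measurable fun z : FullHistory A B X S t × Round A B X S =>
      (inner ℝ (ψ z.1) (Γ.roundPayoff z.2) : ℝ) :=
    (hψ.comp measurable_fst).inner (measurable_roundPayoff.comp measurable_snd)
  have hpair : Measurable fun ω : ℕ → Round A B X S => (fullHistory t ω, ω t) :=
    (measurable_fullHistory t).prodMk (measurable_pi_apply t)
  have hint : ∀ (μ : Measure (FullHistory A B X S t × Round A B X S)) [IsProbabilityMeasure μ],
      Integrable (fun z => (inner ℝ (ψ z.1) (Γ.roundPayoff z.2) : ℝ)) μ := fun μ _ =>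
    integrable_of_bounded hmeas (c := c * Γ.supNorm) fun z =>
      (norm_inner_le_norm _ _).trans (mul_le_mul (hc _) (norm_roundPayoff_le hm _)
        (norm_nonneg _) ((norm_nonneg _).trans (hc z.1)))
  have h1 := integral_map (μ := Γ.playLaw Q σ τ) hpair.aemeasurable
    (f := fun z => (inner ℝ (ψ z.1) (Γ.roundPayoff z.2) : ℝ)) hmeas.aestronglyMeasurable
  have hprob : IsProbabilityMeasure ((Γ.playLaw Q σ τ).map (fullHistory t)) :=
    Measure.isProbabilityMeasure_map (measurable_fullHistory t).aemeasurable
  rw [map_playLaw_eq_compProd, Measure.integral_compProd (hint _)] at h1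
  rw [← h1, integral_map (measurable_fullHistory t).aemeasurable]
  · refine integral_congr_ae (Eventually.of_forall fun ω => ?_)
    simp only
    rw [integral_inner, integral_roundPayoff_roundKernel Q σ τ hm]
    · rfl
    · exact integrable_of_bounded measurable_roundPayoff fun r => norm_roundPayoff_le hm r
  · exact hmeas.stronglyMeasurable.integral_kernel_prod_right'.aestronglyMeasurable

variable {Q σ τ} {Qhat : Estimator X S d}

/-- The estimation error after `t` rounds along a play. -/
noncomputable def tvAlong (Γ : Game A B X S d) (Q : Measure (X × S)) (Qhat : Estimator X S d)
    (t : ℕ) (ω : ℕ → Round A B X S) : ℝ :=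
  tvDist ((Qhat t).1 (Γ.playerHistory ω t)) Q

theorem measurable_tvAlong [StandardBorelSpace X] [Fintype S] [MeasurableSingletonClass S]
    (t : ℕ) : Measurable (Γ.tvAlong Q Qhat t) := by
  have := (Qhat t).2
  exact (measurable_tvDist Q (Qhat t).1).comp (measurable_playerHistory t)

theorem tvAlong_nonneg {A B X S : Type*} [MeasurableSpace X] [MeasurableSpace S] {d : ℕ}
    {Γ : Game A B X S d} {Q : Measure (X × S)} [IsProbabilityMeasure Q] {Qhat : Estimator X S d}
    (t : ℕ) (ω : ℕ → Round A B X S) : 0 ≤ Γ.tvAlong Q Qhat t ω := by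
  have := (Qhat t).2
  exact tvDist_nonneg _ _

theorem tvAlong_le_one {A B X S : Type*} [MeasurableSpace X] [MeasurableSpace S] {d : ℕ}
    {Γ : Game A B X S d} {Q : Measure (X × S)} [IsProbabilityMeasure Q] {Qhat : Estimator X S d}
    (t : ℕ) (ω : ℕ → Round A B X S) : Γ.tvAlong Q Qhat t ω ≤ 1 := by
  have := (Qhat t).2
  exact tvDist_le_one _ _

theorem tvError_eq (t : ℕ) :
    Γ.tvError Q σ τ Qhat t = √(∫ ω, Γ.tvAlong Q Qhat t ω ^ 2 ∂(Γ.playLaw Q σ τ)) := rfl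

theorem tvError_nonneg (t : ℕ) : 0 ≤ Γ.tvError Q σ τ Qhat t := Real.sqrt_nonneg _

theorem tvError_le_one (t : ℕ) : Γ.tvError Q σ τ Qhat t ≤ 1 := by
  rw [tvError_eq, Real.sqrt_le_left zero_le_one, one_pow]
  calc ∫ ω, Γ.tvAlong Q Qhat t ω ^ 2 ∂(Γ.playLaw Q σ τ)
      ≤ ∫ _, (1 : ℝ) ∂(Γ.playLaw Q σ τ) := by
        refine integral_mono_of_nonneg (Eventually.of_forall fun ω => sq_nonneg _)
          (integrable_const _) (Eventually.of_forall fun ω => ?_)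
        exact pow_le_one₀ (tvAlong_nonneg t ω) (tvAlong_le_one t ω)
    _ = 1 := by simp

variable [Nonempty A] [Nonempty B] [Fintype S] [MeasurableSingletonClass S] [Nonempty S]
  [StandardBorelSpace X]
  (hm : Γ.BoundedPayoff) (hCne : C.Nonempty) (hCcl : IsClosed C) (hCcv : Convex ℝ C)
include hm hCne hCcl hCcv

/-- Blackwell's recursion in expectation, with a weight depending on the past. -/
theorem integral_weighted_sq_distTo_succ_le (hB : Γ.BlackwellCondition Q C)
    (hσ : Γ.IsBlackwellStrategy C Qhat σ) {t : ℕ} (ht : 1 ≤ t)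
    {φ : FullHistory A B X S t → ℝ} (hφ : Measurable φ) (hφ0 : ∀ H, 0 ≤ φ H)
    (hφ1 : ∀ H, φ H ≤ 1) :
    ((t : ℝ) + 1) ^ 2 *
        ∫ ω, φ (fullHistory t ω) * Γ.distTo C ω (t + 1) ^ 2 ∂(Γ.playLaw Q σ τ) ≤
      (t : ℝ) ^ 2 * ∫ ω, φ (fullHistory t ω) * Γ.distTo C ω t ^ 2 ∂(Γ.playLaw Q σ τ) +
        Γ.constK C + 8 * t * Γ.supNorm *
          (√(∫ ω, Γ.distTo C ω t ^ 2 ∂(Γ.playLaw Q σ τ)) * Γ.tvError Q σ τ Qhat t) := by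
  set P := Γ.playLaw Q σ τ
  set R := Γ.supNorm + ‖proj C 0‖
  have hM := Γ.supNorm_nonneg
  have hR0 : 0 ≤ R := add_nonneg hM (norm_nonneg _)
  have hdR : ∀ ω s, Γ.distTo C ω s ≤ R := distTo_le hCne hCcl hCcv hm
  have hφω : Measurable fun ω : ℕ → Round A B X S => φ (fullHistory t ω) :=
    hφ.comp (measurable_fullHistory t)
  let v : FullHistory A B X S t → EuclideanSpace ℝ (Fin d) := fun H => avgPayoff (Γ.playerInfo H)
  let u : FullHistory A B X S t → EuclideanSpace ℝ (Fin d) := fun H => v H - proj C (v H)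
  have hv : Measurable v := measurable_avgPayoff.comp measurable_playerInfo
  have hpv : Measurable fun H => proj C (v H) :=
    (lipschitzWith_proj hCne hCcl hCcv).continuous.measurable.comp hv
  have hu : Measurable u := hv.sub hpv
  have hunorm : ∀ ω, ‖u (fullHistory t ω)‖ = Γ.distTo C ω t := fun ω =>
    (distTo_eq_norm hCne hCcl hCcv ω t).symm
  -- Every finite history extends to a play (as `t ≥ 1`, its first round can serve as filler), so
  -- bounds proved along plays transfer to all histories.
  have hext : ∀ H : FullHistory A B X S t, ∃ ω : ℕ → Round A B X S, fullHistory t ω = H := by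
    intro H
    refine ⟨fun n => if h : n < t then H ⟨n, h⟩ else H ⟨0, ht⟩, ?_⟩
    funext i
    simp [fullHistory]
  have huR : ∀ H, ‖u H‖ ≤ R := by
    intro H
    obtain ⟨ω, rfl⟩ := hext H
    rw [hunorm]
    exact hdR ω t
  have hvM : ∀ H, ‖v H‖ ≤ Γ.supNorm := by
    intro H
    obtain ⟨ω, rfl⟩ := hext H
    exact norm_avgPayoff_le hm ω t
  have hpvR : ∀ H, ‖proj C (v H)‖ ≤ ‖proj C 0‖ + Γ.supNorm := fun H =>
    (norm_proj_le hCne hCcl hCcv _).trans (add_le_add le_rfl (hvM H))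
  have hφabs : ∀ H, |φ H| ≤ 1 := fun H => abs_le.2 ⟨by linarith [hφ0 H], hφ1 H⟩
  -- integrability
  have hI0 : ∀ s, Integrable (fun ω => φ (fullHistory t ω) * Γ.distTo C ω s ^ 2) P := fun s =>
    integrable_of_bounded (hφω.mul ((measurable_distTo s).pow_const 2)) (c := 1 * R ^ 2)
      fun ω => by
        rw [norm_mul, norm_pow]
        refine mul_le_mul (hφabs _) (pow_le_pow_left₀ (norm_nonneg _) ?_ 2) (by positivity)
          zero_le_one
        rw [Real.norm_of_nonneg (distTo_nonneg _ _)]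
        exact hdR ω s
  have hIφ : Integrable (fun ω => φ (fullHistory t ω) * Γ.constK C) P :=
    integrable_of_bounded (hφω.mul_const _) (c := 1 * |Γ.constK C|) fun ω => by
      rw [norm_mul]
      exact mul_le_mul_of_nonneg_right (hφabs _) (abs_nonneg _)
  let ψ : FullHistory A B X S t → EuclideanSpace ℝ (Fin d) := fun H => φ H • u H
  have hψ : Measurable ψ := hφ.smul hu
  have hψR : ∀ H, ‖ψ H‖ ≤ R := fun H => by
    rw [norm_smul]
    calc ‖φ H‖ * ‖u H‖ ≤ 1 * R := mul_le_mul (hφabs H) (huR H) (norm_nonneg _) zero_le_one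
      _ = R := one_mul R
  have hI1 : Integrable (fun ω => (inner ℝ (ψ (fullHistory t ω)) (Γ.roundPayoff (ω t)) : ℝ)) P :=
    integrable_of_bounded ((hψ.comp (measurable_fullHistory t)).inner
      (measurable_roundPayoff.comp (measurable_pi_apply t))) (c := R * Γ.supNorm) fun ω =>
      (norm_inner_le_norm _ _).trans (mul_le_mul (hψR _) (norm_roundPayoff_le hm _)
        (norm_nonneg _) hR0)
  have hI2 : Integrable (fun ω => (inner ℝ (ψ (fullHistory t ω))
      (proj C (v (fullHistory t ω))) : ℝ)) P :=
    integrable_of_bounded ((hψ.inner hpv).comp (measurable_fullHistory t))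
      (c := R * (‖proj C 0‖ + Γ.supNorm)) fun ω =>
      (norm_inner_le_norm _ _).trans (mul_le_mul (hψR _) (hpvR _) (norm_nonneg _) hR0)
  have hI3 : Integrable (fun ω => (inner ℝ (ψ (fullHistory t ω))
      (Γ.expectedPayoff Q (playerFamily σ (Γ.playerHistory ω t))
        (natureFamily τ (fullHistory t ω))) : ℝ)) P :=
    integrable_of_bounded ((hψ.inner
      (measurable_expectedPayoff_families Q σ τ hm t)).comp (measurable_fullHistory t))
      (c := R * Γ.supNorm) fun ω =>
      (norm_inner_le_norm _ _).trans (mul_le_mul (hψR _) (norm_expectedPayoff_le hm _ _ _)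
        (norm_nonneg _) hR0)
  have hI4 : Integrable (fun ω => Γ.distTo C ω t * Γ.tvAlong Q Qhat t ω) P :=
    integrable_of_bounded ((measurable_distTo t).mul (measurable_tvAlong t)) (c := R * 1)
      fun ω => by
        rw [Real.norm_of_nonneg (mul_nonneg (distTo_nonneg _ _) (tvAlong_nonneg _ _))]
        exact mul_le_mul (hdR ω t) (tvAlong_le_one t ω) (tvAlong_nonneg _ _) hR0
  -- the pointwise recursion
  have step1 : ((t : ℝ) + 1) ^ 2 * ∫ ω, φ (fullHistory t ω) * Γ.distTo C ω (t + 1) ^ 2 ∂P ≤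
      (t : ℝ) ^ 2 * ∫ ω, φ (fullHistory t ω) * Γ.distTo C ω t ^ 2 ∂P +
        ∫ ω, φ (fullHistory t ω) * Γ.constK C ∂P +
        2 * t * (∫ ω, inner ℝ (ψ (fullHistory t ω)) (Γ.roundPayoff (ω t)) ∂P -
          ∫ ω, inner ℝ (ψ (fullHistory t ω)) (proj C (v (fullHistory t ω))) ∂P) := by
    have hJ1 : Integrable (fun ω => (t : ℝ) ^ 2 * (φ (fullHistory t ω) * Γ.distTo C ω t ^ 2) +
        φ (fullHistory t ω) * Γ.constK C) P := ((hI0 t).const_mul _).add hIφ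
    have hJ2 : Integrable (fun ω => 2 * (t : ℝ) *
        (inner ℝ (ψ (fullHistory t ω)) (Γ.roundPayoff (ω t)) -
          inner ℝ (ψ (fullHistory t ω)) (proj C (v (fullHistory t ω))))) P :=
      (hI1.sub hI2).const_mul _
    rw [← integral_const_mul, ← integral_const_mul, ← integral_sub hI1 hI2, ← integral_const_mul,
      ← integral_add ((hI0 t).const_mul _) hIφ, ← integral_add hJ1 hJ2]
    refine integral_mono ((hI0 (t + 1)).const_mul _) (hJ1.add hJ2) fun ω => ?_
    have h : φ (fullHistory t ω) * (((t : ℝ) + 1) ^ 2 * Γ.distTo C ω (t + 1) ^ 2) ≤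
        φ (fullHistory t ω) * ((t : ℝ) ^ 2 * Γ.distTo C ω t ^ 2 + Γ.constK C +
          2 * t * (inner ℝ (u (fullHistory t ω)) (Γ.roundPayoff (ω t)) -
            inner ℝ (u (fullHistory t ω)) (proj C (v (fullHistory t ω))))) :=
      mul_le_mul_of_nonneg_left (sq_distTo_succ_le hCne hCcl hCcv hm ω ht)
        (hφ0 (fullHistory t ω))
    simp only [ψ, real_inner_smul_left]
    linarith
  -- the conditional expectation of the payoff
  have step2 : ∫ ω, inner ℝ (ψ (fullHistory t ω)) (Γ.roundPayoff (ω t)) ∂P -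
      ∫ ω, inner ℝ (ψ (fullHistory t ω)) (proj C (v (fullHistory t ω))) ∂P ≤
      4 * Γ.supNorm * ∫ ω, Γ.distTo C ω t * Γ.tvAlong Q Qhat t ω ∂P := by
    rw [integral_inner_roundPayoff Q σ τ hm t hψ hψR, ← integral_sub hI3 hI2,
      ← integral_const_mul]
    refine integral_mono (hI3.sub hI2) (hI4.const_mul _) fun ω => ?_
    have := (Qhat t).2
    have h := inner_expectedPayoff_sub_proj_le hm hCne hCcl hCcv hB
      (hσ t ht (Γ.playerHistory ω t)) (natureFamily τ (fullHistory t ω))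
    rw [← distTo_eq_norm hCne hCcl hCcv] at h
    simp only [ψ, real_inner_smul_left]
    rw [← mul_sub]
    have h2 : inner ℝ (u (fullHistory t ω))
        (Γ.expectedPayoff Q (playerFamily σ (Γ.playerHistory ω t))
          (natureFamily τ (fullHistory t ω))) -
        inner ℝ (u (fullHistory t ω)) (proj C (v (fullHistory t ω))) ≤
        4 * Γ.supNorm * (Γ.distTo C ω t * Γ.tvAlong Q Qhat t ω) := sub_le_iff_le_add'.2 h
    -- Nonnegativity of the error permits dropping the weight `φ ≤ 1`, so the error term is the same
    -- for all weights.
    have h3 : 0 ≤ 4 * Γ.supNorm * (Γ.distTo C ω t * Γ.tvAlong Q Qhat t ω) :=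
      mul_nonneg (by positivity) (mul_nonneg (distTo_nonneg _ _) (tvAlong_nonneg _ _))
    calc _ ≤ φ (fullHistory t ω) *
          (4 * Γ.supNorm * (Γ.distTo C ω t * Γ.tvAlong Q Qhat t ω)) :=
          mul_le_mul_of_nonneg_left h2 (hφ0 _)
      _ ≤ _ := mul_le_of_le_one_left h3 (hφ1 _)
  have step3 : ∫ ω, Γ.distTo C ω t * Γ.tvAlong Q Qhat t ω ∂P ≤
      √(∫ ω, Γ.distTo C ω t ^ 2 ∂P) * Γ.tvError Q σ τ Qhat t :=
    integral_mul_le_sqrt_mul_sqrt (measurable_distTo t) (measurable_tvAlong t) (c := max R 1)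
      (fun ω => distTo_nonneg ω t) (tvAlong_nonneg t) (fun ω => (hdR ω t).trans (le_max_left _ _))
      (fun ω => (tvAlong_le_one t ω).trans (le_max_right _ _))
  have step4 : ∫ ω, φ (fullHistory t ω) * Γ.constK C ∂P ≤ Γ.constK C := by
    calc ∫ ω, φ (fullHistory t ω) * Γ.constK C ∂P ≤ ∫ _, Γ.constK C ∂P :=
          integral_mono hIφ (integrable_const _) fun ω =>
            mul_le_of_le_one_left (constK_nonneg) (hφ1 _)
      _ = Γ.constK C := by simp
  have step5 := step2.trans (mul_le_mul_of_nonneg_left step3 (by positivity))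
  have step6 := mul_le_mul_of_nonneg_left step5 (by positivity : (0 : ℝ) ≤ 2 * t)
  linarith

/-- The rate in mean square. -/
theorem sqrt_integral_sq_distTo_le (hB : Γ.BlackwellCondition Q C)
    (hσ : Γ.IsBlackwellStrategy C Qhat σ) {T : ℕ} (hT : 1 ≤ T) :
    √(∫ ω, Γ.distTo C ω T ^ 2 ∂(Γ.playLaw Q σ τ)) ≤
      √(Γ.constK C / T) + 4 * Γ.supNorm * Γ.avgTvError Q σ τ Qhat T := by
  refine sqrt_le_of_sq_recursion constK_nonneg Γ.supNorm_nonneg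
    (D := fun t => ∫ ω, Γ.distTo C ω t ^ 2 ∂(Γ.playLaw Q σ τ))
    (fun t => integral_nonneg fun ω => sq_nonneg _) (fun t => tvError_nonneg t) ?_ ?_ hT
  · calc ∫ ω, Γ.distTo C ω 1 ^ 2 ∂(Γ.playLaw Q σ τ) ≤ ∫ _, Γ.constK C ∂(Γ.playLaw Q σ τ) :=
          integral_mono_of_nonneg (Eventually.of_forall fun ω => sq_nonneg _)
            (integrable_const _)
            (Eventually.of_forall fun ω => sq_distTo_one_le hCne hCcl hCcv hm ω)
      _ = Γ.constK C := by simp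
  · intro t ht
    have h := integral_weighted_sq_distTo_succ_le (τ := τ) hm hCne hCcl hCcv hB hσ ht
      (φ := fun _ => 1) measurable_const (fun _ => zero_le_one) (fun _ => le_rfl)
    simpa only [one_mul] using h

end Expectation

end Game

/-! ### Telescoping estimates and a Kronecker lemma -/

section RealSums

theorem one_div_add_one_sq_le {t : ℝ} (ht : 0 < t) :
    1 / (t + 1) ^ 2 ≤ 1 / t - 1 / (t + 1) := by
  have : 1 / t - 1 / (t + 1) = 1 / (t * (t + 1)) := by field_simp; ring
  rw [this]
  exact one_div_le_one_div_of_le (by positivity) (by nlinarith)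

/-- With `a = √(t-1) ≤ b = √t` and `b² - a² = 1`, the difference `1/a - 1/b` equals `1/(ab(a+b))`,
which is at least `1/(2b³)`. This makes the sum of `t^(-3/2)` telescope. -/
theorem one_div_mul_sqrt_le {t : ℝ} (ht : 1 < t) :
    1 / (t * √t) ≤ 2 * (1 / √(t - 1) - 1 / √t) := by
  have ha : 0 < √(t - 1) := Real.sqrt_pos.2 (by linarith)
  have hb : 0 < √t := Real.sqrt_pos.2 (by linarith)
  have hab : √(t - 1) ≤ √t := Real.sqrt_le_sqrt (by linarith)
  have ea : √(t - 1) ^ 2 = t - 1 := Real.sq_sqrt (by linarith)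
  have eb : √t ^ 2 = t := Real.sq_sqrt (by linarith)
  set a := √(t - 1)
  set b := √t
  have hsub : (b - a) * (b + a) = 1 := by nlinarith
  have h1 : 2 * (1 / a - 1 / b) = 2 / (a * b * (b + a)) := by
    have : 1 / a - 1 / b = (b - a) / (a * b) := by field_simp
    rw [this, eq_div_iff (by positivity)]
    field_simp
    linarith
  have h2 : 1 / (t * b) = 2 / (2 * (b ^ 2 * b)) := by
    rw [eb]
    field_simp
  rw [h1, h2]
  refine div_le_div_of_nonneg_left (by norm_num) (by positivity) ?_
  have h3 : a * b ≤ b ^ 2 := by nlinarith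
  nlinarith [mul_le_mul h3 (by linarith : b + a ≤ 2 * b) (by positivity) (by positivity)]

/-- The rate for `√(D t)` is fed back into the error. Its part `√(K/t)`, combined with `δ t ≤ 1`,
yields `8M √K t^(-3/2)`; its part `4M Δ t ≤ 4M s` yields `32M² s δ t / t`. The first sum and that of
`K/(t+1)²` telescope; `T ≥ 2` keeps `√(t-1)` positive. -/
theorem sum_recursion_error_le {K M s : ℝ} (hK : 0 ≤ K) (hM : 0 ≤ M) {D δ Δ : ℕ → ℝ} {T N : ℕ}
    (hT : 2 ≤ T) (hN : T ≤ N) (hδ0 : ∀ t, 0 ≤ δ t) (hδ1 : ∀ t, δ t ≤ 1)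
    (hs : ∀ t, T ≤ t → Δ t ≤ s)
    (hD : ∀ t : ℕ, T ≤ t → √(D t) ≤ √(K / t) + 4 * M * Δ t) :
    ∑ t ∈ Finset.Ico T N, (K + 8 * t * M * (√(D t) * δ t)) / ((t : ℝ) + 1) ^ 2 ≤
      K / T + 16 * M * √(K / (T - 1)) +
        32 * M ^ 2 * s * ∑ t ∈ Finset.Ico T N, δ t / t := by
  have hterm : ∀ t : ℕ, T ≤ t → (K + 8 * t * M * (√(D t) * δ t)) / ((t : ℝ) + 1) ^ 2 ≤
      K * (1 / t - 1 / (t + 1)) + 16 * M * √K * (1 / √((t : ℝ) - 1) - 1 / √t) +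
        32 * M ^ 2 * s * (δ t / t) := by
    intro t ht
    have ht2 : (2 : ℝ) ≤ t := by exact_mod_cast hT.trans ht
    have ht0 : (0 : ℝ) < t := by linarith
    have hst : 0 < √(t : ℝ) := Real.sqrt_pos.2 ht0
    have hδt := hδ0 t
    have h1 := mul_le_mul_of_nonneg_left (one_div_add_one_sq_le ht0) hK
    have h2 := mul_le_mul_of_nonneg_left (one_div_mul_sqrt_le (by linarith : (1 : ℝ) < t))
      (by positivity : 0 ≤ 8 * M * √K)
    have h3 : 8 * t * M * (√(D t) * δ t) / ((t : ℝ) + 1) ^ 2 ≤ 8 * M * (√(D t) * δ t) / t := by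
      rw [div_le_div_iff₀ (by positivity) ht0]
      have : 0 ≤ M * (√(D t) * δ t) := by positivity
      nlinarith
    have h4 : √(D t) * δ t ≤ √(K / t) + 4 * M * s * δ t := by
      calc √(D t) * δ t ≤ (√(K / t) + 4 * M * Δ t) * δ t :=
            mul_le_mul_of_nonneg_right (hD t ht) hδt
        _ = √(K / t) * δ t + 4 * M * Δ t * δ t := by ring
        _ ≤ √(K / t) * 1 + 4 * M * s * δ t := by
            gcongr
            · exact hδ1 t
            · exact hs t ht
        _ = _ := by ring
    have h5 : 8 * M * (√(D t) * δ t) / t ≤ 8 * M * (√(K / t) + 4 * M * s * δ t) / t := by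
      gcongr
    have h6 : 8 * M * (√(K / t) + 4 * M * s * δ t) / t =
        8 * M * √K * (1 / (t * √t)) + 32 * M ^ 2 * s * (δ t / t) := by
      rw [Real.sqrt_div hK]
      field_simp
      ring
    rw [add_div, div_eq_mul_one_div K]
    linarith
  have hsum : ∑ t ∈ Finset.Ico T N, (K + 8 * t * M * (√(D t) * δ t)) / ((t : ℝ) + 1) ^ 2 ≤
      K * (1 / T - 1 / N) + 16 * M * √K * (1 / √((T : ℝ) - 1) - 1 / √((N : ℝ) - 1)) +
        32 * M ^ 2 * s * ∑ t ∈ Finset.Ico T N, δ t / t := by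
    induction N, hN using Nat.le_induction with
    | base => simp
    | succ n hn ih =>
      rw [Finset.sum_Ico_succ_top hn, Finset.sum_Ico_succ_top hn]
      have h := hterm n hn
      push_cast
      rw [add_sub_cancel_right]
      linarith
  have hT2 : (2 : ℝ) ≤ T := by exact_mod_cast hT
  have hN2 : (2 : ℝ) ≤ N := by exact_mod_cast hT.trans hN
  have e1 : √(K / ((T : ℝ) - 1)) = √K * (1 / √((T : ℝ) - 1)) := by
    rw [Real.sqrt_div hK]
    ring
  have h1 : 0 ≤ K * (1 / (N : ℝ)) := by positivity
  have h2 : 0 ≤ 16 * M * √K * (1 / √((N : ℝ) - 1)) := by positivity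
  rw [e1, div_eq_mul_one_div K (T : ℝ)]
  linarith

/-- Dominated convergence for series: for `1 ≤ t < T` the term `δ t / T` is at most `δ t / t`, and
each term vanishes as `T` grows. -/
theorem tendsto_average_of_summable_div {δ : ℕ → ℝ} (hδ : ∀ t, 0 ≤ δ t)
    (hsum : Summable fun t : ℕ => δ t / t) :
    Tendsto (fun T : ℕ => 1 / (T : ℝ) * ∑ t ∈ Finset.Ico 1 T, δ t) atTop (𝓝 0) := by
  have h := tendsto_tsum_of_dominated_convergence (𝓕 := atTop) hsum
    (f := fun (T t : ℕ) => if t ∈ Finset.Ico 1 T then 1 / (T : ℝ) * δ t else 0)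
    (g := fun _ => 0) ?_ ?_
  · simp only [tsum_zero] at h
    refine h.congr fun T => ?_
    rw [tsum_eq_sum (s := Finset.Ico 1 T) fun t ht => if_neg ht, Finset.mul_sum]
    exact Finset.sum_congr rfl fun t ht => if_pos ht
  · intro t
    have h1 : Tendsto (fun T : ℕ => 1 / (T : ℝ) * δ t) atTop (𝓝 0) := by
      simpa using (tendsto_one_div_atTop_nhds_zero_nat (𝕜 := ℝ)).mul_const (δ t)
    refine squeeze_zero (fun T => ?_) (fun T => ?_) h1
    · split_ifs
      · exact mul_nonneg (by positivity) (hδ t)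
      · exact le_rfl
    · split_ifs
      · exact le_rfl
      · exact mul_nonneg (by positivity) (hδ t)
  · refine Eventually.of_forall fun T t => ?_
    split_ifs with ht
    · rw [Real.norm_of_nonneg (mul_nonneg (by positivity) (hδ t)), one_div_mul_eq_div]
      obtain ⟨h1, h2⟩ := Finset.mem_Ico.1 ht
      exact div_le_div_of_nonneg_left (hδ t) (by exact_mod_cast h1) (by exact_mod_cast h2.le)
    · rw [norm_zero]
      exact div_nonneg (hδ t) (Nat.cast_nonneg t)

end RealSums

/-! ### The maximal inequality and almost sure convergence -/

namespace Game

variable {A B X S : Type*} [Fintype A] [MeasurableSpace A] [MeasurableSingletonClass A]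
  [Fintype B] [MeasurableSpace B] [MeasurableSingletonClass B]
  [MeasurableSpace X] [MeasurableSpace S] {d : ℕ} {Γ : Game A B X S d}
  {C : Set (EuclideanSpace ℝ (Fin d))}
  {Q : Measure (X × S)} [IsProbabilityMeasure Q] {σ : PlayerStrategy A X S d}
  {τ : NatureStrategy A B X S} {Qhat : Estimator X S d}

/-- The plays that stay at distance less than `ε` of `C` from round `T` to round `N`. -/
def closePlays (Γ : Game A B X S d) (C : Set (EuclideanSpace ℝ (Fin d))) (ε : ℝ) (T N : ℕ) :
    Set (ℕ → Round A B X S) :=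
  {ω | ∀ j : Fin (N + 1), T ≤ j → Γ.distTo C ω j < ε}

theorem measurableSet_closePlays (ε : ℝ) (T N : ℕ) :
    MeasurableSet (Γ.closePlays C ε T N) := by
  have : Γ.closePlays C ε T N =
      ⋂ j : Fin (N + 1), ⋂ _ : T ≤ j, {ω | Γ.distTo C ω j < ε} := by
    ext ω
    simp [closePlays]
  rw [this]
  exact MeasurableSet.iInter fun j => MeasurableSet.iInter fun _ =>
    measurableSet_lt (measurable_distTo j) measurable_const

/-- Staying close until round `N` is determined by the first `N` rounds. -/
theorem exists_measurableSet_closePlays_eq (Γ : Game A B X S d)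
    (C : Set (EuclideanSpace ℝ (Fin d))) (ε : ℝ) (T N : ℕ) :
    ∃ E : Set (FullHistory A B X S N), MeasurableSet E ∧
      ∀ ω, fullHistory N ω ∈ E ↔ ω ∈ Γ.closePlays C ε T N := by
  let g : ∀ j : Fin (N + 1), FullHistory A B X S N → ℝ := fun j H =>
    Metric.infDist (avgPayoff (Γ.playerInfo
      fun i : Fin j => H (Fin.castLE (Nat.lt_succ_iff.1 j.2) i))) C
  have hg : ∀ j, Measurable (g j) := fun j =>
    (Metric.continuous_infDist_pt C).measurable.comp (measurable_avgPayoff.comp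
      (measurable_playerInfo.comp (measurable_pi_lambda _ fun i => measurable_pi_apply _)))
  refine ⟨⋂ j : Fin (N + 1), ⋂ _ : T ≤ j, {H | g j H < ε},
    MeasurableSet.iInter fun j => MeasurableSet.iInter fun _ =>
      measurableSet_lt (hg j) measurable_const, fun ω => ?_⟩
  simp only [Set.mem_iInter]
  rfl

theorem mem_closePlays_succ {A B X S : Type*} [MeasurableSpace X] [MeasurableSpace S] {d : ℕ}
    {Γ : Game A B X S d} {C : Set (EuclideanSpace ℝ (Fin d))} {ε : ℝ} {T N : ℕ} (hN : T ≤ N + 1) (ω : ℕ → Round A B X S) :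
    ω ∈ Γ.closePlays C ε T (N + 1) ↔
      ω ∈ Γ.closePlays C ε T N ∧ Γ.distTo C ω (N + 1) < ε := by
  constructor
  · intro h
    exact ⟨fun j hj => h j.castSucc hj, h (Fin.last _) hN⟩
  · rintro ⟨h1, h2⟩ j hj
    induction j using Fin.lastCases with
    | last => exact h2
    | cast j => exact h1 j hj

theorem avgTvError_nonneg (t : ℕ) : 0 ≤ Γ.avgTvError Q σ τ Qhat t :=
  mul_nonneg (by positivity) (Finset.sum_nonneg fun i _ => tvError_nonneg i)

theorem avgTvError_le_one (t : ℕ) : Γ.avgTvError Q σ τ Qhat t ≤ 1 := by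
  rcases Nat.eq_zero_or_pos t with rfl | ht
  · simp [avgTvError]
  have ht0 : (0 : ℝ) < t := by exact_mod_cast ht
  rw [avgTvError, one_div_mul_eq_div, div_le_one ht0]
  calc ∑ i ∈ Finset.Ico 1 t, Γ.tvError Q σ τ Qhat i ≤ ∑ i ∈ Finset.Ico 1 t, (1 : ℝ) :=
        Finset.sum_le_sum fun i _ => tvError_le_one i
    _ = ((t - 1 : ℕ) : ℝ) := by simp
    _ ≤ t := by exact_mod_cast Nat.sub_le t 1

theorem bddAbove_avgTvError (T : ℕ) :
    BddAbove (Set.range fun k => Γ.avgTvError Q σ τ Qhat (T + k)) :=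
  ⟨1, by rintro _ ⟨k, rfl⟩; exact avgTvError_le_one _⟩

theorem summable_tvError_div (h : Γ.FastEstimation Q σ τ Qhat) :
    Summable fun t : ℕ => Γ.tvError Q σ τ Qhat t / t :=
  (summable_nat_add_iff 1).1 h

/-- The numerator of the bound on the probability of a late deviation. -/
noncomputable def maximalBound (Γ : Game A B X S d) (C : Set (EuclideanSpace ℝ (Fin d)))
    (Q : Measure (X × S)) [IsProbabilityMeasure Q] (σ : PlayerStrategy A X S d)
    (τ : NatureStrategy A B X S) (Qhat : Estimator X S d) (T : ℕ) : ℝ :=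
  3 * Γ.constK C / T + 16 * Γ.supNorm * (√(Γ.constK C / (T - 1)) +
    2 * Γ.supNorm * (⨆ k : ℕ, Γ.avgTvError Q σ τ Qhat (T + k)) *
      (Γ.avgTvError Q σ τ Qhat T +
        ∑' k : ℕ, Γ.tvError Q σ τ Qhat (T + k) / ((T + k : ℕ) : ℝ)))

/-- The average error vanishes by the Kronecker lemma and the tail sum by summability; the supremum
factor only needs the trivial bound 1. -/
theorem tendsto_maximalBound (h : Γ.FastEstimation Q σ τ Qhat) :
    Tendsto (Γ.maximalBound C Q σ τ Qhat) atTop (𝓝 0) := by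
  have hinv : Tendsto (fun T : ℕ => (T : ℝ)⁻¹) atTop (𝓝 0) := tendsto_inv_atTop_nhds_zero_nat
  have h1 : Tendsto (fun T : ℕ => 3 * Γ.constK C / (T : ℝ)) atTop (𝓝 0) := by
    simpa [div_eq_mul_inv] using hinv.const_mul (3 * Γ.constK C)
  have h2 : Tendsto (fun T : ℕ => √(Γ.constK C / ((T : ℝ) - 1))) atTop (𝓝 0) := by
    have : Tendsto (fun T : ℕ => Γ.constK C / ((T : ℝ) - 1)) atTop (𝓝 0) :=
      Tendsto.const_div_atTop (tendsto_atTop_add_const_right _ (-1)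
        (tendsto_natCast_atTop_atTop (R := ℝ))) _
    simpa using this.sqrt
  have hΔ : Tendsto (fun T => Γ.avgTvError Q σ τ Qhat T) atTop (𝓝 0) :=
    tendsto_average_of_summable_div (fun t => tvError_nonneg t) (summable_tvError_div h)
  have htail : Tendsto (fun T : ℕ => ∑' k : ℕ, Γ.tvError Q σ τ Qhat (T + k) / ((T + k : ℕ) : ℝ))
      atTop (𝓝 0) := by
    have := tendsto_sum_nat_add fun t : ℕ => Γ.tvError Q σ τ Qhat t / t
    refine this.congr fun T => tsum_congr fun k => ?_
    rw [add_comm]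
  have hprod : Tendsto (fun T : ℕ => (⨆ k : ℕ, Γ.avgTvError Q σ τ Qhat (T + k)) *
      (Γ.avgTvError Q σ τ Qhat T +
        ∑' k : ℕ, Γ.tvError Q σ τ Qhat (T + k) / ((T + k : ℕ) : ℝ))) atTop (𝓝 0) := by
    have hs : Tendsto (fun T : ℕ => Γ.avgTvError Q σ τ Qhat T +
        ∑' k : ℕ, Γ.tvError Q σ τ Qhat (T + k) / ((T + k : ℕ) : ℝ)) atTop (𝓝 0) := by
      simpa using hΔ.add htail
    have hnn : ∀ T : ℕ, 0 ≤ Γ.avgTvError Q σ τ Qhat T +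
        ∑' k : ℕ, Γ.tvError Q σ τ Qhat (T + k) / ((T + k : ℕ) : ℝ) := fun T =>
      add_nonneg (avgTvError_nonneg T)
        (tsum_nonneg fun k => div_nonneg (tvError_nonneg _) (Nat.cast_nonneg _))
    refine squeeze_zero (fun T => mul_nonneg ?_ (hnn T)) (fun T => ?_) hs
    · exact Real.iSup_nonneg fun k => avgTvError_nonneg _
    · exact mul_le_of_le_one_left (hnn T) (ciSup_le fun k => avgTvError_le_one _)
  have h3 := h1.add ((h2.add (hprod.const_mul (2 * Γ.supNorm))).const_mul (16 * Γ.supNorm))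
  simp only [mul_zero, add_zero] at h3
  refine h3.congr fun T => ?_
  rw [maximalBound]
  ring

variable [Nonempty A] [Nonempty B] [Fintype S] [MeasurableSingletonClass S] [Nonempty S]
  [StandardBorelSpace X]
  (hm : Γ.BoundedPayoff) (hCne : C.Nonempty) (hCcl : IsClosed C) (hCcv : Convex ℝ C)
include hm hCne hCcl hCcv

open Classical in
/-- The squared distance stopped when it first reaches `ε ^ 2` after round `T`. -/
theorem integral_stopped_sq_distTo_le (hB : Γ.BlackwellCondition Q C)
    (hσ : Γ.IsBlackwellStrategy C Qhat σ) {T N : ℕ} (hT : 1 ≤ T) (hN : T ≤ N) {ε : ℝ}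
    (hε : 0 < ε) :
    ∫ ω, (if ω ∈ Γ.closePlays C ε T N then Γ.distTo C ω N ^ 2 else ε ^ 2) ∂(Γ.playLaw Q σ τ) ≤
      ∫ ω, Γ.distTo C ω T ^ 2 ∂(Γ.playLaw Q σ τ) +
        ∑ t ∈ Finset.Ico T N, (Γ.constK C + 8 * t * Γ.supNorm *
          (√(∫ ω, Γ.distTo C ω t ^ 2 ∂(Γ.playLaw Q σ τ)) * Γ.tvError Q σ τ Qhat t)) /
            ((t : ℝ) + 1) ^ 2 := by
  set P := Γ.playLaw Q σ τ
  set R := Γ.supNorm + ‖proj C 0‖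
  have hdR : ∀ ω s, Γ.distTo C ω s ^ 2 ≤ R ^ 2 := fun ω s =>
    pow_le_pow_left₀ (distTo_nonneg _ _) (distTo_le hCne hCcl hCcv hm ω s) 2
  have hW : ∀ n s, Integrable (fun ω =>
      if ω ∈ Γ.closePlays C ε T n then Γ.distTo C ω s ^ 2 else ε ^ 2) P := fun n s =>
    integrable_of_bounded (Measurable.ite (measurableSet_closePlays ε T n)
      ((measurable_distTo s).pow_const 2) measurable_const) (c := max (R ^ 2) (ε ^ 2)) fun ω => by
        rw [Real.norm_of_nonneg (by split_ifs <;> positivity)]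
        split_ifs
        · exact (hdR ω s).trans (le_max_left _ _)
        · exact le_max_right _ _
  have hd2 : ∀ s, Integrable (fun ω => Γ.distTo C ω s ^ 2) P := fun s =>
    integrable_of_bounded ((measurable_distTo s).pow_const 2) (c := R ^ 2) fun ω => by
      rw [Real.norm_of_nonneg (sq_nonneg _)]
      exact hdR ω s
  induction N, hN using Nat.le_induction with
  | base =>
    simp only [Finset.Ico_self, Finset.sum_empty, add_zero]
    refine integral_mono (hW T T) (hd2 T) fun ω => ?_
    simp only
    split_ifs with h
    · exact le_rfl
    · simp only [closePlays, Set.mem_ofPred_eq, not_forall, not_lt] at h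
      obtain ⟨j, hj, hle⟩ := h
      have : (j : ℕ) = T := le_antisymm (Nat.lt_succ_iff.1 j.2) hj
      rw [this] at hle
      exact pow_le_pow_left₀ hε.le hle 2
  | succ n hn ih =>
    obtain ⟨E, hE, hEiff⟩ := exists_measurableSet_closePlays_eq Γ C ε T n
    -- The weight is the indicator that the play has not yet been stopped, an event of the first `n`
    -- rounds.
    have hrec := integral_weighted_sq_distTo_succ_le (τ := τ) hm hCne hCcl hCcv hB hσ
      (hT.trans hn) (φ := fun H => if H ∈ E then 1 else 0)
      (Measurable.ite hE measurable_const measurable_const)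
      (fun H => by split_ifs <;> norm_num) (fun H => by split_ifs <;> norm_num)
    simp only [hEiff, ite_mul, one_mul, zero_mul] at hrec
    have hsplit : ∀ s, ∫ ω, (if ω ∈ Γ.closePlays C ε T n then Γ.distTo C ω s ^ 2 else ε ^ 2) ∂P =
        ∫ ω, (if ω ∈ Γ.closePlays C ε T n then Γ.distTo C ω s ^ 2 else 0) ∂P +
          ∫ ω, (if ω ∈ Γ.closePlays C ε T n then 0 else ε ^ 2) ∂P := by
      intro s
      rw [← integral_add]
      · refine integral_congr_ae (Eventually.of_forall fun ω => ?_)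
        simp only
        split_ifs <;> simp
      · refine integrable_of_bounded (Measurable.ite (measurableSet_closePlays ε T n)
          ((measurable_distTo s).pow_const 2) measurable_const) (c := R ^ 2) fun ω => ?_
        rw [Real.norm_of_nonneg (by split_ifs <;> positivity)]
        split_ifs
        · exact hdR ω s
        · positivity
      · refine integrable_of_bounded (Measurable.ite (measurableSet_closePlays ε T n)
          measurable_const measurable_const) (c := ε ^ 2) fun ω => ?_
        rw [Real.norm_of_nonneg (by split_ifs <;> positivity)]
        split_ifs
        · positivity
        · exact le_rfl
    -- A play that leaves the neighbourhood in round `n + 1` has squared distance at least `ε²`, so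
    -- resetting the value to `ε²` can only lower it.
    have hmono : ∫ ω, (if ω ∈ Γ.closePlays C ε T (n + 1) then Γ.distTo C ω (n + 1) ^ 2
        else ε ^ 2) ∂P ≤
        ∫ ω, (if ω ∈ Γ.closePlays C ε T n then Γ.distTo C ω (n + 1) ^ 2 else ε ^ 2) ∂P := by
      refine integral_mono (hW (n + 1) (n + 1)) (hW n (n + 1)) fun ω => ?_
      have hiff := mem_closePlays_succ (Γ := Γ) (C := C) (ε := ε) (T := T) (N := n) (by omega) ω
      simp only
      by_cases h1 : ω ∈ Γ.closePlays C ε T (n + 1)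
      · rw [if_pos h1, if_pos (hiff.1 h1).1]
      · by_cases h2 : ω ∈ Γ.closePlays C ε T n
        · rw [if_neg h1, if_pos h2]
          have h3 : ε ≤ Γ.distTo C ω (n + 1) := not_lt.1 fun h => h1 (hiff.2 ⟨h2, h⟩)
          exact pow_le_pow_left₀ hε.le h3 2
        · rw [if_neg h1, if_neg h2]
    rw [Finset.sum_Ico_succ_top hn]
    rw [hsplit n] at ih
    rw [hsplit (n + 1)] at hmono
    have hpos : (0 : ℝ) < ((n : ℝ) + 1) ^ 2 := by positivity
    set I := ∫ ω, (if ω ∈ Γ.closePlays C ε T n then Γ.distTo C ω n ^ 2 else 0) ∂P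
    set I' := ∫ ω, (if ω ∈ Γ.closePlays C ε T n then Γ.distTo C ω (n + 1) ^ 2 else 0) ∂P
    have hI : 0 ≤ I := integral_nonneg fun ω => by
      simp only [Pi.zero_apply]
      split_ifs <;> positivity
    have hstep : I' ≤ I + (Γ.constK C + 8 * n * Γ.supNorm *
          (√(∫ ω, Γ.distTo C ω n ^ 2 ∂P) * Γ.tvError Q σ τ Qhat n)) / ((n : ℝ) + 1) ^ 2 := by
      rw [← sub_le_iff_le_add', le_div_iff₀ hpos]
      have : (n : ℝ) ^ 2 * I ≤ ((n : ℝ) + 1) ^ 2 * I :=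
        mul_le_mul_of_nonneg_right (by nlinarith [(Nat.cast_nonneg n : (0 : ℝ) ≤ n)]) hI
      linarith
    linarith

/-- The maximal inequality. -/
theorem measureReal_exists_le_distTo_le (hB : Γ.BlackwellCondition Q C)
    (hσ : Γ.IsBlackwellStrategy C Qhat σ) (hF : Γ.FastEstimation Q σ τ Qhat) {T : ℕ}
    (hT : 2 ≤ T) {ε : ℝ} (hε : 0 < ε) :
    (Γ.playLaw Q σ τ).real {ω | ∃ k, ε ≤ Γ.distTo C ω (T + k)} ≤
      Γ.maximalBound C Q σ τ Qhat T / ε ^ 2 := by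
  classical
  set P := Γ.playLaw Q σ τ
  have hM := Γ.supNorm_nonneg
  have hK : 0 ≤ Γ.constK C := constK_nonneg
  have hT1 : 1 ≤ T := by omega
  set s := ⨆ k : ℕ, Γ.avgTvError Q σ τ Qhat (T + k)
  have hs : ∀ t, T ≤ t → Γ.avgTvError Q σ τ Qhat t ≤ s := by
    intro t ht
    obtain ⟨k, rfl⟩ := Nat.exists_eq_add_of_le ht
    exact le_ciSup (bddAbove_avgTvError T) k
  have hs0 : 0 ≤ s := (avgTvError_nonneg T).trans (hs T le_rfl)
  set tail := ∑' k : ℕ, Γ.tvError Q σ τ Qhat (T + k) / ((T + k : ℕ) : ℝ)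
  have hrate : ∀ t : ℕ, T ≤ t → √(∫ ω, Γ.distTo C ω t ^ 2 ∂P) ≤
      √(Γ.constK C / t) + 4 * Γ.supNorm * Γ.avgTvError Q σ τ Qhat t := fun t ht =>
    sqrt_integral_sq_distTo_le hm hCne hCcl hCcv hB hσ (hT1.trans ht)
  -- Squaring the rate with `(a + b)² ≤ 2a² + 2b²` gives `2K/T` and the factor `32 = 2 · 4²`; the
  -- summed recursion contributes the third `K/T`.
  have hDT : ∫ ω, Γ.distTo C ω T ^ 2 ∂P ≤ 2 * (Γ.constK C / T) +
      32 * Γ.supNorm ^ 2 * s * Γ.avgTvError Q σ τ Qhat T := by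
    have h1 := pow_le_pow_left₀ (Real.sqrt_nonneg _) (hrate T le_rfl) 2
    rw [Real.sq_sqrt (integral_nonneg fun ω => sq_nonneg _)] at h1
    have h2 : √(Γ.constK C / T) ^ 2 = Γ.constK C / T := Real.sq_sqrt (by positivity)
    have h3 : Γ.avgTvError Q σ τ Qhat T * Γ.avgTvError Q σ τ Qhat T ≤
        s * Γ.avgTvError Q σ τ Qhat T :=
      mul_le_mul_of_nonneg_right (hs T le_rfl) (avgTvError_nonneg T)
    have h4 := mul_le_mul_of_nonneg_left h3 (by positivity : 0 ≤ 32 * Γ.supNorm ^ 2)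
    nlinarith [sq_nonneg (√(Γ.constK C / T) - 4 * Γ.supNorm * Γ.avgTvError Q σ τ Qhat T)]
  have hfin : ∀ N, T ≤ N → P.real (Γ.closePlays C ε T N)ᶜ ≤
      Γ.maximalBound C Q σ τ Qhat T / ε ^ 2 := by
    intro N hN
    rw [le_div_iff₀ (by positivity)]
    have h1 := integral_stopped_sq_distTo_le (τ := τ) hm hCne hCcl hCcv hB hσ hT1 hN hε
    have h2 := sum_recursion_error_le (δ := Γ.tvError Q σ τ Qhat) hK hM hT hN (fun t => tvError_nonneg t)
      (fun t => tvError_le_one t) hs hrate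
    have h3 : ∑ t ∈ Finset.Ico T N, Γ.tvError Q σ τ Qhat t / t ≤ tail := by
      rw [Finset.sum_Ico_eq_sum_range]
      refine Summable.sum_le_tsum (f := fun k : ℕ =>
        Γ.tvError Q σ τ Qhat (T + k) / ((T + k : ℕ) : ℝ)) _
        (fun k _ => div_nonneg (tvError_nonneg _) (Nat.cast_nonneg _)) ?_
      have := (summable_nat_add_iff T).2 (summable_tvError_div hF)
      exact this.congr fun k => by rw [add_comm]
    have h4 := mul_le_mul_of_nonneg_left h3 (by positivity : 0 ≤ 32 * Γ.supNorm ^ 2 * s)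
    -- Markov's inequality: the stopped value is `ε²` on the stopped plays and nonnegative
    -- elsewhere.
    have h5 : P.real (Γ.closePlays C ε T N)ᶜ * ε ^ 2 ≤
        ∫ ω, (if ω ∈ Γ.closePlays C ε T N then Γ.distTo C ω N ^ 2 else ε ^ 2) ∂P := by
      have hms := measurableSet_closePlays (Γ := Γ) (C := C) ε T N
      rw [← smul_eq_mul, ← integral_indicator_const _ hms.compl]
      refine integral_mono ((integrable_const _).indicator hms.compl) ?_ fun ω => ?_
      · refine integrable_of_bounded (Measurable.ite hms ((measurable_distTo N).pow_const 2)
          measurable_const) (c := max ((Γ.supNorm + ‖proj C 0‖) ^ 2) (ε ^ 2)) fun ω => ?_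
        rw [Real.norm_of_nonneg (by split_ifs <;> positivity)]
        split_ifs
        · exact (pow_le_pow_left₀ (distTo_nonneg _ _)
            (distTo_le hCne hCcl hCcv hm ω N) 2).trans (le_max_left _ _)
        · exact le_max_right _ _
      · by_cases h : ω ∈ Γ.closePlays C ε T N
        · simp [h, sq_nonneg]
        · simp [h]
    have h6 : Γ.maximalBound C Q σ τ Qhat T = 3 * (Γ.constK C / T) +
        16 * Γ.supNorm * √(Γ.constK C / (T - 1)) +
        32 * Γ.supNorm ^ 2 * s * Γ.avgTvError Q σ τ Qhat T +
        32 * Γ.supNorm ^ 2 * s * tail := by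
      rw [maximalBound]
      ring
    rw [h6]
    linarith
  have hmono : Monotone fun k => (Γ.closePlays C ε T (T + k))ᶜ := by
    refine monotone_nat_of_le_succ fun k => Set.compl_subset_compl.2 fun ω hω => ?_
    exact ((mem_closePlays_succ (N := T + k) (by omega) ω).1 hω).1
  have hunion : {ω | ∃ k, ε ≤ Γ.distTo C ω (T + k)} = ⋃ k, (Γ.closePlays C ε T (T + k))ᶜ := by
    ext ω
    simp only [Set.mem_ofPred_eq, Set.mem_iUnion, Set.mem_compl_iff, closePlays, not_forall,
      not_lt]
    constructor
    · rintro ⟨k, hk⟩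
      exact ⟨k, Fin.last _, by simp, hk⟩
    · rintro ⟨k, j, hj, hle⟩
      refine ⟨j - T, ?_⟩
      rwa [Nat.add_sub_cancel' hj]
  have hlim := tendsto_measure_iUnion_atTop (μ := P) hmono
  rw [← hunion] at hlim
  have hlim' := (ENNReal.tendsto_toReal (measure_ne_top P _)).comp hlim
  exact le_of_tendsto' hlim' fun k => hfin (T + k) (Nat.le_add_right T k)

/-- The maximal inequality for the supremum of the late distances. -/
theorem measureReal_le_iSup_distTo_le (hB : Γ.BlackwellCondition Q C)
    (hσ : Γ.IsBlackwellStrategy C Qhat σ) (hF : Γ.FastEstimation Q σ τ Qhat) {T : ℕ}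
    (hT : 2 ≤ T) {ε : ℝ} (hε : 0 < ε) :
    (Γ.playLaw Q σ τ).real {ω | ε ≤ ⨆ k : ℕ, Γ.distTo C ω (T + k)} ≤
      Γ.maximalBound C Q σ τ Qhat T / ε ^ 2 := by
  -- The supremum can equal `ε` without any distance reaching `ε`, so the inequality is applied at
  -- levels `ε' < ε`, followed by `ε' ↑ ε`.
  have hlt : ∀ ε' ∈ Set.Ioo 0 ε,
      (Γ.playLaw Q σ τ).real {ω | ε ≤ ⨆ k : ℕ, Γ.distTo C ω (T + k)} ≤
        Γ.maximalBound C Q σ τ Qhat T / ε' ^ 2 := by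
    intro ε' hε'
    refine le_trans (measureReal_mono ?_)
      (measureReal_exists_le_distTo_le hm hCne hCcl hCcv hB hσ hF hT hε'.1)
    intro ω hω
    obtain ⟨k, hk⟩ := exists_lt_of_lt_ciSup (lt_of_lt_of_le hε'.2 hω)
    exact ⟨k, hk.le⟩
  have hcont : Tendsto (fun ε' : ℝ => Γ.maximalBound C Q σ τ Qhat T / ε' ^ 2) (𝓝[<] ε)
      (𝓝 (Γ.maximalBound C Q σ τ Qhat T / ε ^ 2)) := by
    refine Tendsto.mono_left ?_ nhdsWithin_le_nhds
    exact (continuousAt_const.div (continuousAt_id.pow 2) (pow_ne_zero 2 hε.ne')).tendsto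
  refine ge_of_tendsto hcont ?_
  filter_upwards [Ioo_mem_nhdsLT hε] with ε' hε' using hlt ε' hε'

/-- Returning infinitely often to distance `1/(n+1)` implies a deviation after every `T`; the
probabilities of such deviations tend to 0, and countably many levels suffice. -/
theorem approaches_of_isBlackwellStrategy (hB : Γ.BlackwellCondition Q C)
    (hσ : Γ.IsBlackwellStrategy C Qhat σ) (hF : Γ.FastEstimation Q σ τ Qhat) :
    Γ.Approaches Q C σ τ := by
  have hzero : ∀ n : ℕ, ∀ᵐ ω ∂(Γ.playLaw Q σ τ),
      ¬ ∀ T, ∃ k, 1 / ((n : ℝ) + 1) ≤ Γ.distTo C ω (T + k) := by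
    intro n
    set ε : ℝ := 1 / ((n : ℝ) + 1)
    have hε : 0 < ε := by positivity
    have hle : ∀ T : ℕ, 2 ≤ T →
        (Γ.playLaw Q σ τ).real {ω | ∀ T, ∃ k, ε ≤ Γ.distTo C ω (T + k)} ≤
          Γ.maximalBound C Q σ τ Qhat T / ε ^ 2 := fun T hT =>
      (measureReal_mono (by intro ω hω; exact hω T)).trans
        (measureReal_exists_le_distTo_le hm hCne hCcl hCcv hB hσ hF hT hε)
    have hlim : Tendsto (fun T => Γ.maximalBound C Q σ τ Qhat T / ε ^ 2) atTop (𝓝 0) := by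
      simpa using (tendsto_maximalBound (C := C) hF).div_const (ε ^ 2)
    have h0 : (Γ.playLaw Q σ τ).real {ω | ∀ T, ∃ k, ε ≤ Γ.distTo C ω (T + k)} ≤ 0 :=
      ge_of_tendsto hlim ((eventually_ge_atTop 2).mono hle)
    have h1 := le_antisymm h0 measureReal_nonneg
    rw [measureReal_eq_zero_iff] at h1
    rw [ae_iff]
    simpa using h1
  unfold Approaches
  filter_upwards [ae_all_iff.2 hzero] with ω hω
  rw [Metric.tendsto_atTop]
  intro ε hε
  obtain ⟨n, hn⟩ := exists_nat_one_div_lt hε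
  have h := hω n
  push Not at h
  obtain ⟨T, hT⟩ := h
  refine ⟨T, fun t ht => ?_⟩
  obtain ⟨k, rfl⟩ := Nat.exists_eq_add_of_le ht
  rw [dist_zero_right, Real.norm_of_nonneg (distTo_nonneg _ _)]
  exact (hT k).trans hn

end Game

/-! ### Simplex-valued functions in `L²` -/

section SimplexValued

variable {X A : Type*} [MeasurableSpace X] [Fintype A]

/-- The probability vectors, as a subset of the Euclidean space. -/
def euclideanSimplex (A : Type*) [Fintype A] : Set (EuclideanSpace ℝ A) :=
  {v | (fun a => v a) ∈ stdSimplex ℝ A}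

theorem isClosed_euclideanSimplex : IsClosed (euclideanSimplex A) := by
  have h : Continuous fun v : EuclideanSpace ℝ A => fun a => v a := by fun_prop
  exact (isCompact_stdSimplex ℝ A).isClosed.preimage h

theorem convex_euclideanSimplex : Convex ℝ (euclideanSimplex A) :=
  fun _ hv _ hw _ _ ha hb hab => convex_stdSimplex ℝ A hv hw ha hb hab

theorem norm_le_one_of_mem_euclideanSimplex {v : EuclideanSpace ℝ A}
    (hv : v ∈ euclideanSimplex A) : ‖v‖ ≤ 1 := by
  have h : ‖v‖ ^ 2 ≤ 1 := by
    rw [EuclideanSpace.norm_sq_eq]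
    calc ∑ a, ‖v a‖ ^ 2 ≤ ∑ a, v a := by
          refine Finset.sum_le_sum fun a _ => ?_
          have h1 := mem_Icc_of_mem_stdSimplex hv a
          rw [Real.norm_of_nonneg h1.1]
          exact pow_le_of_le_one h1.1 h1.2 two_ne_zero
      _ = 1 := hv.2
  exact (sq_le_one_iff₀ (norm_nonneg v)).1 h

/-- The square-integrable functions with values in the probability vectors. -/
def simplexValued (A : Type*) [Fintype A] (μ : Measure X) :
    Set (Lp (EuclideanSpace ℝ A) 2 μ) :=
  {f | ∀ᵐ x ∂μ, f x ∈ euclideanSimplex A}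

variable (μ : Measure X)

/-- `L²` convergence gives almost everywhere convergence along a subsequence, and the simplex is
closed. -/
theorem isClosed_simplexValued : IsClosed (simplexValued A μ) := by
  refine IsSeqClosed.isClosed fun f g hf hlim => ?_
  obtain ⟨ns, -, hns⟩ :=
    (tendstoInMeasure_of_tendsto_Lp hlim).exists_seq_tendsto_ae
  filter_upwards [ae_all_iff.2 hf, hns] with x hx hlim'
  exact isClosed_euclideanSimplex.mem_of_tendsto hlim' (Eventually.of_forall fun n => hx _)

theorem convex_simplexValued : Convex ℝ (simplexValued A μ) := by
  intro f hf g hg a b ha hb hab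
  filter_upwards [hf, hg, Lp.coeFn_add (a • f) (b • g), Lp.coeFn_smul a f, Lp.coeFn_smul b g]
    with x h1 h2 h3 h4 h5
  rw [h3, Pi.add_apply, h4, h5]
  exact convex_euclideanSimplex h1 h2 ha hb hab

theorem isBounded_simplexValued [IsProbabilityMeasure μ] : Bornology.IsBounded (simplexValued A μ) := by
  refine isBounded_iff_forall_norm_le.2 ⟨1, fun f hf => ?_⟩
  have hb : ∀ᵐ x ∂μ, ‖f x‖ ≤ 1 := by
    filter_upwards [hf] with x hx using norm_le_one_of_mem_euclideanSimplex hx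
  simpa [measureUnivNNReal] using Lp.norm_le_of_ae_bound zero_le_one hb

/-- The integral of a combination of bounded vector functions with square-integrable
coefficients, as a continuous linear map of the coefficients. -/
theorem exists_integral_sum_smul {Z F : Type*} [MeasurableSpace Z] [NormedAddCommGroup F]
    [NormedSpace ℝ F] {ρ : Measure Z} [IsProbabilityMeasure ρ] {g : Z → X} (hg : Measurable g)
    {m : A → Z → F} (hm : ∀ a, AEStronglyMeasurable (m a) ρ) {M : ℝ}
    (hM : ∀ a z, ‖m a z‖ ≤ M) :
    ∃ L : Lp (EuclideanSpace ℝ A) 2 (ρ.map g) →L[ℝ] F,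
      ∀ f, L f = ∫ z, ∑ a, (f (g z) a) • m a z ∂ρ := by
  have hprob : IsProbabilityMeasure (ρ.map g) := Measure.isProbabilityMeasure_map hg.aemeasurable
  have hnorm : ∀ f : Lp (EuclideanSpace ℝ A) 2 (ρ.map g),
      Integrable (fun z => ‖f (g z)‖) ρ := fun f =>
    (((Lp.memLp f).integrable one_le_two).comp_measurable hg).norm
  have hpt : ∀ (f : Lp (EuclideanSpace ℝ A) 2 (ρ.map g)) z,
      ‖∑ a, (f (g z) a) • m a z‖ ≤ (Fintype.card A * M) * ‖f (g z)‖ := by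
    intro f z
    calc ‖∑ a, (f (g z) a) • m a z‖ ≤ ∑ _a : A, ‖f (g z)‖ * M := by
          refine (norm_sum_le _ _).trans (Finset.sum_le_sum fun a _ => ?_)
          rw [norm_smul]
          exact mul_le_mul (PiLp.norm_apply_le _ a) (hM a z) (norm_nonneg _) (norm_nonneg _)
      _ = _ := by
          rw [Finset.sum_const, Finset.card_univ, nsmul_eq_mul]
          ring
  have hint : ∀ f : Lp (EuclideanSpace ℝ A) 2 (ρ.map g),
      Integrable (fun z => ∑ a, (f (g z) a) • m a z) ρ := by
    intro f
    refine ((hnorm f).const_mul (Fintype.card A * M)).mono' ?_ (Eventually.of_forall (hpt f))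
    refine Finset.aestronglyMeasurable_fun_sum _ fun a _ => AEStronglyMeasurable.smul ?_ (hm a)
    have h1 : Measurable fun v : EuclideanSpace ℝ A => v a := by fun_prop
    exact (h1.comp ((Lp.stronglyMeasurable f).measurable.comp hg)).aestronglyMeasurable
  let L₀ : Lp (EuclideanSpace ℝ A) 2 (ρ.map g) →ₗ[ℝ] F :=
    { toFun := fun f => ∫ z, ∑ a, (f (g z) a) • m a z ∂ρ
      map_add' := by
        intro f f'
        rw [← integral_add (hint f) (hint f')]
        refine integral_congr_ae ?_
        filter_upwards [ae_of_ae_map hg.aemeasurable (Lp.coeFn_add f f')] with z hz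
        simp only [hz, Pi.add_apply, PiLp.add_apply, add_smul, Finset.sum_add_distrib]
      map_smul' := by
        intro c f
        rw [RingHom.id_apply, ← integral_smul]
        refine integral_congr_ae ?_
        filter_upwards [ae_of_ae_map hg.aemeasurable (Lp.coeFn_smul c f)] with z hz
        simp only [hz, Pi.smul_apply, PiLp.smul_apply, smul_eq_mul, mul_smul, Finset.smul_sum] }
  refine ⟨L₀.mkContinuous (Fintype.card A * M) fun f => ?_, fun f => rfl⟩
  have hM0 : 0 ≤ Fintype.card A * M := by
    rcases isEmpty_or_nonempty A with hA | ⟨⟨a⟩⟩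
    · simp
    · have : Nonempty Z := ρ.nonempty_of_neZero
      exact mul_nonneg (Nat.cast_nonneg _) ((norm_nonneg _).trans (hM a (Classical.arbitrary Z)))
  calc ‖L₀ f‖ ≤ ∫ z, (Fintype.card A * M) * ‖f (g z)‖ ∂ρ :=
        norm_integral_le_of_norm_le ((hnorm f).const_mul _) (Eventually.of_forall (hpt f))
    _ = (Fintype.card A * M) * ∫ x, ‖f x‖ ∂(ρ.map g) := by
        rw [integral_const_mul, integral_map hg.aemeasurable
          (Lp.aestronglyMeasurable f).norm]
    -- Under a probability measure the `L¹` norm is at most the `L²` norm.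
    _ ≤ (Fintype.card A * M) * ‖f‖ := by
        refine mul_le_mul_of_nonneg_left ?_ hM0
        rw [integral_norm_eq_lintegral_enorm (Lp.aestronglyMeasurable f),
          ← eLpNorm_one_eq_lintegral_enorm, Lp.norm_def]
        exact ENNReal.toReal_mono (Lp.eLpNorm_ne_top f)
          (eLpNorm_le_eLpNorm_of_exponent_le one_le_two (Lp.aestronglyMeasurable f))

end SimplexValued

/-! ### Necessity of the Blackwell condition -/

namespace Game

variable {A B X S : Type*} [Fintype A] [MeasurableSpace A] [MeasurableSingletonClass A]
  [Fintype B] [MeasurableSpace B] [MeasurableSingletonClass B]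
  [MeasurableSpace X] [MeasurableSpace S] {d : ℕ} {Γ : Game A B X S d}
  {C : Set (EuclideanSpace ℝ (Fin d))}

/-- The expected payoffs that the Player can obtain against a given family of Nature form a
closed convex set. -/
theorem convex_isClosed_range_expectedPayoff [Nonempty A] (hm : Γ.BoundedPayoff)
    (Q : Measure (X × S)) [IsProbabilityMeasure Q] (q : MeasFamily (X ⊕ (X × S)) B) :
    Convex ℝ (Set.range fun p : MeasFamily X A => Γ.expectedPayoff Q p q) ∧
      IsClosed (Set.range fun p : MeasFamily X A => Γ.expectedPayoff Q p q) := by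
  classical
  have := q.2
  let m : A → X × S → EuclideanSpace ℝ (Fin d) := fun a z =>
    ∑ b, (q.1 (Γ.G.obs z)).real {b} • Γ.payoff a b z.1 z.2
  have hmm : ∀ a, Measurable (m a) := fun a => Finset.measurable_sum _ fun b _ =>
    ((measurable_kernel_real q.1 b).comp Γ.G.measurable_obs).smul (Γ.measurable_payoff a b)
  have hmM : ∀ a z, ‖m a z‖ ≤ Γ.supNorm := by
    intro a z
    have hq := real_singleton_mem_stdSimplex (q.1 (Γ.G.obs z))
    calc ‖m a z‖ ≤ ∑ b, (q.1 (Γ.G.obs z)).real {b} * ‖Γ.payoff a b z.1 z.2‖ := by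
          refine (norm_sum_le _ _).trans (Finset.sum_le_sum fun b _ => ?_)
          rw [norm_smul, Real.norm_of_nonneg (hq.1 b)]
      _ ≤ Γ.supNorm := sum_stdSimplex_mul_le hq fun b => norm_payoff_le_supNorm hm _ _ _ _
  obtain ⟨L, hL⟩ := exists_integral_sum_smul (ρ := Q) measurable_fst
    (fun a => (hmm a).aestronglyMeasurable) hmM
  have hprob : IsProbabilityMeasure (Q.map Prod.fst) :=
    Measure.isProbabilityMeasure_map measurable_fst.aemeasurable
  have hmix : ∀ (p : MeasFamily X A) (z : X × S),
      Γ.mixedPayoff (p.1 z.1) (q.1 (Γ.G.obs z)) z.1 z.2 =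
        ∑ a, (p.1 z.1).real {a} • m a z := by
    intro p z
    simp only [mixedPayoff, m, Finset.smul_sum, smul_smul]
  have hrange : (Set.range fun p : MeasFamily X A => Γ.expectedPayoff Q p q) =
      L '' simplexValued A (Q.map Prod.fst) := by
    apply Set.Subset.antisymm
    · rintro _ ⟨p, rfl⟩
      have := p.2
      let f : X → EuclideanSpace ℝ A := fun x => WithLp.toLp 2 fun a => (p.1 x).real {a}
      have hf : Measurable f := (WithLp.measurable_toLp 2 _).comp
        (measurable_pi_lambda _ fun a => measurable_kernel_real p.1 a)
      have hfs : ∀ x, f x ∈ euclideanSimplex A := fun x =>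
        real_singleton_mem_stdSimplex (p.1 x)
      have hfL : MemLp f 2 (Q.map Prod.fst) :=
        MemLp.of_bound hf.aestronglyMeasurable 1
          (Eventually.of_forall fun x => norm_le_one_of_mem_euclideanSimplex (hfs x))
      refine ⟨hfL.toLp f, ?_, ?_⟩
      · filter_upwards [hfL.coeFn_toLp] with x hx
        rw [hx]
        exact hfs x
      · rw [hL]
        refine integral_congr_ae ?_
        filter_upwards [ae_of_ae_map measurable_fst.aemeasurable hfL.coeFn_toLp] with z hz
        rw [hmix, hz]
    · rintro _ ⟨f, hf, rfl⟩
      let p₀ : A → ℝ := Pi.single (Classical.arbitrary A) 1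
      have hcoord : Measurable fun v : EuclideanSpace ℝ A => fun a => v a :=
        Continuous.measurable (by fun_prop)
      have hfm : Measurable f := (Lp.stronglyMeasurable f).measurable
      -- An `L²` class takes values in the simplex only almost everywhere; a fixed vertex on the
      -- exceptional null set gives a genuine family.
      let p : X → A → ℝ := fun x => if f x ∈ euclideanSimplex A then fun a => f x a else p₀
      have hp : Measurable p := Measurable.ite
        (hfm isClosed_euclideanSimplex.measurableSet) (hcoord.comp hfm) measurable_const
      have hps : ∀ x, p x ∈ stdSimplex ℝ A := by
        intro x
        simp only [p]
        split_ifs with h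
        · exact h
        · exact single_mem_stdSimplex ℝ _
      refine ⟨simplexFamily p hp hps, ?_⟩
      rw [hL]
      refine integral_congr_ae ?_
      filter_upwards [ae_of_ae_map measurable_fst.aemeasurable hf] with z hz
      rw [hmix]
      refine Finset.sum_congr rfl fun a _ => ?_
      have h1 : ((simplexFamily p hp hps).1 z.1).real {a} = p z.1 a :=
        simplexKernel_real_singleton p hp hps z.1 a
      rw [h1]
      simp only [p, if_pos hz]
  rw [hrange]
  exact ⟨(convex_simplexValued _).is_linear_image L.isBoundedLinearMap.toIsLinearMap,
    isClosed_image_of_convex L (isClosed_simplexValued _) (convex_simplexValued _)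
      (isBounded_simplexValued _)⟩

/-- The vector identity is tested against each constant direction, where the scalar identity
`integral_inner_roundPayoff` applies. -/
theorem integral_roundPayoff_playLaw (hm : Γ.BoundedPayoff) (Q : Measure (X × S))
    [IsProbabilityMeasure Q] (σ : PlayerStrategy A X S d) (τ : NatureStrategy A B X S) (t : ℕ) :
    ∫ ω, Γ.roundPayoff (ω t) ∂(Γ.playLaw Q σ τ) =
      ∫ ω, Γ.expectedPayoff Q (playerFamily σ (Γ.playerHistory ω t))
        (natureFamily τ (fullHistory t ω)) ∂(Γ.playLaw Q σ τ) ∧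
    Integrable (fun ω => Γ.expectedPayoff Q (playerFamily σ (Γ.playerHistory ω t))
        (natureFamily τ (fullHistory t ω))) (Γ.playLaw Q σ τ) ∧
    Integrable (fun ω => Γ.roundPayoff (ω t)) (Γ.playLaw Q σ τ) := by
  have h1 : Integrable (fun ω => Γ.roundPayoff (ω t)) (Γ.playLaw Q σ τ) :=
    integrable_of_bounded (measurable_roundPayoff.comp (measurable_pi_apply t))
      fun ω => norm_roundPayoff_le hm _
  have h2 : Integrable (fun ω => Γ.expectedPayoff Q (playerFamily σ (Γ.playerHistory ω t))
      (natureFamily τ (fullHistory t ω))) (Γ.playLaw Q σ τ) :=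
    integrable_of_bounded ((measurable_expectedPayoff_families Q σ τ hm t).comp
      (measurable_fullHistory t)) fun ω => norm_expectedPayoff_le hm _ _ _
  refine ⟨ext_inner_left ℝ fun u => ?_, h2, h1⟩
  rw [← integral_inner h1, ← integral_inner h2]
  exact integral_inner_roundPayoff Q σ τ hm t (ψ := fun _ => u) measurable_const
    (fun _ => le_rfl)

/-- The Blackwell condition is necessary for approachability. -/
theorem blackwellCondition_of_approachable [Nonempty A] (hm : Γ.BoundedPayoff)
    (hCne : C.Nonempty) (hCcl : IsClosed C) (hCcv : Convex ℝ C) {Q : Measure (X × S)}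
    [IsProbabilityMeasure Q] (h : Γ.Approachable Q C) : Γ.BlackwellCondition Q C := by
  obtain ⟨σ, hσ⟩ := h
  intro q
  have := q.2
  -- Nature plays `q` in every round
  let κ : ∀ t, Kernel (FullHistory A B X S t × (X ⊕ (X × S))) B := fun t =>
    q.1.comap Prod.snd measurable_snd
  have hκ : ∀ t, IsMarkovKernel (κ t) := fun t => by
    unfold κ
    infer_instance
  let τ : NatureStrategy A B X S := fun t => ⟨κ t, hκ t⟩
  have hτ : ∀ t (H : FullHistory A B X S t), natureFamily τ H = q := fun t H =>
    Subtype.ext (Kernel.ext fun _ => rfl)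
  have happ := hσ τ
  unfold Approaches at happ
  set P := Γ.playLaw Q σ τ
  obtain ⟨hRcv, hRcl⟩ := convex_isClosed_range_expectedPayoff (Γ := Γ) hm Q q
  set R := Set.range fun p : MeasFamily X A => Γ.expectedPayoff Q p q
  -- Given the history, the mean payoff lies in `R` because Nature's family is always `q`; averaging
  -- over histories stays in `R` because it is closed and convex.
  have hround : ∀ t, ∫ ω, Γ.roundPayoff (ω t) ∂P ∈ R := by
    intro t
    obtain ⟨h1, h2, -⟩ := integral_roundPayoff_playLaw hm Q σ τ t
    rw [h1]
    refine hRcv.integral_mem hRcl (Eventually.of_forall fun ω => ?_) h2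
    rw [hτ]
    exact ⟨_, rfl⟩
  let x : ℕ → EuclideanSpace ℝ (Fin d) := fun T =>
    ∫ ω, avgPayoff (Γ.playerHistory ω (T + 1)) ∂P
  have hxR : ∀ T, x T ∈ R := by
    intro T
    have : x T = ∑ i ∈ Finset.range (T + 1), ((T + 1 : ℕ) : ℝ)⁻¹ •
        ∫ ω, Γ.roundPayoff (ω i) ∂P := by
      simp only [x, avgPayoff_playerHistory]
      rw [integral_smul, integral_finsetSum _ fun i _ =>
        (integral_roundPayoff_playLaw hm Q σ τ i).2.2, Finset.smul_sum]
    rw [this]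
    refine hRcv.sum_mem (fun i _ => by positivity) ?_ fun i _ => hround i
    rw [Finset.sum_const, Finset.card_range, nsmul_eq_mul,
      mul_inv_cancel₀ (Nat.cast_ne_zero.2 (by omega))]
  let c : ℕ → EuclideanSpace ℝ (Fin d) := fun T =>
    ∫ ω, proj C (avgPayoff (Γ.playerHistory ω (T + 1))) ∂P
  have hmavg : ∀ T, Measurable fun ω : ℕ → Round A B X S =>
      avgPayoff (Γ.playerHistory ω T) := fun T =>
    measurable_avgPayoff.comp (measurable_playerHistory T)
  have hiavg : ∀ T, Integrable (fun ω => avgPayoff (Γ.playerHistory ω T)) P := fun T =>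
    integrable_of_bounded (hmavg T) fun ω => norm_avgPayoff_le hm ω T
  have hiproj : ∀ T, Integrable (fun ω => proj C (avgPayoff (Γ.playerHistory ω T))) P := fun T =>
    integrable_of_bounded ((lipschitzWith_proj hCne hCcl hCcv).continuous.measurable.comp
      (hmavg T)) (c := ‖proj C 0‖ + Γ.supNorm) fun ω =>
      (norm_proj_le hCne hCcl hCcv _).trans (add_le_add le_rfl (norm_avgPayoff_le hm ω T))
  have hcC : ∀ T, c T ∈ C := fun T =>
    hCcv.integral_mem hCcl (Eventually.of_forall fun ω => proj_mem hCne hCcl hCcv _)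
      (hiproj (T + 1))
  -- Distances are uniformly bounded, so almost sure convergence passes to expectations and `x T - c
  -- T` vanishes.
  have hd0 : Tendsto (fun T => ∫ ω, Γ.distTo C ω T ∂P) atTop (𝓝 0) := by
    have := tendsto_integral_of_dominated_convergence (μ := P)
      (F := fun T ω => Γ.distTo C ω T) (f := fun _ => 0) (fun _ => Γ.supNorm + ‖proj C 0‖)
      (fun T => (measurable_distTo T).aestronglyMeasurable) (integrable_const _)
      (fun T => Eventually.of_forall fun ω => by
        rw [Real.norm_of_nonneg (distTo_nonneg _ _)]
        exact distTo_le hCne hCcl hCcv hm ω T) happ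
    simpa using this
  have hxc : Tendsto (fun T => x T - c T) atTop (𝓝 0) := by
    refine squeeze_zero_norm (fun T => ?_) (hd0.comp (tendsto_add_atTop_nat 1))
    simp only [x, c]
    rw [← integral_sub (hiavg (T + 1)) (hiproj (T + 1))]
    refine (norm_integral_le_integral_norm _).trans (le_of_eq ?_)
    exact integral_congr_ae (Eventually.of_forall fun ω =>
      (distTo_eq_norm hCne hCcl hCcv ω (T + 1)).symm)
  have hRbdd : Bornology.IsBounded R :=
    isBounded_iff_forall_norm_le.2 ⟨Γ.supNorm, by
      rintro _ ⟨p, rfl⟩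
      exact norm_expectedPayoff_le hm Q p q⟩
  obtain ⟨r, hr, φ, hφ, hlim⟩ :=
    (Metric.isCompact_of_isClosed_isBounded hRcl hRbdd).tendsto_subseq hxR
  obtain ⟨p, hp⟩ := hr
  refine ⟨p, ?_⟩
  have hclim : Tendsto (fun n => c (φ n)) atTop (𝓝 r) := by
    have := hlim.sub (hxc.comp hφ.tendsto_atTop)
    simpa using this
  have hrC := hCcl.mem_of_tendsto hclim (Eventually.of_forall fun n => hcC _)
  simp only at hp
  rw [hp]
  exact hrC

end Game

end FairApproach

/-! ### The main theorem -/

open MeasureTheory FairApproach in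
theorem theorem1 {A B X S : Type*}
    [Fintype A] [Nonempty A] [MeasurableSpace A] [MeasurableSingletonClass A]
    [Fintype B] [Nonempty B] [MeasurableSpace B] [MeasurableSingletonClass B]
    [MeasurableSpace X] [StandardBorelSpace X]
    [Fintype S] [MeasurableSpace S] [MeasurableSingletonClass S]
    {d : ℕ} (Γ : Game A B X S d) (hm : Γ.BoundedPayoff)
    (Q : Measure (X × S)) [IsProbabilityMeasure Q]
    (C : Set (EuclideanSpace ℝ (Fin d))) (hCne : C.Nonempty) (hCcl : IsClosed C)
    (hCcv : Convex ℝ C) :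
    -- characterization of approachability
    (Γ.Approachable Q C ↔ Γ.BlackwellCondition Q C) ∧
    -- for all adapted estimates and any first family, a plug-in Blackwell strategy exists
    (∀ (Qhat : Estimator X S d) (p₁ : MeasFamily X A),
      ∃ σ : PlayerStrategy A X S d, Γ.IsBlackwellStrategy C Qhat σ ∧
        ∀ h : PlayerHistory X S d 0, Game.playerFamily σ h = p₁) ∧
    -- under the Blackwell condition, every such strategy achieves the rates
    (Γ.BlackwellCondition Q C →
      ∀ (Qhat : Estimator X S d) (σ : PlayerStrategy A X S d),
        Γ.IsBlackwellStrategy C Qhat σ →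
        ∀ τ : NatureStrategy A B X S, Γ.FastEstimation Q σ τ Qhat →
          Γ.Approaches Q C σ τ ∧
          (∀ T : ℕ, 1 ≤ T →
            √(∫ ω, Γ.distTo C ω T ^ 2 ∂(Γ.playLaw Q σ τ)) ≤
              √(Γ.constK C / T) + 4 * Γ.supNorm * Γ.avgTvError Q σ τ Qhat T) ∧
          (∀ T : ℕ, 2 ≤ T → ∀ ε : ℝ, 0 < ε →
            (Γ.playLaw Q σ τ).real {ω | ε ≤ ⨆ k : ℕ, Γ.distTo C ω (T + k)} ≤
              3 * Γ.constK C / (T * ε ^ 2) +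
                16 * Γ.supNorm / ε ^ 2 *
                  (√(Γ.constK C / (T - 1)) +
                    2 * Γ.supNorm * (⨆ k : ℕ, Γ.avgTvError Q σ τ Qhat (T + k)) *
                      (Γ.avgTvError Q σ τ Qhat T +
                        ∑' k : ℕ, Γ.tvError Q σ τ Qhat (T + k) / ((T + k : ℕ) : ℝ))))) := by
  -- `S` is not assumed nonempty; a probability measure on `X × S` forces it.
  have hXS : Nonempty (X × S) := Q.nonempty_of_neZero
  have : Nonempty S := hXS.map Prod.snd
  have hrates : Γ.BlackwellCondition Q C →
      ∀ (Qhat : Estimator X S d) (σ : PlayerStrategy A X S d),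
        Γ.IsBlackwellStrategy C Qhat σ →
        ∀ τ : NatureStrategy A B X S, Γ.FastEstimation Q σ τ Qhat → Γ.Approaches Q C σ τ :=
    fun hB Qhat σ hσ τ hF =>
      Game.approaches_of_isBlackwellStrategy hm hCne hCcl hCcv hB hσ hF
  refine ⟨⟨fun h => Game.blackwellCondition_of_approachable hm hCne hCcl hCcv h, fun hB => ?_⟩,
    fun Qhat p₁ => Game.exists_isBlackwellStrategy hm hCne hCcl hCcv Qhat p₁,
    fun hB Qhat σ hσ τ hF => ⟨hrates hB Qhat σ hσ τ hF, fun T hT =>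
      Game.sqrt_integral_sq_distTo_le hm hCne hCcl hCcv hB hσ hT, fun T hT ε hε => ?_⟩⟩
  · -- the context distribution is known, so that the estimates may be taken exact
    let Qhat : Estimator X S d := fun t => ⟨ProbabilityTheory.Kernel.const _ Q, inferInstance⟩
    obtain ⟨p₁⟩ := Game.nonempty_measFamily (Y := X) (Z := A)
    obtain ⟨σ, hσ, -⟩ := Game.exists_isBlackwellStrategy hm hCne hCcl hCcv Qhat p₁
    refine ⟨σ, fun τ => hrates hB Qhat σ hσ τ ?_⟩
    have h0 : ∀ t, Γ.tvError Q σ τ Qhat t = 0 := by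
      intro t
      have h1 : ∀ h : PlayerHistory X S d t, tvDist ((Qhat t).1 h) Q = 0 := fun h =>
        tvDist_self Q
      simp only [Game.tvError, h1]
      simp
    unfold Game.FastEstimation
    simp only [h0, zero_div]
    exact summable_zero
  · refine (Game.measureReal_le_iSup_distTo_le hm hCne hCcl hCcv hB hσ hF hT hε).trans
      (le_of_eq ?_)
    have hT0 : (T : ℝ) ≠ 0 := Nat.cast_ne_zero.2 (by omega)
    have h3 : 3 * Γ.constK C / (T * ε ^ 2) = 3 * Γ.constK C / T / ε ^ 2 := by
      rw [div_div]
    rw [Game.maximalBound, h3, add_div]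
    congr 1
    ring
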